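/- **Proposition.** Let $k$ be a commutative ring. A *bicomplex* $X$ consists of $k$-modules $X_{p,q}$, $p\ge 0$, $q\in\mathbb Z$ (put $X_{p,q}=0$ for $p<0$), with differentials $d_h\colon X_{p,q}\to X_{p-1,q}$ and $d_v\colon X_{p,q}\to X_{p,q-1}$ such that $d_h^2=0$, $d_v^2=0$ and $d_hd_v+d_vd_h=0$; morphisms are families of $k$-linear maps $X_{p,q}\to Y_{p,q}$ commuting with $d_h$ and $d_v$. Let $\operatorname{bCh}$ be the category of bicomplexes, with the symmetric monoidal structure $$(X\otimes Y)_{p,q}=\bigoplus_{m+s=p,\;n+t=q}X_{m,n}\otimes_k Y_{s,t},$$ $$d_h(x\otimes y)=d_hx\otimes y+(-1)^{|x|}x\otimes d_hy,\qquad d_v(x\otimes y)=d_vx\otimes y+(-1)^{|x|}x\otimes d_vy,$$ where $|x|=m+n$ for $x\in X_{m,n}$, with the obvious associativity and unit constraints, the symmetry $x\otimes y\mapsto(-1)^{|x||y|}y\otimes x$, and as unit $k$ concentrated in bidegree $(0,0)$. Let $S^{p,q}$ be $k$ concentrated in bidegree $(p,q)$. For $p>0$ and $q\in\mathbb Z$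 let $D^{p,q}$ be the bicomplex with $k$ in the bidegrees $(p,q)$, $(p-1,q)$, $(p,q-1)$, $(p-1,q-1)$ and $0$ elsewhere, whose four nontrivial differentials are identities except that $d_v\colon D^{p,q}_{p,q}\to D^{p,q}_{p,q-1}$ is $-1$. Let $\partial_hD^{p,q}\subset D^{p,q}$ be the image of $d_h$ (bidegrees $(p-1,q)$ and $(p-1,q-1)$) and $\partial_vD^{p,q}\subset D^{p,q}$ the image of $d_v$ (bidegrees $(p,q-1)$ and $(p-1,q-1)$). Put $$I=\{0\to S^{0,q}\}\cup\{S^{p-1,q-1}\hookrightarrow\partial_vD^{p,q}\}\cup\{0\to\partial_hD^{1,q}\}\cup\{\partial_hD^{p,q}\hookrightarrow D^{p,q}\},$$ $$J=\{0\to\partial_vD^{p,q}\}\cup\{0\to\partial_hD^{1,q}\}\cup\{\partial_hD^{p,q}\hookrightarrow D^{p,q}\}\qquad(p>0,\ q\in\mathbb Z).$$ Call a morphism $f$ of bicomplexes * a *weak equivalence* if $H^h_{p,q}(H^v(f))$ is an isomorphism for all $p\ge0$ and $q\in\mathbb Z$, where $H^v$ is the homology with respect to $d_v$ (with the differential induced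 by $d_h$) and $H^h$ is the homology with respect to $d_h$; * a *fibration* if it has the right lifting property with respect to $J$; * a *cofibration* if it has the left lifting property with respect to all morphisms that have the right lifting property with respect to $I$. These three classes form a model structure on $\operatorname{bCh}$, the *Cartan–Eilenberg model structure* $\operatorname{bCh}_{\mathrm{CE}}$, and the following hold. 1. $\operatorname{bCh}_{\mathrm{CE}}$ is a (symmetric) monoidal model category: the symmetric monoidal category $\operatorname{bCh}$ is closed; for cofibrations $f\colon A\to B$ and $g\colon X\to Y$ the pushout-product $(B\otimes X)\sqcup_{A\otimes X}(A\otimes Y)\to B\otimes Y$ is a cofibration, and it is a trivial cofibration if $f$ or $g$ is one; and for every trivial fibration $e\colon Q\to\mathbb 1$ onto the tensor unit with $Q$ cofibrant and every cofibrant $X$, the maps $e\otimes X$ and $X\otimes e$ are weak equivalences. 2. The tensor unit is cofibrant. 3. The monoid axiom of Schwede and Shipley holds: every transfinite composition of pushouts of morphisms of the form $j\otimes Z$, with $j$ a trivial cofibration and $Z$ a bicomplex, is a weak equivalence. -/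

import Mathlib

open CategoryTheory Limits MonoidalCategory HomotopicalAlgebra

universe u v

noncomputable section

namespace Bicomplex

/-- Horizontal differentials go from bidegree `(p, q)` to `(p - 1, q)`. -/
abbrev hShape : ComplexShape (ℕ × ℤ) := ComplexShape.down' (1, 0)
/-- Vertical differentials go from bidegree `(p, q)` to `(p, q - 1)`. -/
abbrev vShape : ComplexShape (ℕ × ℤ) := ComplexShape.down' (0, 1)

lemma hShape_rel (i j : ℕ × ℤ) : hShape.Rel i j ↔ j.1 + 1 = i.1 ∧ j.2 = i.2 := by
  simp [ComplexShape.down', Prod.ext_iff]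

lemma vShape_rel (i j : ℕ × ℤ) : vShape.Rel i j ↔ j.1 = i.1 ∧ j.2 + 1 = i.2 := by
  simp [ComplexShape.down', Prod.ext_iff]

/-- The sign `(-1) ^ (p + q)`. It enters the differentials of the tensor product, in both directions. -/
def totalSign : Multiplicative (ℕ × ℤ) →* ℤˣ :=
  MonoidHom.mk' (fun i => Int.negOnePow ((Multiplicative.toAdd i).1 + (Multiplicative.toAdd i).2))
    (fun a b => by
      rw [← Int.negOnePow_add]
      congr 1
      change ((((Multiplicative.toAdd a).1 + (Multiplicative.toAdd b).1 : ℕ) : ℤ) +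
        ((Multiplicative.toAdd a).2 + (Multiplicative.toAdd b).2)) = _
      push_cast
      ring)

instance : hShape.TensorSigns where
  ε' := totalSign
  rel_add p q r h := by rw [hShape_rel] at *; simp; omega
  add_rel p q r h := by rw [hShape_rel] at *; simp; omega
  ε'_succ p q h := by
    rw [hShape_rel] at h
    change Int.negOnePow ((q.1 : ℤ) + q.2) = - Int.negOnePow ((p.1 : ℤ) + p.2)
    rw [← Int.negOnePow_succ, h.2, ← h.1, Int.negOnePow_eq_iff]
    exact ⟨-1, by push_cast; ring⟩

instance : vShape.TensorSigns where
  ε' := totalSign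
  rel_add p q r h := by rw [vShape_rel] at *; simp; omega
  add_rel p q r h := by rw [vShape_rel] at *; simp; omega
  ε'_succ p q h := by
    rw [vShape_rel] at h
    change Int.negOnePow ((q.1 : ℤ) + q.2) = - Int.negOnePow ((p.1 : ℤ) + p.2)
    rw [← Int.negOnePow_succ, ← h.2, ← h.1, Int.negOnePow_eq_iff]
    exact ⟨-1, by push_cast; ring⟩

end Bicomplex

open Bicomplex

/-- Bicomplexes of `k`-modules in the right half-plane, graded by `ℕ × ℤ`, with anticommuting
horizontal and vertical differentials of bidegrees `(-1, 0)` and `(0, -1)`. -/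
structure Bicomplex (k : Type u) [CommRing k] where
  X : ℕ × ℤ → ModuleCat.{u} k
  dh (i j : ℕ × ℤ) : X i ⟶ X j
  dv (i j : ℕ × ℤ) : X i ⟶ X j
  dh_shape (i j : ℕ × ℤ) : ¬ hShape.Rel i j → dh i j = 0
  dv_shape (i j : ℕ × ℤ) : ¬ vShape.Rel i j → dv i j = 0
  dh_comp_dh (i j l : ℕ × ℤ) : dh i j ≫ dh j l = 0
  dv_comp_dv (i j l : ℕ × ℤ) : dv i j ≫ dv j l = 0
  anticomm (p : ℕ) (q : ℤ) :
    dh (p + 1, q + 1) (p, q + 1) ≫ dv (p, q + 1) (p, q) +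
      dv (p + 1, q + 1) (p + 1, q) ≫ dh (p + 1, q) (p, q) = 0

namespace Bicomplex

variable {k : Type u} [CommRing k]

/-- The horizontal complexes of a bicomplex. -/
@[simps]
def horizontal (A : Bicomplex k) : HomologicalComplex (ModuleCat.{u} k) hShape where
  X := A.X
  d := A.dh
  shape := A.dh_shape
  d_comp_d' i j l _ _ := A.dh_comp_dh i j l

/-- The vertical complexes of a bicomplex. -/
@[simps]
def vertical (A : Bicomplex k) : HomologicalComplex (ModuleCat.{u} k) vShape where
  X := A.X
  d := A.dv
  shape := A.dv_shape
  d_comp_d' i j l _ _ := A.dv_comp_dv i j l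

/-- Morphisms of bicomplexes. -/
@[ext]
structure Hom (A B : Bicomplex k) where
  f (i : ℕ × ℤ) : A.X i ⟶ B.X i
  comm_h (i j : ℕ × ℤ) : f i ≫ B.dh i j = A.dh i j ≫ f j
  comm_v (i j : ℕ × ℤ) : f i ≫ B.dv i j = A.dv i j ≫ f j

instance : Category (Bicomplex k) where
  Hom A B := Hom A B
  id A := { f := fun _ => 𝟙 _, comm_h := by simp, comm_v := by simp }
  comp φ ψ :=
    { f := fun i => φ.f i ≫ ψ.f i
      comm_h := fun i j => by
        rw [Category.assoc, ψ.comm_h, ← Category.assoc, φ.comm_h, Category.assoc]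
      comm_v := fun i j => by
        rw [Category.assoc, ψ.comm_v, ← Category.assoc, φ.comm_v, Category.assoc] }

@[ext]
lemma hom_ext {A B : Bicomplex k} (φ ψ : A ⟶ B) (h : ∀ i, φ.f i = ψ.f i) : φ = ψ :=
  Hom.ext (funext h)

def horizontalFunctor : Bicomplex k ⥤ HomologicalComplex (ModuleCat.{u} k) hShape where
  obj := horizontal
  map φ := { f := φ.f, comm' := fun i j _ => φ.comm_h i j }

def verticalFunctor : Bicomplex k ⥤ HomologicalComplex (ModuleCat.{u} k) vShape where
  obj := vertical
  map φ := { f := φ.f, comm' := fun i j _ => φ.comm_v i j }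

@[simps]
def toGraded : Bicomplex k ⥤ GradedObject (ℕ × ℤ) (ModuleCat.{u} k) where
  obj := X
  map φ := φ.f

instance : (toGraded (k := k)).Faithful where
  map_injective h := Hom.ext h

section Tensor

variable (A B : Bicomplex k)

/-- `(A ⊗ B)_j = ⨁_{i₁ + i₂ = j} A_{i₁} ⊗ B_{i₂}`. -/
abbrev tensorX : GradedObject (ℕ × ℤ) (ModuleCat.{u} k) := GradedObject.Monoidal.tensorObj A.X B.X

/-- The inclusion of a summand of the tensor product. -/
abbrev ι (i₁ i₂ j : ℕ × ℤ) (h : i₁ + i₂ = j) : A.X i₁ ⊗ B.X i₂ ⟶ tensorX A B j :=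
  GradedObject.Monoidal.ιTensorObj A.X B.X i₁ i₂ j h

/-- `d_h (x ⊗ y) = d_h x ⊗ y + (-1) ^ |x| x ⊗ d_h y`, see `ι_tensorDh`, `dh₁_eq`, `dh₂_eq`. -/
def tensorDh (i j : ℕ × ℤ) : tensorX A B i ⟶ tensorX A B j :=
  (HomologicalComplex.tensorObj A.horizontal B.horizontal).d i j

/-- `d_v (x ⊗ y) = d_v x ⊗ y + (-1) ^ |x| x ⊗ d_v y`, see `ι_tensorDv`, `dv₁_eq`, `dv₂_eq`. -/
def tensorDv (i j : ℕ × ℤ) : tensorX A B i ⟶ tensorX A B j :=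
  (HomologicalComplex.tensorObj A.vertical B.vertical).d i j

/-- The sign `(-1) ^ (p + q)`. -/
def sgn (i : ℕ × ℤ) : ℤˣ := Int.negOnePow (i.1 + i.2)

lemma sgn_h (p : ℕ) (q : ℤ) : sgn (p + 1, q) = - sgn (p, q) := by
  simp only [sgn, ← Int.negOnePow_succ]
  congr 1
  push_cast
  ring

lemma sgn_v (p : ℕ) (q : ℤ) : sgn (p, q + 1) = - sgn (p, q) := by
  simp only [sgn, ← Int.negOnePow_succ]
  congr 1
  ring


/-- The contribution of the horizontal differential of the first factor. -/
def dh₁ (i₁ i₂ j : ℕ × ℤ) : A.X i₁ ⊗ B.X i₂ ⟶ tensorX A B j :=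
  HomologicalComplex.mapBifunctor.d₁ A.horizontal B.horizontal
    (curriedTensor (ModuleCat.{u} k)) hShape i₁ i₂ j

/-- The contribution of the horizontal differential of the second factor. -/
def dh₂ (i₁ i₂ j : ℕ × ℤ) : A.X i₁ ⊗ B.X i₂ ⟶ tensorX A B j :=
  HomologicalComplex.mapBifunctor.d₂ A.horizontal B.horizontal
    (curriedTensor (ModuleCat.{u} k)) hShape i₁ i₂ j

/-- The contribution of the vertical differential of the first factor. -/
def dv₁ (i₁ i₂ j : ℕ × ℤ) : A.X i₁ ⊗ B.X i₂ ⟶ tensorX A B j :=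
  HomologicalComplex.mapBifunctor.d₁ A.vertical B.vertical
    (curriedTensor (ModuleCat.{u} k)) vShape i₁ i₂ j

/-- The contribution of the vertical differential of the second factor. -/
def dv₂ (i₁ i₂ j : ℕ × ℤ) : A.X i₁ ⊗ B.X i₂ ⟶ tensorX A B j :=
  HomologicalComplex.mapBifunctor.d₂ A.vertical B.vertical
    (curriedTensor (ModuleCat.{u} k)) vShape i₁ i₂ j

lemma ι_tensorDh (i₁ i₂ j j' : ℕ × ℤ) (h : i₁ + i₂ = j) :
    ι A B i₁ i₂ j h ≫ tensorDh A B j j' = dh₁ A B i₁ i₂ j' + dh₂ A B i₁ i₂ j' :=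
  (Preadditive.comp_add ..).trans (congrArg₂ (· + ·)
    (HomologicalComplex.mapBifunctor.ι_D₁ A.horizontal B.horizontal
      (curriedTensor (ModuleCat.{u} k)) hShape j j' i₁ i₂ h)
    (HomologicalComplex.mapBifunctor.ι_D₂ A.horizontal B.horizontal
      (curriedTensor (ModuleCat.{u} k)) hShape j j' i₁ i₂ h))

lemma ι_tensorDv (i₁ i₂ j j' : ℕ × ℤ) (h : i₁ + i₂ = j) :
    ι A B i₁ i₂ j h ≫ tensorDv A B j j' = dv₁ A B i₁ i₂ j' + dv₂ A B i₁ i₂ j' :=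
  (Preadditive.comp_add ..).trans (congrArg₂ (· + ·)
    (HomologicalComplex.mapBifunctor.ι_D₁ A.vertical B.vertical
      (curriedTensor (ModuleCat.{u} k)) vShape j j' i₁ i₂ h)
    (HomologicalComplex.mapBifunctor.ι_D₂ A.vertical B.vertical
      (curriedTensor (ModuleCat.{u} k)) vShape j j' i₁ i₂ h))

lemma dh₁_eq (i₁ i₂ a j : ℕ × ℤ) (h : hShape.Rel i₁ a) (e : a + i₂ = j) :
    dh₁ A B i₁ i₂ j = (A.dh i₁ a ▷ B.X i₂) ≫ ι A B a i₂ j e :=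
  (HomologicalComplex.mapBifunctor.d₁_eq _ _ _ _ h _ _ e).trans (one_smul _ _)

lemma dh₂_eq (i₁ i₂ a j : ℕ × ℤ) (h : hShape.Rel i₂ a) (e : i₁ + a = j) :
    dh₂ A B i₁ i₂ j = sgn i₁ • ((A.X i₁ ◁ B.dh i₂ a) ≫ ι A B i₁ a j e) :=
  HomologicalComplex.mapBifunctor.d₂_eq _ _ _ _ _ h _ e

lemma dv₁_eq (i₁ i₂ a j : ℕ × ℤ) (h : vShape.Rel i₁ a) (e : a + i₂ = j) :
    dv₁ A B i₁ i₂ j = (A.dv i₁ a ▷ B.X i₂) ≫ ι A B a i₂ j e :=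
  (HomologicalComplex.mapBifunctor.d₁_eq _ _ _ _ h _ _ e).trans (one_smul _ _)

lemma dv₂_eq (i₁ i₂ a j : ℕ × ℤ) (h : vShape.Rel i₂ a) (e : i₁ + a = j) :
    dv₂ A B i₁ i₂ j = sgn i₁ • ((A.X i₁ ◁ B.dv i₂ a) ≫ ι A B i₁ a j e) :=
  HomologicalComplex.mapBifunctor.d₂_eq _ _ _ _ _ h _ e

lemma hShape_not_rel (q : ℤ) (j : ℕ × ℤ) : ¬ hShape.Rel (0, q) j := by
  rw [hShape_rel]
  simp

lemma hShape_rel' (p : ℕ) (q : ℤ) : hShape.Rel (p + 1, q) (p, q) := by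
  simp

lemma vShape_rel' (p : ℕ) (q : ℤ) : vShape.Rel (p, q + 1) (p, q) := by
  simp

lemma dh₁_zero (q : ℤ) (i₂ j : ℕ × ℤ) : dh₁ A B (0, q) i₂ j = 0 :=
  HomologicalComplex.mapBifunctor.d₁_eq_zero _ _ _ _ _ _ _ (hShape_not_rel _ _)

lemma dh₂_zero (q : ℤ) (i₁ j : ℕ × ℤ) : dh₂ A B i₁ (0, q) j = 0 :=
  HomologicalComplex.mapBifunctor.d₂_eq_zero _ _ _ _ _ _ _ (hShape_not_rel _ _)


lemma whiskerLeft_anticomm (M T : ModuleCat.{u} k) (p : ℕ) (q : ℤ) (t : M ⊗ B.X (p, q) ⟶ T) :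
    M ◁ B.dh (p + 1, q + 1) (p, q + 1) ≫ M ◁ B.dv (p, q + 1) (p, q) ≫ t =
      -(M ◁ B.dv (p + 1, q + 1) (p + 1, q) ≫ M ◁ B.dh (p + 1, q) (p, q) ≫ t) := by
  rw [← MonoidalCategory.whiskerLeft_comp_assoc, ← MonoidalCategory.whiskerLeft_comp_assoc,
    eq_neg_iff_add_eq_zero, ← Preadditive.add_comp, ← MonoidalPreadditive.whiskerLeft_add,
    B.anticomm, MonoidalPreadditive.whiskerLeft_zero, zero_comp]

lemma whiskerRight_anticomm (M T : ModuleCat.{u} k) (p : ℕ) (q : ℤ) (t : B.X (p, q) ⊗ M ⟶ T) :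
    B.dh (p + 1, q + 1) (p, q + 1) ▷ M ≫ B.dv (p, q + 1) (p, q) ▷ M ≫ t =
      -(B.dv (p + 1, q + 1) (p + 1, q) ▷ M ≫ B.dh (p + 1, q) (p, q) ▷ M ≫ t) := by
  rw [← MonoidalCategory.comp_whiskerRight_assoc, ← MonoidalCategory.comp_whiskerRight_assoc,
    eq_neg_iff_add_eq_zero, ← Preadditive.add_comp, ← MonoidalPreadditive.add_whiskerRight,
    B.anticomm, MonoidalPreadditive.zero_whiskerRight, zero_comp]

lemma tensor_anticomm (p : ℕ) (q : ℤ) :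
    tensorDh A B (p + 1, q + 1) (p, q + 1) ≫ tensorDv A B (p, q + 1) (p, q) +
      tensorDv A B (p + 1, q + 1) (p + 1, q) ≫ tensorDh A B (p + 1, q) (p, q) = 0 := by
  apply GradedObject.Monoidal.tensorObj_ext
  rintro ⟨p₁, q₁⟩ ⟨p₂, q₂⟩ h
  obtain ⟨q₁, rfl⟩ : ∃ r, q₁ = r + 1 := ⟨q₁ - 1, by simp⟩
  obtain ⟨q₂, rfl⟩ : ∃ r, q₂ = r + 1 := ⟨q₂ - 1, by simp⟩
  change ι A B _ _ _ h ≫ _ = ι A B _ _ _ h ≫ _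
  have hh := h
  simp only [Prod.mk_add_mk, Prod.mk.injEq] at h
  rw [Preadditive.comp_add, comp_zero, reassoc_of% (ι_tensorDh A B _ _ _ (p, q + 1) hh),
    reassoc_of% (ι_tensorDv A B _ _ _ (p + 1, q) hh)]
  simp only [Preadditive.add_comp]
  rw [dv₁_eq A B _ _ _ _ (vShape_rel' p₁ q₁) (by ext <;> simp <;> omega),
    dv₂_eq A B _ _ _ _ (vShape_rel' p₂ q₂) (by ext <;> simp <;> omega)]
  rcases p₁ with _ | p₁
  · rcases p₂ with _ | p₂
    · omega
    rw [dh₂_eq A B _ _ _ _ (hShape_rel' p₂ (q₂ + 1)) (by ext <;> simp <;> omega)]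
    simp only [Linear.units_smul_comp, Category.assoc, ι_tensorDv, ι_tensorDh, dh₁_zero, zero_add,
      zero_comp]
    rw [dv₁_eq A B _ _ _ _ (vShape_rel' 0 q₁) (by ext <;> simp <;> omega),
      dv₂_eq A B _ _ _ _ (vShape_rel' p₂ q₂) (by ext <;> simp <;> omega),
      dh₂_eq A B _ _ _ _ (hShape_rel' p₂ (q₂ + 1)) (by ext <;> simp <;> omega),
      dh₂_eq A B _ _ _ _ (hShape_rel' p₂ q₂) (by ext <;> simp <;> omega)]
    simp only [Linear.comp_units_smul, Preadditive.comp_add, smul_add, ← whisker_exchange_assoc,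
      whiskerLeft_anticomm, sgn_v, Units.neg_smul, smul_neg, Preadditive.comp_neg, neg_neg]
    abel
  rcases p₂ with _ | p₂
  · rw [dh₁_eq A B _ _ _ _ (hShape_rel' p₁ (q₁ + 1)) (by ext <;> simp <;> omega)]
    simp only [Linear.units_smul_comp, Category.assoc, ι_tensorDv, ι_tensorDh, dh₂_zero,
      zero_comp, add_zero]
    rw [dv₁_eq A B _ _ _ _ (vShape_rel' p₁ q₁) (by ext <;> simp <;> omega),
      dv₂_eq A B _ _ _ _ (vShape_rel' 0 q₂) (by ext <;> simp <;> omega),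
      dh₁_eq A B _ _ _ _ (hShape_rel' p₁ (q₁ + 1)) (by ext <;> simp <;> omega),
      dh₁_eq A B _ _ _ _ (hShape_rel' p₁ q₁) (by ext <;> simp <;> omega)]
    simp only [Linear.comp_units_smul, Preadditive.comp_add, ← whisker_exchange_assoc,
      whiskerRight_anticomm, sgn_v, sgn_h, Units.neg_smul, Preadditive.comp_neg, neg_neg]
    abel
  · rw [dh₁_eq A B _ _ _ _ (hShape_rel' p₁ (q₁ + 1)) (by ext <;> simp <;> omega),
      dh₂_eq A B _ _ _ _ (hShape_rel' p₂ (q₂ + 1)) (by ext <;> simp <;> omega)]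
    simp only [Linear.units_smul_comp, Category.assoc, ι_tensorDv, ι_tensorDh]
    rw [dv₁_eq A B _ _ _ _ (vShape_rel' p₁ q₁) (by ext <;> simp <;> omega),
      dv₂_eq A B _ _ _ _ (vShape_rel' (p₂ + 1) q₂) (by ext <;> simp <;> omega),
      dv₁_eq A B _ _ _ _ (vShape_rel' (p₁ + 1) q₁) (by ext <;> simp <;> omega),
      dv₂_eq A B _ _ _ _ (vShape_rel' p₂ q₂) (by ext <;> simp <;> omega),
      dh₁_eq A B _ _ _ _ (hShape_rel' p₁ q₁) (by ext <;> simp <;> omega),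
      dh₂_eq A B _ _ _ _ (hShape_rel' p₂ (q₂ + 1)) (by ext <;> simp <;> omega),
      dh₁_eq A B _ _ _ _ (hShape_rel' p₁ (q₁ + 1)) (by ext <;> simp <;> omega),
      dh₂_eq A B _ _ _ _ (hShape_rel' p₂ q₂) (by ext <;> simp <;> omega)]
    simp only [Linear.comp_units_smul, Preadditive.comp_add, smul_add, ← whisker_exchange_assoc,
      whiskerRight_anticomm, whiskerLeft_anticomm, sgn_v, sgn_h, Units.neg_smul, smul_neg,
      Preadditive.comp_neg, neg_neg]
    abel

/-- The tensor product of bicomplexes. -/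
@[simps]
def tensor : Bicomplex k where
  X := tensorX A B
  dh := tensorDh A B
  dv := tensorDv A B
  dh_shape := (HomologicalComplex.tensorObj A.horizontal B.horizontal).shape
  dv_shape := (HomologicalComplex.tensorObj A.vertical B.vertical).shape
  dh_comp_dh i j l := HomologicalComplex.d_comp_d _ i j l
  dv_comp_dv i j l := HomologicalComplex.d_comp_d _ i j l
  anticomm := tensor_anticomm A B

end Tensor

section MonoidalStructure

variable {A B A' B' : Bicomplex k}

def tensorMap (φ : A ⟶ A') (ψ : B ⟶ B') : tensor A B ⟶ tensor A' B' where
  f := GradedObject.Monoidal.tensorHom φ.f ψ.f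
  comm_h i j := (HomologicalComplex.tensorHom (horizontalFunctor.map φ)
    (horizontalFunctor.map ψ)).comm i j
  comm_v i j := (HomologicalComplex.tensorHom (verticalFunctor.map φ)
    (verticalFunctor.map ψ)).comm i j

variable (A B A') in
def assoc : tensor (tensor A B) A' ≅ tensor A (tensor B A') where
  hom :=
    { f := (GradedObject.Monoidal.associator A.X B.X A'.X).hom
      comm_h := fun i j => (HomologicalComplex.associator A.horizontal B.horizontal
        A'.horizontal).hom.comm i j
      comm_v := fun i j => (HomologicalComplex.associator A.vertical B.vertical
        A'.vertical).hom.comm i j }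
  inv :=
    { f := (GradedObject.Monoidal.associator A.X B.X A'.X).inv
      comm_h := fun i j => (HomologicalComplex.associator A.horizontal B.horizontal
        A'.horizontal).inv.comm i j
      comm_v := fun i j => (HomologicalComplex.associator A.vertical B.vertical
        A'.vertical).inv.comm i j }
  hom_inv_id := Hom.ext (GradedObject.Monoidal.associator A.X B.X A'.X).hom_inv_id
  inv_hom_id := Hom.ext (GradedObject.Monoidal.associator A.X B.X A'.X).inv_hom_id

variable (k) in
/-- The tensor unit: `k` concentrated in bidegree `(0, 0)`. -/
def unit : Bicomplex k where
  X := (HomologicalComplex.tensorUnit (ModuleCat.{u} k) hShape).X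
  dh _ _ := 0
  dv _ _ := 0
  dh_shape := by simp
  dv_shape := by simp
  dh_comp_dh := by simp
  dv_comp_dv := by simp
  anticomm := by simp

variable (A) in
def leftUnit : tensor (unit k) A ≅ A where
  hom :=
    { f := (HomologicalComplex.leftUnitor' A.horizontal).hom
      comm_h := fun i j => (HomologicalComplex.leftUnitor A.horizontal).hom.comm i j
      comm_v := fun i j => (HomologicalComplex.leftUnitor A.vertical).hom.comm i j }
  inv :=
    { f := (HomologicalComplex.leftUnitor' A.horizontal).inv
      comm_h := fun i j => (HomologicalComplex.leftUnitor A.horizontal).inv.comm i j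
      comm_v := fun i j => (HomologicalComplex.leftUnitor A.vertical).inv.comm i j }
  hom_inv_id := Hom.ext (HomologicalComplex.leftUnitor' A.horizontal).hom_inv_id
  inv_hom_id := Hom.ext (HomologicalComplex.leftUnitor' A.horizontal).inv_hom_id

variable (A) in
def rightUnit : tensor A (unit k) ≅ A where
  hom :=
    { f := (HomologicalComplex.rightUnitor' A.horizontal).hom
      comm_h := fun i j => (HomologicalComplex.rightUnitor A.horizontal).hom.comm i j
      comm_v := fun i j => (HomologicalComplex.rightUnitor A.vertical).hom.comm i j }
  inv :=
    { f := (HomologicalComplex.rightUnitor' A.horizontal).inv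
      comm_h := fun i j => (HomologicalComplex.rightUnitor A.horizontal).inv.comm i j
      comm_v := fun i j => (HomologicalComplex.rightUnitor A.vertical).inv.comm i j }
  hom_inv_id := Hom.ext (HomologicalComplex.rightUnitor' A.horizontal).hom_inv_id
  inv_hom_id := Hom.ext (HomologicalComplex.rightUnitor' A.horizontal).inv_hom_id


instance : MonoidalCategory (GradedObject (ℕ × ℤ) (ModuleCat.{u} k)) :=
  GradedObject.monoidalCategory

instance : MonoidalCategoryStruct (Bicomplex k) where
  tensorObj := tensor
  whiskerLeft A _ _ φ := tensorMap (𝟙 A) φ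
  whiskerRight φ B := tensorMap φ (𝟙 B)
  tensorHom φ ψ := tensorMap φ ψ
  tensorUnit := unit k
  associator := assoc
  leftUnitor := leftUnit
  rightUnitor := rightUnit

lemma associator_aux {C : Type*} [Category* C] [MonoidalCategory C] (X Y Z : C) :
    ((((Iso.refl ((X ⊗ Y) ⊗ Z)).symm ≪≫ ((Iso.refl (X ⊗ Y)).symm ⊗ᵢ .refl Z)) ≪≫ α_ X Y Z) ≪≫
      ((.refl X ⊗ᵢ .refl (Y ⊗ Z)) ≪≫ .refl (X ⊗ (Y ⊗ Z)))).hom = (α_ X Y Z).hom := by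
  simp

lemma leftUnitor_aux {C : Type*} [Category* C] [MonoidalCategory C] (X : C) {U : C}
    (e : 𝟙_ C ≅ U) :
    (((Iso.refl (U ⊗ X)).symm ≪≫ (e.symm ⊗ᵢ .refl X)) ≪≫ λ_ X).hom =
      (e.inv ⊗ₘ 𝟙 X) ≫ (λ_ X).hom := by
  simp

lemma rightUnitor_aux {C : Type*} [Category* C] [MonoidalCategory C] (X : C) {U : C}
    (e : 𝟙_ C ≅ U) :
    (((Iso.refl (X ⊗ U)).symm ≪≫ (.refl X ⊗ᵢ e.symm)) ≪≫ ρ_ X).hom =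
      (𝟙 X ⊗ₘ e.inv) ≫ (ρ_ X).hom := by
  simp

def inducingFunctorData : Monoidal.InducingFunctorData (toGraded (k := k)) where
  μIso _ _ := Iso.refl _
  εIso := HomologicalComplex.tensorUnitIso (ModuleCat.{u} k) hShape
  whiskerLeft_eq _ _ _ _ := ((Category.id_comp _).trans (Category.comp_id _)).symm
  whiskerRight_eq _ _ := ((Category.id_comp _).trans (Category.comp_id _)).symm
  tensorHom_eq _ _ := ((Category.id_comp _).trans (Category.comp_id _)).symm
  associator_eq A B C := (associator_aux (C := GradedObject (ℕ × ℤ) (ModuleCat.{u} k)) A.X B.X C.X).symm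
  leftUnitor_eq A := (leftUnitor_aux (C := GradedObject (ℕ × ℤ) (ModuleCat.{u} k)) A.X
    (HomologicalComplex.tensorUnitIso (ModuleCat.{u} k) hShape)).symm
  rightUnitor_eq A := (rightUnitor_aux (C := GradedObject (ℕ × ℤ) (ModuleCat.{u} k)) A.X
    (HomologicalComplex.tensorUnitIso (ModuleCat.{u} k) hShape)).symm

instance : MonoidalCategory (Bicomplex k) := Monoidal.induced _ inducingFunctorData

end MonoidalStructure


section Braiding

/-- The total degree. -/
def deg (i : ℕ × ℤ) : ℤ := i.1 + i.2

lemma deg_add (i j : ℕ × ℤ) : deg (i + j) = deg i + deg j := by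
  simp only [deg, Prod.fst_add, Prod.snd_add]
  push_cast
  ring

/-- The Koszul sign `(-1) ^ (|i| |j|)`. -/
def koszul (i j : ℕ × ℤ) : ℤˣ := Int.negOnePow (deg i * deg j)

lemma koszul_comm (i j : ℕ × ℤ) : koszul i j = koszul j i := by
  simp only [koszul, mul_comm]

lemma koszul_add_left (i i' j : ℕ × ℤ) : koszul (i + i') j = koszul i j * koszul i' j := by
  simp only [koszul, deg_add, add_mul, Int.negOnePow_add]

lemma koszul_add_right (i j j' : ℕ × ℤ) : koszul i (j + j') = koszul i j * koszul i j' := by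
  simp only [koszul, deg_add, mul_add, Int.negOnePow_add]

lemma koszul_mul_self (i j : ℕ × ℤ) : koszul i j * koszul j i = 1 := by
  rw [koszul_comm, Int.units_mul_self]

lemma koszul_of_hRel (i a j : ℕ × ℤ) (h : hShape.Rel i a) :
    koszul i j = koszul a j * sgn j := by
  rw [hShape_rel] at h
  have : deg i = deg a + 1 := by simp only [deg, ← h.1, h.2]; push_cast; ring
  rw [koszul, this, add_mul, one_mul, Int.negOnePow_add]
  rfl

lemma koszul_of_vRel (i a j : ℕ × ℤ) (h : vShape.Rel i a) :
    koszul i j = koszul a j * sgn j := by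
  rw [vShape_rel] at h
  have : deg i = deg a + 1 := by simp only [deg, ← h.2, h.1]; ring
  rw [koszul, this, add_mul, one_mul, Int.negOnePow_add]
  rfl

abbrev GMod (k : Type u) [CommRing k] := GradedObject (ℕ × ℤ) (ModuleCat.{u} k)

open GradedObject.Monoidal

/-- The braiding of graded modules with the Koszul sign of total degrees. -/
def gBraid (X Y : GMod k) :
    GradedObject.Monoidal.tensorObj X Y ⟶ GradedObject.Monoidal.tensorObj Y X := fun j =>
  tensorObjDesc (fun i₁ i₂ h => koszul i₁ i₂ • ((β_ (X i₁) (Y i₂)).hom ≫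
    ιTensorObj Y X i₂ i₁ j (by rw [add_comm, h])))

lemma ι_gBraid (X Y : GMod k) (i₁ i₂ j : ℕ × ℤ) (h : i₁ + i₂ = j) :
    ιTensorObj X Y i₁ i₂ j h ≫ gBraid X Y j = koszul i₁ i₂ • ((β_ (X i₁) (Y i₂)).hom ≫
      ιTensorObj Y X i₂ i₁ j (by rw [add_comm, h])) :=
  ι_tensorObjDesc _ _ _ _

lemma gBraid_symm (X Y : GMod k) : gBraid X Y ≫ gBraid Y X = 𝟙 _ := by
  funext j
  change gBraid X Y j ≫ gBraid Y X j = 𝟙 _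
  apply tensorObj_ext
  intro i₁ i₂ h
  rw [reassoc_of% (ι_gBraid X Y i₁ i₂ j h), Linear.units_smul_comp, Category.assoc, ι_gBraid, Linear.comp_units_smul,
    smul_smul, koszul_mul_self, one_smul, SymmetricCategory.symmetry_assoc, Category.comp_id]

lemma gBraid_natural {X X' Y Y' : GMod k} (f : X ⟶ X') (g : Y ⟶ Y') :
    GradedObject.Monoidal.tensorHom f g ≫ gBraid X' Y' =
      gBraid X Y ≫ GradedObject.Monoidal.tensorHom g f := by
  funext j
  change GradedObject.Monoidal.tensorHom f g j ≫ gBraid X' Y' j =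
      gBraid X Y j ≫ GradedObject.Monoidal.tensorHom g f j
  apply tensorObj_ext
  intro i₁ i₂ h
  rw [ι_tensorHom_assoc, ι_gBraid, reassoc_of% (ι_gBraid X Y i₁ i₂ j h), Linear.units_smul_comp, Category.assoc,
    Linear.comp_units_smul, ι_tensorHom, BraidedCategory.braiding_naturality_assoc]

lemma gBraid_whiskerRight (X Y : GMod k) (M : ModuleCat.{u} k) (i₁ i₂ j : ℕ × ℤ)
    (h : i₁ + i₂ = j) :
    (ιTensorObj X Y i₁ i₂ j h ▷ M) ≫ (gBraid X Y j ⊗ₘ 𝟙 M) =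
      koszul i₁ i₂ • (((β_ (X i₁) (Y i₂)).hom ▷ M) ≫
        (ιTensorObj Y X i₂ i₁ j (by rw [add_comm, h]) ▷ M)) := by
  rw [MonoidalCategory.tensorHom_id, ← MonoidalCategory.comp_whiskerRight, ι_gBraid,
    ← MonoidalCategory.comp_whiskerRight, Units.smul_def, Units.smul_def]
  exact Functor.map_zsmul (MonoidalCategory.tensorRight M) ..

lemma gBraid_whiskerLeft (X Y : GMod k) (M : ModuleCat.{u} k) (i₁ i₂ j : ℕ × ℤ)
    (h : i₁ + i₂ = j) :
    (M ◁ ιTensorObj X Y i₁ i₂ j h) ≫ (𝟙 M ⊗ₘ gBraid X Y j) =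
      koszul i₁ i₂ • ((M ◁ (β_ (X i₁) (Y i₂)).hom) ≫
        (M ◁ ιTensorObj Y X i₂ i₁ j (by rw [add_comm, h]))) := by
  rw [MonoidalCategory.id_tensorHom, ← MonoidalCategory.whiskerLeft_comp, ι_gBraid,
    ← MonoidalCategory.whiskerLeft_comp, Units.smul_def, Units.smul_def]
  exact Functor.map_zsmul (MonoidalCategory.tensorLeft M) ..

lemma gBraid_hexagon (X Y Z : GMod k) :
    (GradedObject.Monoidal.associator X Y Z).hom ≫
      gBraid X (GradedObject.Monoidal.tensorObj Y Z) ≫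
        (GradedObject.Monoidal.associator Y Z X).hom =
      GradedObject.Monoidal.tensorHom (gBraid X Y) (𝟙 Z) ≫
        (GradedObject.Monoidal.associator Y X Z).hom ≫
          GradedObject.Monoidal.tensorHom (𝟙 Y) (gBraid X Z) := by
  funext j
  change (GradedObject.Monoidal.associator X Y Z).hom j ≫
      gBraid X (GradedObject.Monoidal.tensorObj Y Z) j ≫
        (GradedObject.Monoidal.associator Y Z X).hom j =
      GradedObject.Monoidal.tensorHom (gBraid X Y) (𝟙 Z) j ≫
        (GradedObject.Monoidal.associator Y X Z).hom j ≫
          GradedObject.Monoidal.tensorHom (𝟙 Y) (gBraid X Z) j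
  apply tensorObj₃'_ext
  intro i₁ i₂ i₃ h
  rw [ιTensorObj₃'_associator_hom_assoc, ιTensorObj₃_eq X Y Z i₁ i₂ i₃ j h _ rfl,
    Category.assoc,
    reassoc_of% (ι_gBraid X (GradedObject.Monoidal.tensorObj Y Z) i₁ (i₂ + i₃) j
      (by rw [← add_assoc, h])), Linear.units_smul_comp, Category.assoc,
    Linear.comp_units_smul, Linear.comp_units_smul]
  rw [BraidedCategory.braiding_naturality_right_assoc]
  rw [← ιTensorObj₃'_eq_assoc Y Z X i₂ i₃ i₁ j (by rw [add_comm _ i₁, ← add_assoc, h]) _ rfl,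
    ιTensorObj₃'_associator_hom]
  rw [ιTensorObj₃'_eq X Y Z i₁ i₂ i₃ j h _ rfl, Category.assoc, ι_tensorHom_assoc]
  have e₁ := gBraid_whiskerRight X Y (Z i₃) i₁ i₂ (i₁ + i₂) rfl
  have e₂ := gBraid_whiskerLeft X Z (Y i₂) i₁ i₃ (i₁ + i₃) rfl
  rw [GradedObject.categoryOfGradedObjects_id, reassoc_of% e₁, Linear.units_smul_comp,
    Category.assoc,
    ← ιTensorObj₃'_eq_assoc Y X Z i₂ i₁ i₃ j (by rw [add_comm i₂ i₁, h]) (i₁ + i₂) (add_comm i₂ i₁),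
    ιTensorObj₃'_associator_hom_assoc,
    ιTensorObj₃_eq Y X Z i₂ i₁ i₃ j (by rw [add_comm i₂ i₁, h]) _ rfl, Category.assoc,
    ι_tensorHom, GradedObject.categoryOfGradedObjects_id, reassoc_of% e₂]
  simp only [Linear.units_smul_comp, Linear.comp_units_smul, smul_smul, Category.assoc]
  rw [← ιTensorObj₃_eq Y Z X i₂ i₃ i₁ j (by rw [add_comm _ i₁, ← add_assoc, h])
      (i₁ + i₃) (add_comm _ _), koszul_add_right, BraidedCategory.hexagon_forward_assoc]

variable (A B : Bicomplex k)

lemma ι_gBraid' (i₁ i₂ j : ℕ × ℤ) (h : i₁ + i₂ = j) :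
    ι A B i₁ i₂ j h ≫ gBraid A.X B.X j = koszul i₁ i₂ • ((β_ (A.X i₁) (B.X i₂)).hom ≫
      ι B A i₂ i₁ j (by rw [add_comm, h])) :=
  ι_gBraid _ _ _ _ _ _

lemma dh₁_gBraid (i₁ i₂ j j' : ℕ × ℤ) (h : i₁ + i₂ = j) (hj : hShape.Rel j j') :
    dh₁ A B i₁ i₂ j' ≫ gBraid A.X B.X j' =
      koszul i₁ i₂ • (β_ (A.X i₁) (B.X i₂)).hom ≫ dh₂ B A i₂ i₁ j' := by
  rcases i₁ with ⟨_ | p, q⟩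
  · rw [dh₁_zero, dh₂_zero, zero_comp, comp_zero, smul_zero]
  · have e : (p, q) + i₂ = j' := by
      rw [hShape_rel] at hj
      subst h
      ext
      · have := hj.1
        simp at this ⊢
        omega
      · simp [hj.2]
    rw [dh₁_eq A B _ _ _ _ (hShape_rel' p q) e, dh₂_eq B A _ _ _ _ (hShape_rel' p q)
      (by rw [add_comm, e]), Category.assoc, ι_gBraid', Linear.comp_units_smul,
      Linear.comp_units_smul, smul_smul, koszul_of_hRel _ _ _ (hShape_rel' p q), mul_assoc,
      Int.units_mul_self, mul_one, BraidedCategory.braiding_naturality_left_assoc]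

lemma dh₂_gBraid (i₁ i₂ j j' : ℕ × ℤ) (h : i₁ + i₂ = j) (hj : hShape.Rel j j') :
    dh₂ A B i₁ i₂ j' ≫ gBraid A.X B.X j' =
      koszul i₁ i₂ • (β_ (A.X i₁) (B.X i₂)).hom ≫ dh₁ B A i₂ i₁ j' := by
  rcases i₂ with ⟨_ | p, q⟩
  · rw [dh₁_zero, dh₂_zero, zero_comp, comp_zero, smul_zero]
  · have e : i₁ + (p, q) = j' := by
      rw [hShape_rel] at hj
      subst h
      ext
      · have := hj.1
        simp at this ⊢
        omega
      · simp [hj.2]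
    rw [dh₂_eq A B _ _ _ _ (hShape_rel' p q) e, dh₁_eq B A _ _ _ _ (hShape_rel' p q)
      (by rw [add_comm, e]), Linear.units_smul_comp, Category.assoc, ι_gBraid',
      Linear.comp_units_smul, smul_smul, koszul_comm i₁ (p + 1, q),
      koszul_of_hRel _ _ _ (hShape_rel' p q), koszul_comm i₁, mul_comm (sgn i₁),
      BraidedCategory.braiding_naturality_right_assoc]

lemma dv₁_gBraid (i₁ i₂ j j' : ℕ × ℤ) (h : i₁ + i₂ = j) (hj : vShape.Rel j j') :
    dv₁ A B i₁ i₂ j' ≫ gBraid A.X B.X j' =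
      koszul i₁ i₂ • (β_ (A.X i₁) (B.X i₂)).hom ≫ dv₂ B A i₂ i₁ j' := by
  obtain ⟨p, q, rfl⟩ : ∃ p q, i₁ = (p, q + 1) := ⟨i₁.1, i₁.2 - 1, by simp⟩
  have e : (p, q) + i₂ = j' := by
    rw [vShape_rel] at hj
    subst h
    ext
    · simp [hj.1]
    · have := hj.2
      simp at this ⊢
      omega
  rw [dv₁_eq A B _ _ _ _ (vShape_rel' p q) e, dv₂_eq B A _ _ _ _ (vShape_rel' p q)
    (by rw [add_comm, e]), Category.assoc, ι_gBraid', Linear.comp_units_smul,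
    Linear.comp_units_smul, smul_smul, koszul_of_vRel _ _ _ (vShape_rel' p q), mul_assoc,
    Int.units_mul_self, mul_one, BraidedCategory.braiding_naturality_left_assoc]

lemma dv₂_gBraid (i₁ i₂ j j' : ℕ × ℤ) (h : i₁ + i₂ = j) (hj : vShape.Rel j j') :
    dv₂ A B i₁ i₂ j' ≫ gBraid A.X B.X j' =
      koszul i₁ i₂ • (β_ (A.X i₁) (B.X i₂)).hom ≫ dv₁ B A i₂ i₁ j' := by
  obtain ⟨p, q, rfl⟩ : ∃ p q, i₂ = (p, q + 1) := ⟨i₂.1, i₂.2 - 1, by simp⟩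
  have e : i₁ + (p, q) = j' := by
    rw [vShape_rel] at hj
    subst h
    ext
    · simp [hj.1]
    · have := hj.2
      simp at this ⊢
      omega
  rw [dv₂_eq A B _ _ _ _ (vShape_rel' p q) e, dv₁_eq B A _ _ _ _ (vShape_rel' p q)
    (by rw [add_comm, e]), Linear.units_smul_comp, Category.assoc, ι_gBraid',
    Linear.comp_units_smul, smul_smul, koszul_comm i₁ (p, q + 1),
    koszul_of_vRel _ _ _ (vShape_rel' p q), koszul_comm i₁, mul_comm (sgn i₁),
    BraidedCategory.braiding_naturality_right_assoc]

/-- The symmetry `x ⊗ y ↦ (-1) ^ (|x| |y|) y ⊗ x` as a morphism of bicomplexes. -/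
def braidHom : tensor A B ⟶ tensor B A where
  f := gBraid A.X B.X
  comm_h j j' := by
    by_cases hj : hShape.Rel j j'
    · apply tensorObj_ext
      intro i₁ i₂ h
      change ι A B i₁ i₂ j h ≫ gBraid A.X B.X j ≫ tensorDh B A j j' =
        ι A B i₁ i₂ j h ≫ tensorDh A B j j' ≫ gBraid A.X B.X j'
      rw [reassoc_of% (ι_tensorDh A B i₁ i₂ j j' h), Preadditive.add_comp, dh₁_gBraid A B _ _ _ _ h hj,
        dh₂_gBraid A B _ _ _ _ h hj, reassoc_of% (ι_gBraid' A B i₁ i₂ j h),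
        Linear.units_smul_comp, Category.assoc, ι_tensorDh, Preadditive.comp_add, smul_add,
        add_comm]
    · rw [(tensor B A).dh_shape _ _ hj, (tensor A B).dh_shape _ _ hj]
      exact comp_zero.trans zero_comp.symm
  comm_v j j' := by
    by_cases hj : vShape.Rel j j'
    · apply tensorObj_ext
      intro i₁ i₂ h
      change ι A B i₁ i₂ j h ≫ gBraid A.X B.X j ≫ tensorDv B A j j' =
        ι A B i₁ i₂ j h ≫ tensorDv A B j j' ≫ gBraid A.X B.X j'
      rw [reassoc_of% (ι_tensorDv A B i₁ i₂ j j' h), Preadditive.add_comp, dv₁_gBraid A B _ _ _ _ h hj,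
        dv₂_gBraid A B _ _ _ _ h hj, reassoc_of% (ι_gBraid' A B i₁ i₂ j h),
        Linear.units_smul_comp, Category.assoc, ι_tensorDv, Preadditive.comp_add, smul_add,
        add_comm]
    · rw [(tensor B A).dv_shape _ _ hj, (tensor A B).dv_shape _ _ hj]
      exact comp_zero.trans zero_comp.symm

def braidIso : tensor A B ≅ tensor B A where
  hom := braidHom A B
  inv := braidHom B A
  hom_inv_id := Hom.ext (gBraid_symm A.X B.X)
  inv_hom_id := Hom.ext (gBraid_symm B.X A.X)

lemma braid_hexagon (A B C : Bicomplex k) :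
    (α_ A B C).hom ≫ (braidIso A (B ⊗ C)).hom ≫ (α_ B C A).hom =
      (braidIso A B).hom ▷ C ≫ (α_ B A C).hom ≫ B ◁ (braidIso A C).hom :=
  Hom.ext (gBraid_hexagon A.X B.X C.X)

lemma braid_hexagon' (A B C : Bicomplex k) :
    (α_ A B C).inv ≫ (braidIso (A ⊗ B) C).hom ≫ (α_ C A B).inv =
      A ◁ (braidIso B C).hom ≫ (α_ A C B).inv ≫ (braidIso A C).hom ▷ B := by
  have h : (α_ C A B) ≪≫ (braidIso C (A ⊗ B)) ≪≫ (α_ A B C) =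
      whiskerRightIso (braidIso C A) B ≪≫ (α_ A C B) ≪≫ whiskerLeftIso A (braidIso C B) :=
    Iso.ext (braid_hexagon C A B)
  have h' := congrArg Iso.inv h
  simp only [Iso.trans_inv, Category.assoc, whiskerRightIso_inv, whiskerLeftIso_inv] at h'
  exact h'

instance : BraidedCategory (Bicomplex k) where
  braiding := braidIso
  braiding_naturality_right A _ _ f := Hom.ext (gBraid_natural (𝟙 A.X) f.f)
  braiding_naturality_left f A := Hom.ext (gBraid_natural f.f (𝟙 A.X))
  hexagon_forward := braid_hexagon
  hexagon_reverse := braid_hexagon'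

instance : SymmetricCategory (Bicomplex k) where
  symmetry A B := Hom.ext (gBraid_symm A.X B.X)

end Braiding

section Homology

lemma vShape_rel_next (i : ℕ × ℤ) : vShape.Rel i (vShape.next i) := by
  have h : vShape.Rel i (i.1, i.2 - 1) := (vShape_rel _ _).2 ⟨rfl, by simp⟩
  rwa [vShape.next_eq' h]

lemma vShape_rel_prev (i : ℕ × ℤ) : vShape.Rel (vShape.prev i) i := by
  have h : vShape.Rel (i.1, i.2 + 1) i := (vShape_rel _ _).2 ⟨rfl, rfl⟩
  rwa [vShape.prev_eq' h]

lemma dh_comp_dv (A : Bicomplex k) {i j i' j' : ℕ × ℤ} (hi : vShape.Rel i i')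
    (hj : vShape.Rel j j') : A.dh i j ≫ A.dv j j' = -(A.dv i i' ≫ A.dh i' j') := by
  by_cases h : hShape.Rel i j
  · obtain ⟨p, q⟩ := i'
    obtain ⟨p', q'⟩ := j'
    obtain ⟨r, s⟩ := i
    obtain ⟨r', s'⟩ := j
    simp only [hShape_rel, vShape_rel] at h hi hj
    obtain ⟨rfl, rfl⟩ := h
    obtain ⟨rfl, rfl⟩ := hi
    obtain ⟨rfl, h⟩ := hj
    obtain rfl : q' = q := by omega
    exact eq_neg_of_add_eq_zero_left (A.anticomm _ _)
  · have h' : ¬ hShape.Rel i' j' := by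
      simp only [hShape_rel, vShape_rel] at h hi hj ⊢
      omega
    rw [A.dh_shape _ _ h, A.dh_shape _ _ h', zero_comp, comp_zero, neg_zero]

/-- The horizontal differential as a morphism of vertical short complexes. -/
def dhShort (A : Bicomplex k) (i j : ℕ × ℤ) : A.vertical.sc i ⟶ A.vertical.sc j where
  τ₁ := -A.dh (vShape.prev i) (vShape.prev j)
  τ₂ := A.dh i j
  τ₃ := -A.dh (vShape.next i) (vShape.next j)
  comm₁₂ := (Preadditive.neg_comp _ _).trans
    (neg_eq_iff_eq_neg.2 (A.dh_comp_dv (vShape_rel_prev i) (vShape_rel_prev j)))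
  comm₂₃ := (A.dh_comp_dv (vShape_rel_next i) (vShape_rel_next j)).trans
    (Preadditive.comp_neg _ _).symm

lemma dhShort_comp (A : Bicomplex k) (i j l : ℕ × ℤ) :
    A.dhShort i j ≫ A.dhShort j l = 0 := by
  ext1
  · exact ((Preadditive.neg_comp_neg _ _).trans (A.dh_comp_dh _ _ _) :)
  · exact A.dh_comp_dh _ _ _
  · exact ((Preadditive.neg_comp_neg _ _).trans (A.dh_comp_dh _ _ _) :)

lemma dhShort_eq_zero (A : Bicomplex k) (i j : ℕ × ℤ) (h : ¬ hShape.Rel i j) :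
    A.dhShort i j = 0 := by
  have h₁ : ¬ hShape.Rel (vShape.prev i) (vShape.prev j) := by
    have hi := vShape_rel_prev i
    have hj := vShape_rel_prev j
    rw [hShape_rel] at h ⊢
    rw [vShape_rel] at hi hj
    omega
  have h₂ : ¬ hShape.Rel (vShape.next i) (vShape.next j) := by
    have hi := vShape_rel_next i
    have hj := vShape_rel_next j
    rw [hShape_rel] at h ⊢
    rw [vShape_rel] at hi hj
    omega
  ext1
  · exact (congrArg Neg.neg (A.dh_shape _ _ h₁)).trans neg_zero
  · exact A.dh_shape _ _ h
  · exact (congrArg Neg.neg (A.dh_shape _ _ h₂)).trans neg_zero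

/-- The vertical homology `H^v(X)`, with the differential `[x] ↦ [d_h x]`. -/
@[simps]
def verticalHomology (A : Bicomplex k) : HomologicalComplex (ModuleCat.{u} k) hShape where
  X i := (A.vertical.sc i).homology
  d i j := ShortComplex.homologyMap (A.dhShort i j)
  shape i j h := by
    rw [A.dhShort_eq_zero i j h]
    exact ShortComplex.homologyMap_zero _ _
  d_comp_d' i j l _ _ := by
    refine (ShortComplex.homologyMap_comp (A.dhShort i j) (A.dhShort j l)).symm.trans ?_
    rw [A.dhShort_comp i j l]
    exact ShortComplex.homologyMap_zero _ _

/-- The morphism of vertical short complexes induced by a morphism of bicomplexes. -/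
def mapShort {A B : Bicomplex k} (φ : A ⟶ B) (i : ℕ × ℤ) : A.vertical.sc i ⟶ B.vertical.sc i where
  τ₁ := φ.f (vShape.prev i)
  τ₂ := φ.f i
  τ₃ := φ.f (vShape.next i)
  comm₁₂ := φ.comm_v _ _
  comm₂₃ := φ.comm_v _ _

lemma mapShort_comm {A B : Bicomplex k} (φ : A ⟶ B) (i j : ℕ × ℤ) :
    mapShort φ i ≫ B.dhShort i j = A.dhShort i j ≫ mapShort φ j := by
  ext1
  · exact (Preadditive.comp_neg _ _).trans
      ((congrArg Neg.neg (φ.comm_h _ _)).trans (Preadditive.neg_comp _ _).symm)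
  · exact φ.comm_h _ _
  · exact (Preadditive.comp_neg _ _).trans
      ((congrArg Neg.neg (φ.comm_h _ _)).trans (Preadditive.neg_comp _ _).symm)

/-- The functor `X ↦ H^v(X)`. -/
def verticalHomologyFunctor :
    Bicomplex k ⥤ HomologicalComplex (ModuleCat.{u} k) hShape where
  obj := verticalHomology
  map φ :=
    { f := fun i => ShortComplex.homologyMap (mapShort φ i)
      comm' := fun i j _ => by
        refine (ShortComplex.homologyMap_comp (mapShort φ i) (dhShort _ i j)).symm.trans ?_
        rw [mapShort_comm]
        exact ShortComplex.homologyMap_comp (dhShort _ i j) (mapShort φ j) }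
  map_id A := by
    ext1 i
    exact ShortComplex.homologyMap_id (A.vertical.sc i)
  map_comp φ ψ := by
    ext1 i
    exact ShortComplex.homologyMap_comp (mapShort φ i) (mapShort ψ i)

/-- `H^h_{p,q}(H^v(X))` for `i = (p, q)`. -/
def E₂ (i : ℕ × ℤ) : Bicomplex k ⥤ ModuleCat.{u} k :=
  verticalHomologyFunctor ⋙ HomologicalComplex.homologyFunctor _ hShape i

end Homology

variable (k) in
/-- Weak equivalences: `H^h_{p,q}(H^v(f))` is an isomorphism for all `p` and `q`. -/
def ceWeakEquivalences : MorphismProperty (Bicomplex k) :=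
  fun _ _ φ => ∀ i, IsIso ((E₂ i).map φ)

section Cells

variable (k) in
/-- The submodule `k ⊆ k` if `i ∈ S`, and `0 ⊆ k` otherwise. -/
def cellModule (S : Set (ℕ × ℤ)) (i : ℕ × ℤ) : Submodule k k where
  carrier := {x | i ∉ S → x = 0}
  add_mem' hx hy h := by rw [hx h, hy h, add_zero]
  zero_mem' _ := rfl
  smul_mem' a x hx h := by rw [hx h, smul_zero]

open scoped Classical in
/-- Multiplication by `a` from bidegree `i` to bidegree `j`; it is zero unless `i, j ∈ S`. -/
def cellMap (S : Set (ℕ × ℤ)) (i j : ℕ × ℤ) (a : k) : cellModule k S i →ₗ[k] cellModule k S j where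
  toFun x := ⟨if j ∈ S then a * x else 0, fun h => if_neg h⟩
  map_add' x y := by
    ext
    by_cases h : j ∈ S <;> simp [h, mul_add]
  map_smul' b x := by
    ext
    by_cases h : j ∈ S <;> simp [h, mul_left_comm]

/-- The bidegrees `(n + 1, q)`, `(n, q)`, `(n + 1, q - 1)`, `(n, q - 1)` of the disc
`D^{n + 1, q}`. -/
def corners (n : ℕ) (q : ℤ) : Set (ℕ × ℤ) := {i | (i.1 = n ∨ i.1 = n + 1) ∧ (i.2 = q ∨ i.2 = q - 1)}

/-- A set of corners which is closed under the differentials of the disc. -/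
structure DiscPart (n : ℕ) (q : ℤ) where
  carrier : Set (ℕ × ℤ)
  subset : carrier ⊆ corners n q
  closed : ∀ i ∈ carrier, ∀ j ∈ corners n q, hShape.Rel i j ∨ vShape.Rel i j → j ∈ carrier

namespace DiscPart

variable {n : ℕ} {q : ℤ}

/-- The sign `-1` of the vertical differential of `D^{n + 1, q}` in column `n + 1`. -/
def columnSign (n : ℕ) (i : ℕ × ℤ) : k := if i.1 = n then 1 else -1

open scoped Classical in
variable (k) in
/-- The subbicomplex of `D^{n + 1, q}` spanned by a set of corners. -/
def toBicomplex (S : DiscPart n q) : Bicomplex k where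
  X i := ModuleCat.of k (cellModule k S.carrier i)
  dh i j := if hShape.Rel i j then ModuleCat.ofHom (cellMap S.carrier i j 1) else 0
  dv i j := if vShape.Rel i j then
    ModuleCat.ofHom (cellMap S.carrier i j (columnSign n i)) else 0
  dh_shape i j h := if_neg h
  dv_shape i j h := if_neg h
  dh_comp_dh i j l := by
    split_ifs with h₁ h₂
    · ext x
      have hx := x.2
      rw [hShape_rel] at h₁ h₂
      by_cases hl : l ∈ S.carrier
      · have : i ∉ S.carrier := fun hi => by
          have := S.subset hi
          have := S.subset hl
          simp only [corners, Set.mem_ofPred_eq] at *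
          omega
        simp [cellMap, hx this]
      · simp [cellMap, hl]
    all_goals simp
  dv_comp_dv i j l := by
    split_ifs with h₁ h₂
    · ext x
      have hx := x.2
      rw [vShape_rel] at h₁ h₂
      by_cases hl : l ∈ S.carrier
      · have : i ∉ S.carrier := fun hi => by
          have := S.subset hi
          have := S.subset hl
          simp only [corners, Set.mem_ofPred_eq] at *
          omega
        simp [cellMap, hx this]
      · simp [cellMap, hl]
    all_goals simp
  anticomm p r := by
    rw [if_pos (hShape_rel' _ _), if_pos (vShape_rel' _ _), if_pos (hShape_rel' _ _),
      if_pos (vShape_rel' _ _)]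
    ext x
    have hx := x.2
    by_cases hl : (p, r) ∈ S.carrier
    · by_cases hi : (p + 1, r + 1) ∈ S.carrier
      · have c₁ := S.subset hl
        have c₂ := S.subset hi
        simp only [corners, Set.mem_ofPred_eq] at c₁ c₂
        have e : p = n := by omega
        have h₁ : (p, r + 1) ∈ S.carrier := S.closed _ hi _
          (by simp only [corners, Set.mem_ofPred_eq]; omega) (Or.inl (hShape_rel' _ _))
        have h₂ : (p + 1, r) ∈ S.carrier := S.closed _ hi _
          (by simp only [corners, Set.mem_ofPred_eq]; omega) (Or.inr (vShape_rel' _ _))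
        subst e
        simp [cellMap, hl, h₁, h₂, columnSign]
      · simp [cellMap, hx hi]
    · simp [cellMap, hl]

variable (k) in
/-- The inclusion of subbicomplexes of `D^{n + 1, q}`. -/
def incl {S T : DiscPart n q} (h : S.carrier ⊆ T.carrier) : S.toBicomplex k ⟶ T.toBicomplex k where
  f i := ModuleCat.ofHom
    { toFun := fun x => ⟨x, fun hi => x.2 fun hi' => hi (h hi')⟩
      map_add' := fun _ _ => rfl
      map_smul' := fun _ _ => rfl }
  comm_h i j := by
    simp only [toBicomplex]
    split_ifs with hij
    · ext x
      by_cases hj : j ∈ S.carrier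
      · simp [cellMap, hj, h hj]
      · by_cases hj' : j ∈ T.carrier
        · have : i ∉ S.carrier := fun hi => hj (S.closed _ hi _ (T.subset hj') (Or.inl hij))
          simp [cellMap, x.2 this]
        · simp [cellMap, hj, hj']
    · exact comp_zero.trans zero_comp.symm
  comm_v i j := by
    simp only [toBicomplex]
    split_ifs with hij
    · ext x
      by_cases hj : j ∈ S.carrier
      · simp [cellMap, hj, h hj]
      · by_cases hj' : j ∈ T.carrier
        · have : i ∉ S.carrier := fun hi => hj (S.closed _ hi _ (T.subset hj') (Or.inr hij))
          simp [cellMap, x.2 this]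
        · simp [cellMap, hj, hj']
    · exact comp_zero.trans zero_comp.symm

variable (n q)

/-- The disc `D^{n + 1, q}`. -/
def disc : DiscPart n q := ⟨corners n q, subset_rfl, fun _ _ _ hj _ => hj⟩

/-- The horizontal boundaries `∂_h D^{n + 1, q}`. -/
def horizontalBoundary : DiscPart n q where
  carrier := {(n, q), (n, q - 1)}
  subset := by rintro _ (rfl | rfl) <;> simp [corners]
  closed := by
    rintro _ (rfl | rfl) ⟨r, s⟩ h h' <;>
    · simp only [hShape_rel, vShape_rel, corners, Set.mem_ofPred_eq, Set.mem_insert_iff,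
        Set.mem_singleton_iff, Prod.mk.injEq] at *
      omega

/-- The vertical boundaries `∂_v D^{n + 1, q}`. -/
def verticalBoundary : DiscPart n q where
  carrier := {(n + 1, q - 1), (n, q - 1)}
  subset := by rintro _ (rfl | rfl) <;> simp [corners]
  closed := by
    rintro _ (rfl | rfl) ⟨r, s⟩ h h' <;>
    · simp only [hShape_rel, vShape_rel, corners, Set.mem_ofPred_eq, Set.mem_insert_iff,
        Set.mem_singleton_iff, Prod.mk.injEq] at *
      omega

/-- The sphere `S^{n, q - 1}`. -/
def sphere : DiscPart n q where
  carrier := {(n, q - 1)}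
  subset := by rintro _ rfl; simp [corners]
  closed := by
    rintro _ rfl ⟨r, s⟩ h h'
    simp only [hShape_rel, vShape_rel, corners, Set.mem_ofPred_eq,
        Set.mem_singleton_iff, Prod.mk.injEq] at *
    omega

/-- The zero bicomplex. -/
def zero : DiscPart n q := ⟨∅, Set.empty_subset _, fun _ h => h.elim⟩

variable {n q} in
lemma zero_subset (S : DiscPart n q) : (zero n q).carrier ⊆ S.carrier := Set.empty_subset _

lemma sphere_subset : (sphere n q).carrier ⊆ (verticalBoundary n q).carrier :=
  Set.subset_insert _ _

lemma horizontalBoundary_subset : (horizontalBoundary n q).carrier ⊆ (disc n q).carrier :=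
  (horizontalBoundary n q).subset

end DiscPart

lemma DiscPart.isZero_zero (n : ℕ) (q : ℤ) : IsZero ((DiscPart.zero n q).toBicomplex k) := by
  have h (i : ℕ × ℤ) : Subsingleton (cellModule k (∅ : Set (ℕ × ℤ)) i) :=
    ⟨fun x y => Subtype.ext ((x.2 (Set.notMem_empty i)).trans (y.2 (Set.notMem_empty i)).symm)⟩
  have h' (i : ℕ × ℤ) : IsZero (((DiscPart.zero n q).toBicomplex k).X i) :=
    @ModuleCat.isZero_of_subsingleton _ _ (ModuleCat.of k (cellModule k (∅ : Set (ℕ × ℤ)) i)) (h i)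
  refine ⟨fun B => ⟨⟨⟨⟨fun i => 0, ?_, ?_⟩⟩, fun φ => Hom.ext (funext fun i => (h' i).eq_of_src _ _)⟩⟩,
    fun B => ⟨⟨⟨⟨fun i => 0, ?_, ?_⟩⟩, fun φ => Hom.ext (funext fun i => (h' i).eq_of_tgt _ _)⟩⟩⟩
  all_goals intro i j; exact zero_comp.trans comp_zero.symm

end Cells

open DiscPart

variable (k) in
/-- The generating cofibrations
`0 → S^{0,q-1}`, `S^{n,q-1} → ∂_v D^{n+1,q}`, `0 → ∂_h D^{1,q}`, `∂_h D^{n+1,q} → D^{n+1,q}`,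
for `n : ℕ` and `q : ℤ`. -/
def ceGeneratingCofibrations : MorphismProperty (Bicomplex k) :=
  MorphismProperty.ofHoms (fun q : ℤ => incl k (zero_subset (sphere 0 q))) ⊔
  MorphismProperty.ofHoms (fun i : ℕ × ℤ => incl k (sphere_subset i.1 i.2)) ⊔
  MorphismProperty.ofHoms (fun q : ℤ => incl k (zero_subset (horizontalBoundary 0 q))) ⊔
  MorphismProperty.ofHoms (fun i : ℕ × ℤ => incl k (horizontalBoundary_subset i.1 i.2))

variable (k) in
/-- The generating trivial cofibrations
`0 → ∂_v D^{n+1,q}`, `0 → ∂_h D^{1,q}`, `∂_h D^{n+1,q} → D^{n+1,q}`, for `n : ℕ` and `q : ℤ`. -/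
def ceGeneratingTrivialCofibrations : MorphismProperty (Bicomplex k) :=
  MorphismProperty.ofHoms (fun i : ℕ × ℤ => incl k (zero_subset (verticalBoundary i.1 i.2))) ⊔
  MorphismProperty.ofHoms (fun q : ℤ => incl k (zero_subset (horizontalBoundary 0 q))) ⊔
  MorphismProperty.ofHoms (fun i : ℕ × ℤ => incl k (horizontalBoundary_subset i.1 i.2))

variable (k) in
/-- Cofibrations: the maps with the left lifting property against all maps that have the right
lifting property against the generating cofibrations. -/
def ceCofibrations : MorphismProperty (Bicomplex k) := (ceGeneratingCofibrations k).rlp.llp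

variable (k) in
/-- Fibrations: the maps with the right lifting property against the generating trivial
cofibrations. -/
def ceFibrations : MorphismProperty (Bicomplex k) := (ceGeneratingTrivialCofibrations k).rlp

end Bicomplex

section MonoidalModelCategories

variable (C : Type u) [Category.{v} C] [MonoidalCategory C] [SymmetricCategory C] [ModelCategory C]

/-- A model category with a closed symmetric monoidal structure is a monoidal model category if
it satisfies the pushout-product axiom and the unit axiom. The pushout-product of `f : A ⟶ B` and
`g : X ⟶ Y` is the map `(B ⊗ X) ⊔_(A ⊗ X) (A ⊗ Y) ⟶ B ⊗ Y`. -/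
structure IsMonoidalModelCategory : Prop where
  closed : Nonempty (MonoidalClosed C)
  cofibrations_pushoutProduct {A B X Y : C} (f : A ⟶ B) (g : X ⟶ Y)
    (hf : cofibrations C f) (hg : cofibrations C g)
    (sq : (curriedTensor C).PushoutObjObj f g) : cofibrations C sq.ι
  trivialCofibrations_pushoutProduct_left {A B X Y : C} (f : A ⟶ B) (g : X ⟶ Y)
    (hf : trivialCofibrations C f) (hg : cofibrations C g)
    (sq : (curriedTensor C).PushoutObjObj f g) : trivialCofibrations C sq.ι
  trivialCofibrations_pushoutProduct_right {A B X Y : C} (f : A ⟶ B) (g : X ⟶ Y)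
    (hf : cofibrations C f) (hg : trivialCofibrations C g)
    (sq : (curriedTensor C).PushoutObjObj f g) : trivialCofibrations C sq.ι
  unit_left {Q : C} [IsCofibrant Q] (e : Q ⟶ 𝟙_ C) (he : trivialFibrations C e)
    (X : C) [IsCofibrant X] : weakEquivalences C (e ▷ X)
  unit_right {Q : C} [IsCofibrant Q] (e : Q ⟶ 𝟙_ C) (he : trivialFibrations C e)
    (X : C) [IsCofibrant X] : weakEquivalences C (X ◁ e)

/-- The maps `j ⊗ Z` with `j` a trivial cofibration and `Z` an object. -/
def tensoredTrivialCofibrations : MorphismProperty C :=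
  MorphismProperty.ofHoms (ι := Σ (x : C × C), {f : x.1 ⟶ x.2 // trivialCofibrations C f} × C)
    (fun x => x.2.1.1 ▷ x.2.2)

/-- The monoid axiom: transfinite compositions of pushouts of maps `j ⊗ Z`, with `j` a trivial
cofibration, are weak equivalences. -/
def MonoidAxiom : Prop :=
  MorphismProperty.transfiniteCompositions.{v} (tensoredTrivialCofibrations C).pushouts ≤
    weakEquivalences C

end MonoidalModelCategories

end

/-! The argument is carried by elements. A bicomplex is replaced by the product `Tot A` of all its
modules, with two anticommuting operators `Dh` and `Dv`. Spheres, boundaries and discs corepresent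
homogeneous elements killed by both, one or none of the operators, so lifting against a generator is
solving an equation. Lifting against `I` means `DLift` and `SLift`: the map is a surjective
quasi-isomorphism on horizontal complexes, and also on horizontal complexes of vertical cycles.
Lifting against `J` means `DLift` and `VSurj`, the latter being surjectivity on vertical cycles in
positive columns (`ceGeneratingCofibrations_rlp_iff`, `ceFibrations_iff`).

Trivial fibrations are the maps lifting against `I` (`ceGeneratingCofibrations_rlp`). Let K be the
kernel of a fibration that is a weak equivalence. `DLift` makes K horizontally acyclic; the weak
equivalence makes all vertical cycles lift and makes closed classes of K die on the second page,
that is x = Dh x₁ + Dv x₂ inside K. Replacing x₂ by a horizontal boundary, by induction on the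
column, shows that the vertical cycles of K are horizontally acyclic (`kernel_acyclic`), which is
what `SLift` needs. The converse `weakEquivalence_of_lift` is a diagram chase.

Trivial cofibrations and the monoid axiom are treated together through acyclic embeddings: injective
maps, injective on vertical homology, whose cokernel has vanishing second page. Long exact
sequences, unwound by hand, show that they are weak equivalences. They are closed under composition,
retracts, pushouts, coproducts and filtered colimits, and contain j ⊗ Z for j in `J` and any Z,
because a contraction h of a factor extends to h ⊗ 1 (`isAcyclicEmbedding_whiskerRight`). The small
object argument applies since the sources of the generators are zero or generated by one element
with finitely many relations; with the retract argument it gives the model structure. The monoid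
axiom is then a closure statement, with no cofibrancy assumed of Z.

For the pushout-product, closedness and the two-variable adjunction reduce to generators. Each
generator attaches either one cell, with no vertical differential present, or a cell e together with
its vertical boundary. A map out of a tensor product of two parts of discs is a pairing on cells. If
one factor is of the second kind, the values on e ⊗ - are found with `DLift`, and the values on the
vertical boundary of e are then forced by the relations (`exists_extension_of_dLift`). If both are
of the first kind, a single value is missing and it is a vertical cycle, so `SLift` applies
(`exists_extension_of_sLift`). The trivial case follows by two-out-of-three from acyclic embeddings.
The unit is the sphere in bidegree (0, 0), hence cofibrant, and the unit axiom follows from Ken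
Brown's factorization. -/

noncomputable section

/-! ### Elements of the total space and the operators `Dh` and `Dv` -/

namespace Bicomplex

variable {k : Type u} [CommRing k]

/-- The target `(p - 1, q)` of the horizontal differential (`(0, q)` for `p = 0`). -/
abbrev hn (i : ℕ × ℤ) : ℕ × ℤ := (i.1 - 1, i.2)
/-- The source `(p + 1, q)` of the horizontal differential. -/
abbrev hp (i : ℕ × ℤ) : ℕ × ℤ := (i.1 + 1, i.2)
/-- The target `(p, q - 1)` of the vertical differential. -/
abbrev vn (i : ℕ × ℤ) : ℕ × ℤ := (i.1, i.2 - 1)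
/-- The source `(p, q + 1)` of the vertical differential. -/
abbrev vp (i : ℕ × ℤ) : ℕ × ℤ := (i.1, i.2 + 1)

lemma hn_hp (i : ℕ × ℤ) : hn (hp i) = i := by simp [hn]
lemma vn_vp (i : ℕ × ℤ) : vn (vp i) = i := by simp [vn]
lemma vp_vn (i : ℕ × ℤ) : vp (vn i) = i := by simp [vp]

lemma hRel_hp (i : ℕ × ℤ) : hShape.Rel (hp i) i := (hShape_rel _ _).2 ⟨rfl, rfl⟩
lemma vRel_vp (i : ℕ × ℤ) : vShape.Rel (vp i) i := (vShape_rel _ _).2 ⟨rfl, rfl⟩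
lemma vRel_vn (i : ℕ × ℤ) : vShape.Rel i (vn i) := by simp

lemma eq_hp {i j : ℕ × ℤ} (h : hShape.Rel i j) : i = hp j := by
  rw [hShape_rel] at h; ext <;> simp [h.1, h.2]
lemma eq_vp {i j : ℕ × ℤ} (h : vShape.Rel i j) : i = vp j := by
  rw [vShape_rel] at h; ext <;> simp [h.1, h.2]

/-- The product of all the modules of a bicomplex. -/
abbrev Tot (A : Bicomplex k) : Type u := ∀ i, A.X i

variable (A : Bicomplex k) {B C : Bicomplex k}

/-- The horizontal differential on the total space. -/
def Dh : Tot A →ₗ[k] Tot A where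
  toFun x j := A.dh (hp j) j (x (hp j))
  map_add' x y := by ext j; simp
  map_smul' a x := by ext j; simp

/-- The vertical differential on the total space. -/
def Dv : Tot A →ₗ[k] Tot A where
  toFun x j := A.dv (vp j) j (x (vp j))
  map_add' x y := by ext j; simp
  map_smul' a x := by ext j; simp

/-- The map of total spaces induced by a morphism. -/
def totMap {A B : Bicomplex k} (φ : A ⟶ B) : Tot A →ₗ[k] Tot B where
  toFun x j := φ.f j (x j)
  map_add' x y := by ext j; simp
  map_smul' a x := by ext j; simp

lemma Dh_apply (x : Tot A) (j : ℕ × ℤ) : Dh A x j = A.dh (hp j) j (x (hp j)) := rfl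
lemma Dv_apply (x : Tot A) (j : ℕ × ℤ) : Dv A x j = A.dv (vp j) j (x (vp j)) := rfl
lemma totMap_apply (φ : A ⟶ B) (x : Tot A) (j : ℕ × ℤ) : totMap φ x j = φ.f j (x j) := rfl

lemma Dh_apply_of_rel (x : Tot A) {i j : ℕ × ℤ} (h : hShape.Rel i j) :
    Dh A x j = A.dh i j (x i) := by
  obtain rfl := eq_hp h; rfl

lemma Dv_apply_of_rel (x : Tot A) {i j : ℕ × ℤ} (h : vShape.Rel i j) :
    Dv A x j = A.dv i j (x i) := by
  obtain rfl := eq_vp h; rfl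

@[simp]
lemma Dh_Dh (x : Tot A) : Dh A (Dh A x) = 0 := by
  ext j
  exact ConcreteCategory.congr_hom (A.dh_comp_dh (hp (hp j)) (hp j) j) (x _)

@[simp]
lemma Dv_Dv (x : Tot A) : Dv A (Dv A x) = 0 := by
  ext j
  exact ConcreteCategory.congr_hom (A.dv_comp_dv (vp (vp j)) (vp j) j) (x _)

lemma Dh_Dv (x : Tot A) : Dh A (Dv A x) = - Dv A (Dh A x) := by
  ext j
  have h := ConcreteCategory.congr_hom (A.anticomm j.1 j.2) (x (j.1 + 1, j.2 + 1))
  exact eq_neg_of_add_eq_zero_right h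

lemma Dv_Dh (x : Tot A) : Dv A (Dh A x) = - Dh A (Dv A x) := by rw [Dh_Dv, neg_neg]

variable {A}

lemma totMap_Dh (φ : A ⟶ B) (x : Tot A) : totMap φ (Dh A x) = Dh B (totMap φ x) := by
  ext j
  exact (ConcreteCategory.congr_hom (φ.comm_h (hp j) j) (x _)).symm

lemma totMap_Dv (φ : A ⟶ B) (x : Tot A) : totMap φ (Dv A x) = Dv B (totMap φ x) := by
  ext j
  exact (ConcreteCategory.congr_hom (φ.comm_v (vp j) j) (x _)).symm

lemma totMap_comp (φ : A ⟶ B) (ψ : B ⟶ C) (x : Tot A) :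
    totMap (φ ≫ ψ) x = totMap ψ (totMap φ x) := rfl

@[simp]
lemma totMap_id (x : Tot A) : totMap (𝟙 A) x = x := rfl

/-- The element of the total space concentrated in one bidegree. -/
def single (i : ℕ × ℤ) (x : A.X i) : Tot A := Pi.single (M := fun j => A.X j) i x

@[simp]
lemma single_self (i : ℕ × ℤ) (x : A.X i) : single i x i = x :=
  Pi.single_eq_same (M := fun j => A.X j) i x

lemma single_ne {i j : ℕ × ℤ} (h : j ≠ i) (x : A.X i) : single i x j = 0 :=
  Pi.single_eq_of_ne (M := fun j => A.X j) h x

@[simp]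
lemma single_zero (i : ℕ × ℤ) : single i (0 : A.X i) = 0 :=
  Pi.single_zero (M := fun j => A.X j) i

lemma totMap_single (φ : A ⟶ B) (i : ℕ × ℤ) (x : A.X i) :
    totMap φ (single i x) = single i (φ.f i x) := by
  ext j
  by_cases h : j = i
  · subst h; simp [totMap_apply]
  · simp [totMap_apply, single_ne h]

lemma Dh_single_of_rel {i j : ℕ × ℤ} (h : hShape.Rel i j) (x : A.X i) :
    Dh A (single i x) = single j (A.dh i j x) := by
  ext l
  by_cases hl : l = j
  · subst hl; rw [Dh_apply_of_rel _ _ h]; simp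
  · rw [single_ne hl, Dh_apply, single_ne, map_zero]
    rintro rfl
    rw [hShape_rel] at h
    exact hl (by ext <;> simp at h ⊢ <;> omega)

/-- In column 0 truncated subtraction gives `hn i = i`. The formula survives there because both
sides are zero. -/
lemma Dh_single (i : ℕ × ℤ) (x : A.X i) :
    Dh A (single i x) = single (hn i) (A.dh i (hn i) x) := by
  obtain ⟨_ | p, q⟩ := i
  · rw [A.dh_shape _ _ (hShape_not_rel _ _)]
    ext l
    rw [Dh_apply, single_ne (by simp [hp])]
    simp
  · exact Dh_single_of_rel (by simp) x

lemma Dv_single_of_rel {i j : ℕ × ℤ} (h : vShape.Rel i j) (x : A.X i) :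
    Dv A (single i x) = single j (A.dv i j x) := by
  ext l
  by_cases hl : l = j
  · subst hl; rw [Dv_apply_of_rel _ _ h]; simp
  · rw [single_ne hl, Dv_apply, single_ne, map_zero]
    rintro rfl
    rw [vShape_rel] at h
    exact hl (by ext <;> simp at h ⊢ <;> omega)

lemma Dv_single (i : ℕ × ℤ) (x : A.X i) :
    Dv A (single i x) = single (vn i) (A.dv i (vn i) x) :=
  Dv_single_of_rel (vRel_vn i) x

/-- An element of the total space which is concentrated in bidegree `i`. -/
def Homog (i : ℕ × ℤ) (x : Tot A) : Prop := ∀ j, j ≠ i → x j = 0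

lemma Homog.eq_single {i : ℕ × ℤ} {x : Tot A} (h : Homog i x) : x = single i (x i) := by
  ext j
  by_cases hj : j = i
  · subst hj; simp
  · rw [h j hj, single_ne hj]

lemma homog_single (i : ℕ × ℤ) (x : A.X i) : Homog i (single i x) :=
  fun _ h => single_ne h x

lemma homog_zero (i : ℕ × ℤ) : Homog i (0 : Tot A) := fun _ _ => rfl

lemma Homog.add {i : ℕ × ℤ} {x y : Tot A} (hx : Homog i x) (hy : Homog i y) : Homog i (x + y) :=
  fun j h => by simp [hx j h, hy j h]

lemma Homog.neg {i : ℕ × ℤ} {x : Tot A} (hx : Homog i x) : Homog i (-x) :=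
  fun j h => by simp [hx j h]

lemma Homog.sub {i : ℕ × ℤ} {x y : Tot A} (hx : Homog i x) (hy : Homog i y) : Homog i (x - y) :=
  fun j h => by simp [hx j h, hy j h]

lemma Homog.zsmul {i : ℕ × ℤ} {x : Tot A} (hx : Homog i x) (n : ℤ) : Homog i (n • x) :=
  fun j h => by simp [hx j h]

lemma Homog.smul {i : ℕ × ℤ} {x : Tot A} (hx : Homog i x) (a : k) : Homog i (a • x) :=
  fun j h => by simp [hx j h]

lemma Homog.Dh {i : ℕ × ℤ} {x : Tot A} (hx : Homog i x) : Homog (hn i) (Dh A x) := by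
  rw [hx.eq_single, Dh_single]; exact homog_single _ _

lemma Homog.Dv {i : ℕ × ℤ} {x : Tot A} (hx : Homog i x) : Homog (vn i) (Dv A x) := by
  rw [hx.eq_single, Dv_single]; exact homog_single _ _

lemma Homog.totMap {i : ℕ × ℤ} {x : Tot A} (hx : Homog i x) (φ : A ⟶ B) :
    Homog i (totMap φ x) := fun j h => by rw [totMap_apply, hx j h, map_zero]

lemma Homog.Dh_eq_zero {q : ℤ} {x : Tot A} (hx : Homog (0, q) x) : Bicomplex.Dh A x = 0 := by
  rw [hx.eq_single, Dh_single, A.dh_shape _ _ (hShape_not_rel _ _)]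
  simp

end Bicomplex

end

/-! ### The second page and weak equivalences in terms of representatives -/

noncomputable section

namespace Bicomplex

variable {k : Type u} [CommRing k]

section HomologyClasses

variable (S : ShortComplex (ModuleCat.{u} k))

/-- `h` is the homology class of the cycle `z`. -/
def IsClass (z : S.X₂) (h : S.homology) : Prop := ∃ c : S.cycles, S.iCycles c = z ∧ S.homologyπ c = h

variable {S}

lemma IsClass.exists_rep (h : S.homology) : ∃ z, IsClass S z h := by
  obtain ⟨c, rfl⟩ := (ModuleCat.epi_iff_surjective S.homologyπ).1 inferInstance h
  exact ⟨_, c, rfl, rfl⟩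

lemma IsClass.exists_class (z : S.X₂) (hz : S.g z = 0) : ∃ h, IsClass S z h :=
  ⟨_, S.moduleCatCyclesIso.inv ⟨z, hz⟩,
    ConcreteCategory.congr_hom S.moduleCatCyclesIso_inv_iCycles ⟨z, hz⟩, rfl⟩

lemma IsClass.cycle {z : S.X₂} {h : S.homology} (hz : IsClass S z h) : S.g z = 0 := by
  obtain ⟨c, rfl, -⟩ := hz
  exact ConcreteCategory.congr_hom S.iCycles_g c

lemma IsClass.sub {z z' : S.X₂} {h h' : S.homology} (hz : IsClass S z h) (hz' : IsClass S z' h') :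
    IsClass S (z - z') (h - h') := by
  obtain ⟨c, rfl, rfl⟩ := hz
  obtain ⟨c', rfl, rfl⟩ := hz'
  exact ⟨c - c', map_sub _ _ _, map_sub _ _ _⟩

lemma IsClass.map {T : ShortComplex (ModuleCat.{u} k)} (φ : S ⟶ T) {z : S.X₂} {h : S.homology}
    (hz : IsClass S z h) : IsClass T (φ.τ₂ z) (ShortComplex.homologyMap φ h) := by
  obtain ⟨c, rfl, rfl⟩ := hz
  exact ⟨ShortComplex.cyclesMap φ c,
    ConcreteCategory.congr_hom (ShortComplex.cyclesMap_i φ) c,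
    (ConcreteCategory.congr_hom (ShortComplex.homologyπ_naturality φ) c).symm⟩

/-- One direction reads the class in the concrete quotient of cycles by boundaries; the other uses
that boundaries die under the projection from cycles to homology. -/
lemma IsClass.eq_zero_iff {z : S.X₂} {h : S.homology} (hz : IsClass S z h) :
    h = 0 ↔ ∃ x, S.f x = z := by
  obtain ⟨c, rfl, rfl⟩ := hz
  constructor
  · intro h
    have h' := congrArg S.moduleCatHomologyIso.hom h
    rw [map_zero] at h'
    have h'' := (ConcreteCategory.congr_hom S.π_moduleCatCyclesIso_hom c).symm.trans h'
    obtain ⟨x, hx⟩ := (Submodule.Quotient.mk_eq_zero _).1 h''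
    refine ⟨x, (congrArg Subtype.val hx).trans ?_⟩
    exact ConcreteCategory.congr_hom S.moduleCatCyclesIso_hom_i c
  · rintro ⟨x, hx⟩
    have : S.toCycles x = c := by
      apply (ModuleCat.mono_iff_injective S.iCycles).1 inferInstance
      rw [← hx]
      exact ConcreteCategory.congr_hom S.toCycles_i x
    rw [← this]
    exact ConcreteCategory.congr_hom S.toCycles_comp_homologyπ x

lemma IsClass.eq_iff {z z' : S.X₂} {h h' : S.homology} (hz : IsClass S z h)
    (hz' : IsClass S z' h') : h = h' ↔ ∃ x, S.f x = z - z' := by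
  rw [← sub_eq_zero, (hz.sub hz').eq_zero_iff]

end HomologyClasses

section SecondPage

variable {A B : Bicomplex k}

/-- `e` is the class of `z` in `H^h(H^v(A))`. -/
def IsE₂ (i : ℕ × ℤ) (z : A.X i) (e : (E₂ i).obj A) : Prop :=
  ∃ h : A.verticalHomology.X i, IsClass (A.vertical.sc i) z h ∧ IsClass (A.verticalHomology.sc i) h e

lemma dv_eq_zero_iff {i : ℕ × ℤ} (z : A.X i) :
    (A.vertical.sc i).g z = 0 ↔ ∀ j, A.dv i j z = 0 := by
  refine ⟨fun h j => ?_, fun h => h _⟩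
  by_cases hj : vShape.Rel i j
  · rw [← vShape.next_eq' hj]; exact h
  · rw [A.dv_shape _ _ hj]; rfl

/-- The vertical class of `z` survives to the second page: locally in bidegree `i`. -/
def LocCyc (i : ℕ × ℤ) (z : A.X i) : Prop :=
  (∀ j, A.dv i j z = 0) ∧ ∀ j, ∃ y : A.X (vp j), A.dv (vp j) j y = A.dh i j z

/-- The class of `z` vanishes on the second page: locally in bidegree `i`. -/
def LocBd (i : ℕ × ℤ) (z : A.X i) : Prop :=
  ∃ (y : A.X (hp i)) (w : A.X (vp i)), (∀ j, A.dv (hp i) j y = 0) ∧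
    z = A.dh (hp i) i y + A.dv (vp i) i w

lemma vertical_sc_f (i : ℕ × ℤ) (z : A.X i) :
    (∃ x, (A.vertical.sc i).f x = z) ↔ ∃ y : A.X (vp i), A.dv (vp i) i y = z := by
  obtain h : vShape.prev i = vp i := vShape.prev_eq' (vRel_vp i)
  change (∃ x, A.dv (vShape.prev i) i x = z) ↔ _
  rw [h]

lemma isClass_d {i j : ℕ × ℤ} {z : A.X i} {h : A.verticalHomology.X i}
    (hz : IsClass (A.vertical.sc i) z h) :
    IsClass (A.vertical.sc j) (A.dh i j z) (A.verticalHomology.d i j h) :=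
  hz.map (A.dhShort i j)

/-- The differential on vertical homology is computed on representatives by d_h. Quantifying over
every `j` is harmless: off the shape d_h vanishes and 0 is a preimage. This avoids naming the next
index. -/
lemma verticalHomology_g_eq_zero {i : ℕ × ℤ} {z : A.X i} {h : A.verticalHomology.X i}
    (hz : IsClass (A.vertical.sc i) z h) :
    (A.verticalHomology.sc i).g h = 0 ↔ ∀ j, ∃ y : A.X (vp j), A.dv (vp j) j y = A.dh i j z := by
  refine ⟨fun hh j => ?_, fun hh => ?_⟩
  · by_cases hj : hShape.Rel i j
    · obtain rfl := hShape.next_eq' hj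
      exact (vertical_sc_f _ _).1 ((isClass_d hz).eq_zero_iff.1 hh)
    · exact ⟨0, by rw [A.dh_shape _ _ hj, map_zero]; rfl⟩
  · exact (isClass_d hz).eq_zero_iff.2 ((vertical_sc_f _ _).2 (hh _))

lemma IsE₂.exists_rep (i : ℕ × ℤ) (e : (E₂ i).obj A) : ∃ z, IsE₂ i z e := by
  obtain ⟨h, hh⟩ := IsClass.exists_rep e
  obtain ⟨z, hz⟩ := IsClass.exists_rep (S := A.vertical.sc i) h
  exact ⟨z, h, hz, hh⟩

lemma IsE₂.locCyc {i : ℕ × ℤ} {z : A.X i} {e : (E₂ i).obj A} (h : IsE₂ i z e) : LocCyc i z := by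
  obtain ⟨h, hz, he⟩ := h
  exact ⟨(dv_eq_zero_iff z).1 hz.cycle, (verticalHomology_g_eq_zero hz).1 he.cycle⟩

lemma LocCyc.exists_class {i : ℕ × ℤ} {z : A.X i} (hz : LocCyc i z) : ∃ e, IsE₂ i z e := by
  obtain ⟨h, hh⟩ := IsClass.exists_class (S := A.vertical.sc i) z ((dv_eq_zero_iff z).2 hz.1)
  obtain ⟨e, he⟩ := IsClass.exists_class (S := A.verticalHomology.sc i) h
    ((verticalHomology_g_eq_zero hh).2 hz.2)
  exact ⟨e, h, hh, he⟩

lemma IsE₂.sub {i : ℕ × ℤ} {z z' : A.X i} {e e' : (E₂ i).obj A} (h : IsE₂ i z e)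
    (h' : IsE₂ i z' e') : IsE₂ i (z - z') (e - e') := by
  obtain ⟨h, hz, he⟩ := h
  obtain ⟨h', hz', he'⟩ := h'
  exact ⟨_, hz.sub hz', he.sub he'⟩

lemma IsE₂.map (φ : A ⟶ B) {i : ℕ × ℤ} {z : A.X i} {e : (E₂ i).obj A} (h : IsE₂ i z e) :
    IsE₂ i (φ.f i z) ((E₂ i).map φ e) := by
  obtain ⟨h, hz, he⟩ := h
  exact ⟨_, hz.map (mapShort φ i), he.map ((HomologicalComplex.shortComplexFunctor _ _ i).map
    (verticalHomologyFunctor.map φ))⟩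

lemma IsE₂.eq_zero_iff {i : ℕ × ℤ} {z : A.X i} {e : (E₂ i).obj A} (h : IsE₂ i z e) :
    e = 0 ↔ LocBd i z := by
  obtain ⟨h, hz, he⟩ := h
  refine he.eq_zero_iff.trans ?_
  have hprev : hShape.prev i = hp i := hShape.prev_eq' (hRel_hp i)
  change (∃ x : A.verticalHomology.X (hShape.prev i), A.verticalHomology.d (hShape.prev i) i x = h) ↔ _
  rw [hprev]
  constructor
  · rintro ⟨x, rfl⟩
    obtain ⟨y, hy⟩ := IsClass.exists_rep (S := A.vertical.sc (hp i)) x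
    obtain ⟨w, hw⟩ := (vertical_sc_f _ _).1 ((hz.eq_iff (isClass_d hy)).1 rfl)
    exact ⟨y, w, (dv_eq_zero_iff y).1 hy.cycle, hw.symm ▸ (add_sub_cancel (A.dh (hp i) i y) z).symm⟩
  · rintro ⟨y, w, hy, rfl⟩
    obtain ⟨x, hx⟩ := IsClass.exists_class (S := A.vertical.sc (hp i)) y ((dv_eq_zero_iff y).2 hy)
    refine ⟨x, (((isClass_d hx).eq_iff hz).2 ((vertical_sc_f _ _).2 ⟨-w, ?_⟩))⟩
    rw [map_neg]
    exact (by intros; abel : ∀ a b : A.X i, -b = a - (a + b)) _ _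

/-- The two conjuncts are injectivity and surjectivity on the second page, translated to
representatives so that the homology objects disappear. -/
lemma isIso_E₂_map_iff (φ : A ⟶ B) (i : ℕ × ℤ) :
    IsIso ((E₂ i).map φ) ↔ (∀ z : A.X i, LocCyc i z → LocBd i (φ.f i z) → LocBd i z) ∧
      ∀ y : B.X i, LocCyc i y → ∃ z : A.X i, LocCyc i z ∧ LocBd i (y - φ.f i z) := by
  rw [ConcreteCategory.isIso_iff_bijective]
  refine and_congr ?_ ?_
  · rw [injective_iff_map_eq_zero]
    constructor
    · intro h z hz hb
      obtain ⟨e, he⟩ := hz.exists_class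
      exact he.eq_zero_iff.1 (h e ((he.map φ).eq_zero_iff.2 hb))
    · intro h e he
      obtain ⟨z, hz⟩ := IsE₂.exists_rep i e
      exact hz.eq_zero_iff.2 (h z hz.locCyc ((hz.map φ).eq_zero_iff.1 he))
  · constructor
    · intro h y hy
      obtain ⟨e, he⟩ := hy.exists_class
      obtain ⟨e', rfl⟩ := h e
      obtain ⟨z, hz⟩ := IsE₂.exists_rep i e'
      exact ⟨z, hz.locCyc, (he.sub (hz.map φ)).eq_zero_iff.1 (sub_self _)⟩
    · intro h e
      obtain ⟨y, hy⟩ := IsE₂.exists_rep i e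
      obtain ⟨z, hz, hb⟩ := h y hy.locCyc
      obtain ⟨e', he'⟩ := hz.exists_class
      exact ⟨e', (sub_eq_zero.1 ((hy.sub (he'.map φ)).eq_zero_iff.2 hb)).symm⟩

/-- Since `vp` is a bijection of bidegrees, a family of elements one step up is the same as an
element of the total space; the transport along equal bidegrees is confined to this proof. -/
lemma exists_tot_vp (u : ∀ j, A.X (vp j)) : ∃ w : Tot A, ∀ j, w (vp j) = u j := by
  have h (l : ℕ × ℤ) : ∃ x : A.X l, ∀ j (h : vp j = l), x = h ▸ u j := by
    obtain ⟨j, rfl⟩ : ∃ j, vp j = l := ⟨vn l, vp_vn l⟩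
    refine ⟨u j, fun j' h => ?_⟩
    obtain rfl : j' = j := by rw [← vn_vp j, ← vn_vp j', h]
    rfl
  choose w hw using h
  exact ⟨w, fun j => hw _ j rfl⟩

/-- The map `hp` is injective with image the positive columns, so the family is extended by zero to
column 0. That zero is what keeps the extension a vertical cycle in `bd_iff`. -/
lemma exists_tot_hp (u : ∀ j, A.X (hp j)) :
    ∃ w : Tot A, (∀ j, w (hp j) = u j) ∧ ∀ q, w (0, q) = 0 :=
  ⟨fun l => match l with
    | (0, _) => 0
    | (p + 1, q) => u (p, q), fun _ => rfl, fun _ => rfl⟩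

/-- The elements of the total space whose vertical class survives to the second page. -/
def Cyc (x : Tot A) : Prop := Dv A x = 0 ∧ ∃ w, Dh A x = Dv A w

/-- The elements of the total space which vanish on the second page. -/
def Bd (x : Tot A) : Prop := ∃ y w, Dv A y = 0 ∧ x = Dh A y + Dv A w

lemma mem_range_Dv_iff (x : Tot A) :
    (∃ w, x = Dv A w) ↔ ∀ j, ∃ y : A.X (vp j), A.dv (vp j) j y = x j := by
  constructor
  · rintro ⟨w, rfl⟩ j
    exact ⟨w (vp j), rfl⟩
  · intro h
    choose u hu using h
    obtain ⟨w, hw⟩ := exists_tot_vp u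
    exact ⟨w, by ext j; rw [Dv_apply, hw, hu]⟩

lemma Dv_eq_zero_iff (x : Tot A) : Dv A x = 0 ↔ ∀ i j, A.dv i j (x i) = 0 := by
  constructor
  · intro h i j
    by_cases hj : vShape.Rel i j
    · rw [← Dv_apply_of_rel _ _ hj, h]; rfl
    · rw [A.dv_shape _ _ hj]; rfl
  · intro h
    ext j
    exact h _ _

lemma cyc_iff (x : Tot A) : Cyc x ↔ ∀ i, LocCyc i (x i) := by
  rw [Cyc, mem_range_Dv_iff, Dv_eq_zero_iff]
  simp only [LocCyc, forall_and]
  refine and_congr_right fun _ => ⟨fun h i j => ?_, fun h j => h _ _⟩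
  by_cases hj : hShape.Rel i j
  · rw [← Dh_apply_of_rel _ _ hj]; exact h j
  · exact ⟨0, by rw [A.dh_shape _ _ hj, map_zero]; rfl⟩

lemma bd_iff (x : Tot A) : Bd x ↔ ∀ i, LocBd i (x i) := by
  constructor
  · rintro ⟨y, w, hy, rfl⟩ i
    exact ⟨y (hp i), w (vp i), (Dv_eq_zero_iff y).1 hy (hp i), rfl⟩
  · intro h
    choose y w hy hx using h
    obtain ⟨y', hy', hy₀⟩ := exists_tot_hp y
    obtain ⟨w', hw'⟩ := exists_tot_vp w
    refine ⟨y', w', ?_, ?_⟩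
    · rw [Dv_eq_zero_iff]
      rintro ⟨_ | p, q⟩ j
      · rw [hy₀, map_zero]
      · exact (congrArg _ (hy' (p, q))).trans (hy (p, q) j)
    · ext i
      rw [Pi.add_apply, Dh_apply, Dv_apply, hy', hw']
      exact hx i

lemma locCyc_zero (i : ℕ × ℤ) : LocCyc i (0 : A.X i) :=
  ⟨fun _ => map_zero _, fun _ => ⟨0, by rw [map_zero, map_zero]⟩⟩

lemma locBd_zero (i : ℕ × ℤ) : LocBd i (0 : A.X i) :=
  ⟨0, 0, fun _ => map_zero _, by rw [map_zero, map_zero, add_zero]⟩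

lemma cyc_single {i : ℕ × ℤ} {z : A.X i} (h : LocCyc i z) : Cyc (single i z) := by
  rw [cyc_iff]
  intro j
  by_cases hj : j = i
  · subst hj; rwa [single_self]
  · rw [single_ne hj]; exact locCyc_zero j

lemma bd_single {i : ℕ × ℤ} {z : A.X i} (h : LocBd i z) : Bd (single i z) := by
  rw [bd_iff]
  intro j
  by_cases hj : j = i
  · subst hj; rwa [single_self]
  · rw [single_ne hj]; exact locBd_zero j

/-- Conditions in the separate bidegrees assemble to one condition because `Tot` is the full
product. Apart from two-out-of-three, later arguments about weak equivalences all rest on this form.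
-/
theorem ceWeakEquivalences_iff (φ : A ⟶ B) :
    ceWeakEquivalences k φ ↔ (∀ x : Tot A, Cyc x → Bd (totMap φ x) → Bd x) ∧
      ∀ y : Tot B, Cyc y → ∃ x : Tot A, Cyc x ∧ Bd (y - totMap φ x) := by
  change (∀ i, IsIso ((E₂ i).map φ)) ↔ _
  simp only [isIso_E₂_map_iff, forall_and]
  refine and_congr ⟨fun h x hx hb => ?_, fun h i z hz hb => ?_⟩
    ⟨fun h y hy => ?_, fun h i y hy => ?_⟩
  · rw [cyc_iff] at hx
    rw [bd_iff] at hb ⊢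
    exact fun i => h i _ (hx i) (hb i)
  · have := (bd_iff _).1 (h (single i z) (cyc_single hz)
      (by rw [totMap_single]; exact bd_single hb)) i
    rwa [single_self] at this
  · rw [cyc_iff] at hy
    choose x hx hb using fun i => h i (y i) (hy i)
    exact ⟨x, (cyc_iff x).2 hx, (bd_iff _).2 hb⟩
  · obtain ⟨x, hx, hb⟩ := h (single i y) (cyc_single hy)
    refine ⟨x i, (cyc_iff x).1 hx i, ?_⟩
    have := (bd_iff _).1 hb i
    rwa [Pi.sub_apply, single_self] at this

end SecondPage

end Bicomplex

end

/-! ### Bidegree components, and what the parts of discs corepresent -/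

noncomputable section

namespace Bicomplex

variable {k : Type u} [CommRing k]

section Projections

variable {A B : Bicomplex k}

/-- The component of an element of the total space, as an element of the total space. -/
def pr (i : ℕ × ℤ) (x : Tot A) : Tot A := single i (x i)

lemma homog_pr (i : ℕ × ℤ) (x : Tot A) : Homog i (pr i x) := homog_single _ _

lemma Homog.pr_eq {i : ℕ × ℤ} {x : Tot A} (h : Homog i x) : pr i x = x := h.eq_single.symm

@[simp]
lemma pr_apply_self (i : ℕ × ℤ) (x : Tot A) : pr i x i = x i := single_self _ _

@[simp]
lemma pr_zero (i : ℕ × ℤ) : pr i (0 : Tot A) = 0 := single_zero _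

lemma pr_add (i : ℕ × ℤ) (x y : Tot A) : pr i (x + y) = pr i x + pr i y :=
  Pi.single_add (f := fun j => A.X j) i _ _

lemma Dv_pr (i : ℕ × ℤ) (x : Tot A) : Dv A (pr i x) = pr (vn i) (Dv A x) := by
  rw [pr, Dv_single, pr, Dv_apply_of_rel _ _ (vRel_vn i)]

/-- Column 0 has to be excluded: there the left side is zero, while `hn i = i` and the component of
`Dh A x` in column 0 comes from column 1. -/
lemma Dh_pr {i : ℕ × ℤ} (hi : i.1 ≠ 0) (x : Tot A) : Dh A (pr i x) = pr (hn i) (Dh A x) := by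
  have h : hShape.Rel i (hn i) := by rw [hShape_rel]; simp; omega
  rw [pr, Dh_single, pr, Dh_apply_of_rel _ _ h]

lemma Dh_eq_zero_of_homog {i : ℕ × ℤ} (hi : i.1 = 0) {x : Tot A} (hx : Homog i x) :
    Dh A x = 0 := by
  obtain ⟨p, q⟩ := i
  obtain rfl : p = 0 := hi
  exact hx.Dh_eq_zero

lemma totMap_pr (φ : A ⟶ B) (i : ℕ × ℤ) (x : Tot A) : totMap φ (pr i x) = pr i (totMap φ x) := by
  rw [pr, totMap_single, pr, totMap_apply]

end Projections

namespace DiscPart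

variable {n : ℕ} {q : ℤ} (S T : DiscPart n q) {E : Bicomplex k}

open scoped Classical in
variable (k) in
/-- The indicator function of the set of cells. -/
def coeff (i : ℕ × ℤ) : k := if i ∈ S.carrier then 1 else 0

variable (k) in
/-- The generator of a cell in bidegree `i` (zero if there is no such cell). -/
def gen (i : ℕ × ℤ) : (S.toBicomplex k).X i :=
  (⟨S.coeff k i, fun h => if_neg h⟩ : cellModule k S.carrier i)

variable (k) in
/-- The generator of a cell as an element of the total space. -/
def cell (i : ℕ × ℤ) : Tot (S.toBicomplex k) := single i (S.gen k i)

lemma homog_cell (i : ℕ × ℤ) : Homog i (S.cell k i) := homog_single _ _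

variable {S T}

lemma coeff_of_mem {i : ℕ × ℤ} (hi : i ∈ S.carrier) : S.coeff k i = 1 := if_pos hi

lemma coeff_of_notMem {i : ℕ × ℤ} (hi : i ∉ S.carrier) : S.coeff k i = 0 := if_neg hi

lemma gen_of_notMem {i : ℕ × ℤ} (hi : i ∉ S.carrier) : S.gen k i = 0 :=
  Subtype.ext (coeff_of_notMem hi)

lemma cell_of_notMem {i : ℕ × ℤ} (hi : i ∉ S.carrier) : S.cell k i = 0 := by
  rw [cell, gen_of_notMem hi, single_zero]

lemma X_eq_zero {i : ℕ × ℤ} (hi : i ∉ S.carrier) (x : (S.toBicomplex k).X i) : x = 0 :=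
  Subtype.ext (x.2 hi)

lemma eq_smul_gen {i : ℕ × ℤ} (x : (S.toBicomplex k).X i) :
    x = (x : cellModule k S.carrier i).1 • S.gen k i := by
  by_cases hi : i ∈ S.carrier
  · refine Subtype.ext ?_
    change (x : cellModule k S.carrier i).1 = (x : cellModule k S.carrier i).1 • S.coeff k i
    rw [coeff_of_mem hi, smul_eq_mul, mul_one]
  · rw [X_eq_zero hi x, gen_of_notMem hi, smul_zero]

lemma dh_gen {i j : ℕ × ℤ} (hi : i ∈ S.carrier) (h : hShape.Rel i j) :
    (S.toBicomplex k).dh i j (S.gen k i) = S.gen k j := by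
  simp only [toBicomplex, if_pos h]
  refine Subtype.ext ?_
  by_cases hj : j ∈ S.carrier
  · exact (if_pos hj).trans ((congrArg _ (coeff_of_mem hi)).trans
      ((one_mul _).trans (coeff_of_mem hj).symm))
  · exact (if_neg hj).trans (coeff_of_notMem hj).symm

lemma dv_gen {i j : ℕ × ℤ} (hi : i ∈ S.carrier) (h : vShape.Rel i j) :
    (S.toBicomplex k).dv i j (S.gen k i) = (columnSign n i : k) • S.gen k j := by
  simp only [toBicomplex, if_pos h]
  refine Subtype.ext ?_
  by_cases hj : j ∈ S.carrier
  · exact (if_pos hj).trans ((congrArg _ (coeff_of_mem hi)).trans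
      (congrArg _ (coeff_of_mem hj)).symm)
  · exact (if_neg hj).trans ((congrArg _ (coeff_of_notMem hj)).trans (mul_zero _)).symm

lemma Dh_cell {i : ℕ × ℤ} (hi : i ∈ S.carrier) (h : i.1 ≠ 0) :
    Dh _ (S.cell k i) = S.cell k (hn i) := by
  rw [cell, Dh_single, dh_gen hi (by rw [hShape_rel]; simp; omega), cell]

lemma Dv_cell {i : ℕ × ℤ} (hi : i ∈ S.carrier) :
    Dv _ (S.cell k i) = (columnSign n i : k) • S.cell k (vn i) := by
  rw [cell, Dv_single, dv_gen hi (vRel_vn i), cell]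
  exact Pi.single_smul (f := fun j => (S.toBicomplex k).X j) _ _ _

lemma incl_gen (h : S.carrier ⊆ T.carrier) {i : ℕ × ℤ} (hi : i ∈ S.carrier) :
    (incl k h).f i (S.gen k i) = T.gen k i := by
  refine Subtype.ext ?_
  exact (coeff_of_mem hi).trans (coeff_of_mem (h hi)).symm

lemma totMap_incl_cell (h : S.carrier ⊆ T.carrier) {i : ℕ × ℤ} (hi : i ∈ S.carrier) :
    totMap (incl k h) (S.cell k i) = T.cell k i := by
  rw [cell, totMap_single, incl_gen h hi, cell]

lemma hom_ext_cell {φ ψ : S.toBicomplex k ⟶ E}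
    (h : ∀ i ∈ S.carrier, totMap φ (S.cell k i) = totMap ψ (S.cell k i)) : φ = ψ := by
  ext i x
  by_cases hi : i ∈ S.carrier
  · rw [eq_smul_gen x, map_smul, map_smul]
    congr 1
    have := congrFun (h i hi) i
    rwa [totMap_apply, totMap_apply, cell, single_self] at this
  · rw [X_eq_zero hi x, map_zero, map_zero]

/-- The linear map which sends the generator of a cell to a given element. -/
def genDesc (S : DiscPart n q) {i : ℕ × ℤ} (x : E.X i) : (S.toBicomplex k).X i ⟶ E.X i :=
  ModuleCat.ofHom
    { toFun := fun y : cellModule k S.carrier i => y.1 • x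
      map_add' := fun y z => add_smul y.1 z.1 _
      map_smul' := fun a y => mul_smul a y.1 _ }

lemma genDesc_gen {i : ℕ × ℤ} (x : E.X i) (h : i ∉ S.carrier → x = 0) :
    genDesc S x (S.gen k i) = x := by
  change S.coeff k i • x = x
  by_cases hi : i ∈ S.carrier
  · rw [coeff_of_mem hi, one_smul]
  · rw [h hi, smul_zero]

/-- A morphism out of a part of a disc is given by the images of the cells. -/
lemma exists_hom (H : ℕ × ℤ → Tot E) (hH : ∀ i, Homog i (H i))
    (h₀ : ∀ i, i ∉ S.carrier → H i = 0)
    (hh : ∀ i ∈ S.carrier, i.1 ≠ 0 → Dh E (H i) = H (hn i))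
    (hv : ∀ i ∈ S.carrier, Dv E (H i) = (columnSign n i : k) • H (vn i)) :
    ∃ φ : S.toBicomplex k ⟶ E, ∀ i, totMap φ (S.cell k i) = H i := by
  have hg (i : ℕ × ℤ) : genDesc S (H i i) (S.gen k i) = H i i :=
    genDesc_gen _ fun hi => by rw [h₀ i hi]; rfl
  refine ⟨{
    f := fun i => genDesc S (H i i)
    comm_h := fun i j => ?_
    comm_v := fun i j => ?_ }, fun i => ?_⟩
  · by_cases hij : hShape.Rel i j
    · ext x
      by_cases hi : i ∈ S.carrier
      · rw [eq_smul_gen x, map_smul, map_smul]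
        congr 1
        have hj : hn i = j := by rw [eq_hp hij, hn_hp]
        have h₁ : i.1 ≠ 0 := by rw [hShape_rel] at hij; omega
        change E.dh i j (genDesc S (H i i) (S.gen k i)) =
          genDesc S (H j j) ((S.toBicomplex k).dh i j (S.gen k i))
        rw [dh_gen hi hij, hg, hg, ← Dh_apply_of_rel _ _ hij, hh i hi h₁, hj]
      · rw [X_eq_zero hi x, map_zero, map_zero]
    · rw [E.dh_shape _ _ hij, (S.toBicomplex k).dh_shape _ _ hij]
      exact comp_zero.trans zero_comp.symm
  · by_cases hij : vShape.Rel i j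
    · ext x
      by_cases hi : i ∈ S.carrier
      · rw [eq_smul_gen x, map_smul, map_smul]
        congr 1
        have hj : vn i = j := by rw [eq_vp hij, vn_vp]
        change E.dv i j (genDesc S (H i i) (S.gen k i)) =
          genDesc S (H j j) ((S.toBicomplex k).dv i j (S.gen k i))
        rw [dv_gen hi hij, map_smul, hg, hg, ← Dv_apply_of_rel _ _ hij, hv i hi, hj]
        rfl
      · rw [X_eq_zero hi x, map_zero, map_zero]
    · rw [E.dv_shape _ _ hij, (S.toBicomplex k).dv_shape _ _ hij]
      exact comp_zero.trans zero_comp.symm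
  · rw [cell, totMap_single]
    exact (congrArg _ (hg i)).trans (hH i).eq_single.symm

lemma columnSign_self (n : ℕ) (q : ℤ) : (columnSign n (n, q) : k) = 1 := if_pos rfl

lemma columnSign_succ (n : ℕ) (q : ℤ) : (columnSign n (n + 1, q) : k) = -1 :=
  if_neg (Nat.succ_ne_self n)

/-- This and the three existence lemmas that follow, with the matching `hom_ext` lemmas, say which
elements are corepresented by a sphere, a horizontal boundary, a vertical boundary and a disc: each
part is generated by its top cell subject to the relations listed as hypotheses. -/
lemma exists_sphere_hom (x : Tot E) (hx : Homog (n, q - 1) x) (hh : Dh E x = 0)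
    (hv : Dv E x = 0) :
    ∃ φ : (sphere n q).toBicomplex k ⟶ E, totMap φ ((sphere n q).cell k (n, q - 1)) = x := by
  obtain ⟨φ, hφ⟩ := exists_hom (S := sphere n q) (fun i => if i = (n, q - 1) then x else 0)
    (fun i => by
      by_cases h : i = (n, q - 1)
      · rw [if_pos h, h]; exact hx
      · rw [if_neg h]; exact homog_zero _)
    (fun i hi => if_neg hi)
    (fun i hi h => by
      obtain rfl : i = (n, q - 1) := hi
      rw [if_pos rfl, if_neg (by grind), hh])
    (fun i hi => by
      obtain rfl : i = (n, q - 1) := hi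
      rw [if_pos rfl, if_neg (by grind), hv, smul_zero])
  exact ⟨φ, (hφ _).trans (if_pos rfl)⟩

lemma exists_horizontalBoundary_hom (x : Tot E) (hx : Homog (n, q) x) (hh : Dh E x = 0) :
    ∃ φ : (horizontalBoundary n q).toBicomplex k ⟶ E,
      totMap φ ((horizontalBoundary n q).cell k (n, q)) = x := by
  obtain ⟨φ, hφ⟩ := exists_hom (S := horizontalBoundary n q)
    (fun i => if i = (n, q) then x else if i = (n, q - 1) then Dv E x else 0)
    (fun i => by
      split_ifs with h h'
      · rw [h]; exact hx
      · rw [h']; exact hx.Dv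
      · exact homog_zero _)
    (fun i hi => by
      simp only [horizontalBoundary, Set.mem_insert_iff, Set.mem_singleton_iff, not_or] at hi
      rw [if_neg hi.1, if_neg hi.2])
    (fun i hi h => by
      obtain rfl | rfl : i = (n, q) ∨ i = (n, q - 1) := hi
      · rw [if_pos rfl, if_neg (by grind), if_neg (by grind), hh]
      · rw [if_neg (by grind), if_pos rfl, if_neg (by grind), if_neg (by grind),
          Dh_Dv, hh, map_zero, neg_zero])
    (fun i hi => by
      obtain rfl | rfl : i = (n, q) ∨ i = (n, q - 1) := hi
      · rw [if_pos rfl, if_neg (by grind), if_pos rfl, columnSign_self, one_smul]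
      · rw [if_neg (by grind), if_pos rfl, if_neg (by grind), if_neg (by grind), smul_zero, Dv_Dv])
  exact ⟨φ, (hφ _).trans (if_pos rfl)⟩

lemma exists_verticalBoundary_hom (x : Tot E) (hx : Homog (n + 1, q - 1) x) (hv : Dv E x = 0) :
    ∃ φ : (verticalBoundary n q).toBicomplex k ⟶ E,
      totMap φ ((verticalBoundary n q).cell k (n + 1, q - 1)) = x := by
  obtain ⟨φ, hφ⟩ := exists_hom (S := verticalBoundary n q)
    (fun i => if i = (n + 1, q - 1) then x else if i = (n, q - 1) then Dh E x else 0)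
    (fun i => by
      split_ifs with h h'
      · rw [h]; exact hx
      · rw [h']; exact hx.Dh
      · exact homog_zero _)
    (fun i hi => by
      simp only [verticalBoundary, Set.mem_insert_iff, Set.mem_singleton_iff, not_or] at hi
      rw [if_neg hi.1, if_neg hi.2])
    (fun i hi h => by
      obtain rfl | rfl : i = (n + 1, q - 1) ∨ i = (n, q - 1) := hi
      · rw [if_pos rfl, if_neg (by grind), if_pos (by simp)]
      · rw [if_neg (by grind), if_pos rfl, if_neg (by grind),
          if_neg (by grind), Dh_Dh])
    (fun i hi => by
      obtain rfl | rfl : i = (n + 1, q - 1) ∨ i = (n, q - 1) := hi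
      · rw [if_pos rfl, if_neg (by grind), if_neg (by grind), smul_zero, hv]
      · rw [if_neg (by grind), if_pos rfl, if_neg (by grind), if_neg (by grind), smul_zero, Dv_Dh, hv,
          map_zero, neg_zero])
  exact ⟨φ, (hφ _).trans (if_pos rfl)⟩

lemma exists_disc_hom (x : Tot E) (hx : Homog (n + 1, q) x) :
    ∃ φ : (disc n q).toBicomplex k ⟶ E, totMap φ ((disc n q).cell k (n + 1, q)) = x := by
  obtain ⟨φ, hφ⟩ := exists_hom (S := disc n q)
    -- The vertical differential of the disc in column `n + 1` is -1, so the cell below the top one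
    -- is minus the vertical boundary of the top cell; this is the source of `-Dv E x`.
    -- Anticommutativity then makes both routes to the last corner agree.
    (fun i => if i = (n + 1, q) then x else if i = (n, q) then Dh E x else
      if i = (n + 1, q - 1) then -Dv E x else if i = (n, q - 1) then Dv E (Dh E x) else 0)
    (fun i => by
      split_ifs with h h' h' h'
      · rw [h]; exact hx
      · rw [h']; exact hx.Dh
      · rw [h']; exact hx.Dv.neg
      · rw [h']; exact hx.Dh.Dv
      · exact homog_zero _)
    (fun i hi => by
      simp only [disc, corners, Set.mem_ofPred_eq] at hi
      rw [if_neg, if_neg, if_neg, if_neg]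
      all_goals rintro rfl; simp at hi)
    (fun i hi h => by
      obtain ⟨a, b⟩ := i
      obtain ⟨rfl | rfl, rfl | rfl⟩ : (a = n ∨ a = n + 1) ∧ (b = q ∨ b = q - 1) := hi
      · rw [if_neg (by grind), if_pos rfl, if_neg (by grind), if_neg (by grind),
          if_neg (by grind), if_neg (by grind), Dh_Dh]
      · rw [if_neg (by grind), if_neg (by grind), if_neg (by grind), if_pos rfl,
          if_neg (by grind), if_neg (by grind), if_neg (by grind),
          if_neg (by grind), Dh_Dv, Dh_Dh, map_zero, neg_zero]
      · rw [if_pos rfl, if_neg (by grind), if_pos (by simp)]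
      · rw [if_neg (by grind), if_neg (by grind), if_pos rfl, if_neg (by grind), if_neg (by grind),
          if_neg (by grind), if_pos (by simp), map_neg, Dh_Dv, neg_neg])
    (fun i hi => by
      obtain ⟨a, b⟩ := i
      obtain ⟨rfl | rfl, rfl | rfl⟩ : (a = n ∨ a = n + 1) ∧ (b = q ∨ b = q - 1) := hi
      · rw [if_neg (by grind), if_pos rfl, if_neg (by grind), if_neg (by grind),
          if_neg (by grind), if_pos rfl, columnSign_self, one_smul]
      · rw [if_neg (by grind), if_neg (by grind), if_neg (by grind), if_pos rfl,
          if_neg (by grind), if_neg (by grind), if_neg (by grind), if_neg (by grind), smul_zero, Dv_Dv]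
      · rw [if_pos rfl, if_neg (by grind), if_neg (by grind), if_pos rfl, columnSign_succ, neg_smul,
          one_smul, neg_neg]
      · rw [if_neg (by grind), if_neg (by grind), if_pos rfl, if_neg (by grind), if_neg (by grind),
          if_neg (by grind), if_neg (by grind), smul_zero, map_neg, Dv_Dv, neg_zero])
  exact ⟨φ, (hφ _).trans (if_pos rfl)⟩

lemma sphere_hom_ext {φ ψ : (sphere n q).toBicomplex k ⟶ E}
    (h : totMap φ ((sphere n q).cell k (n, q - 1)) = totMap ψ ((sphere n q).cell k (n, q - 1))) :
    φ = ψ :=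
  hom_ext_cell fun i hi => by obtain rfl : i = (n, q - 1) := hi; exact h

lemma horizontalBoundary_cell :
    (horizontalBoundary n q).cell k (n, q - 1) = Dv _ ((horizontalBoundary n q).cell k (n, q)) := by
  rw [Dv_cell (Or.inl rfl), columnSign_self, one_smul]

lemma horizontalBoundary_hom_ext {φ ψ : (horizontalBoundary n q).toBicomplex k ⟶ E}
    (h : totMap φ ((horizontalBoundary n q).cell k (n, q)) =
      totMap ψ ((horizontalBoundary n q).cell k (n, q))) : φ = ψ :=
  hom_ext_cell fun i hi => by
    obtain rfl | rfl : i = (n, q) ∨ i = (n, q - 1) := hi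
    · exact h
    · rw [horizontalBoundary_cell, totMap_Dv, totMap_Dv, h]

lemma verticalBoundary_cell :
    (verticalBoundary n q).cell k (n, q - 1) =
      Dh _ ((verticalBoundary n q).cell k (n + 1, q - 1)) := by
  rw [Dh_cell (Or.inl rfl) (Nat.succ_ne_zero n)]
  rfl

lemma verticalBoundary_hom_ext {φ ψ : (verticalBoundary n q).toBicomplex k ⟶ E}
    (h : totMap φ ((verticalBoundary n q).cell k (n + 1, q - 1)) =
      totMap ψ ((verticalBoundary n q).cell k (n + 1, q - 1))) : φ = ψ :=
  hom_ext_cell fun i hi => by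
    obtain rfl | rfl : i = (n + 1, q - 1) ∨ i = (n, q - 1) := hi
    · exact h
    · rw [verticalBoundary_cell, totMap_Dh, totMap_Dh, h]

lemma disc_mem₁ : (n + 1, q) ∈ (disc n q).carrier := ⟨Or.inr rfl, Or.inl rfl⟩

lemma disc_mem₂ : (n, q) ∈ (disc n q).carrier := ⟨Or.inl rfl, Or.inl rfl⟩

lemma disc_cell₁ : (disc n q).cell k (n, q) = Dh _ ((disc n q).cell k (n + 1, q)) := by
  rw [Dh_cell disc_mem₁ (Nat.succ_ne_zero n)]
  rfl

lemma disc_cell₂ : (disc n q).cell k (n + 1, q - 1) = -Dv _ ((disc n q).cell k (n + 1, q)) := by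
  rw [Dv_cell disc_mem₁, columnSign_succ, neg_smul, one_smul, neg_neg]

lemma disc_cell₃ : (disc n q).cell k (n, q - 1) = Dv _ (Dh _ ((disc n q).cell k (n + 1, q))) := by
  rw [← disc_cell₁, Dv_cell disc_mem₂, columnSign_self, one_smul]

lemma disc_hom_ext {φ ψ : (disc n q).toBicomplex k ⟶ E}
    (h : totMap φ ((disc n q).cell k (n + 1, q)) = totMap ψ ((disc n q).cell k (n + 1, q))) :
    φ = ψ :=
  hom_ext_cell fun i hi => by
    obtain ⟨a, b⟩ := i
    obtain ⟨rfl | rfl, rfl | rfl⟩ : (a = n ∨ a = n + 1) ∧ (b = q ∨ b = q - 1) := hi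
    · rw [disc_cell₁, totMap_Dh, totMap_Dh, h]
    · rw [disc_cell₃, totMap_Dv, totMap_Dh, totMap_Dv, totMap_Dh, h]
    · exact h
    · rw [disc_cell₂, map_neg, map_neg, totMap_Dv, totMap_Dv, h]

end DiscPart

end Bicomplex

end

/-! ### Lifting properties against the generators as equations -/

noncomputable section

namespace Bicomplex

variable {k : Type u} [CommRing k] {X Y : Bicomplex k} (p : X ⟶ Y)

/-- `p` is a surjective quasi-isomorphism on horizontal complexes. -/
def DLift : Prop := ∀ (y : Tot Y) (u : Tot X), Dh X u = 0 → totMap p u = Dh Y y →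
  ∃ x, totMap p x = y ∧ Dh X x = u

/-- `p` is a surjective quasi-isomorphism on the horizontal complexes of vertical cycles. -/
def SLift : Prop := ∀ (y : Tot Y) (u : Tot X), Dv Y y = 0 → Dv X u = 0 → Dh X u = 0 →
  totMap p u = Dh Y y → ∃ x, Dv X x = 0 ∧ totMap p x = y ∧ Dh X x = u

/-- `p` is surjective on vertical cycles in positive columns. -/
def VSurj : Prop := ∀ y : Tot Y, Dv Y y = 0 →
  ∃ x, Dv X x = 0 ∧ ∀ i : ℕ × ℤ, i.1 ≠ 0 → totMap p x i = y i

variable {p}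

/-- Projecting a solution to bidegree `l` keeps it a solution. The condition in column 0 is needed
because `hn l = l` there, so homogeneity alone would allow a nonzero `u`, which no element of column
0 can hit. -/
lemma DLift.homog (h : DLift p) (l : ℕ × ℤ) (y : Tot Y) (u : Tot X) (hy : Homog l y)
    (hu : Homog (hn l) u) (hl : l.1 = 0 → u = 0) (hhu : Dh X u = 0) (hpu : totMap p u = Dh Y y) :
    ∃ x, Homog l x ∧ totMap p x = y ∧ Dh X x = u := by
  obtain ⟨x, hx, hu'⟩ := h y u hhu hpu
  refine ⟨pr l x, homog_pr _ _, by rw [totMap_pr, hx, hy.pr_eq], ?_⟩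
  by_cases h₀ : l.1 = 0
  · rw [hl h₀, Dh_eq_zero_of_homog h₀ (homog_pr _ _)]
  · rw [Dh_pr h₀, hu', hu.pr_eq]

lemma SLift.homog (h : SLift p) (l : ℕ × ℤ) (y : Tot Y) (u : Tot X) (hy : Homog l y)
    (hu : Homog (hn l) u) (hl : l.1 = 0 → u = 0) (hvy : Dv Y y = 0) (hvu : Dv X u = 0)
    (hhu : Dh X u = 0) (hpu : totMap p u = Dh Y y) :
    ∃ x, Homog l x ∧ Dv X x = 0 ∧ totMap p x = y ∧ Dh X x = u := by
  obtain ⟨x, hvx, hx, hu'⟩ := h y u hvy hvu hhu hpu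
  refine ⟨pr l x, homog_pr _ _, by rw [Dv_pr, hvx, pr_zero], by rw [totMap_pr, hx, hy.pr_eq], ?_⟩
  by_cases h₀ : l.1 = 0
  · rw [hl h₀, Dh_eq_zero_of_homog h₀ (homog_pr _ _)]
  · rw [Dh_pr h₀, hu', hu.pr_eq]

lemma VSurj.homog (h : VSurj p) (l : ℕ × ℤ) (hl : l.1 ≠ 0) (y : Tot Y) (hy : Homog l y)
    (hvy : Dv Y y = 0) : ∃ x, Homog l x ∧ Dv X x = 0 ∧ totMap p x = y := by
  obtain ⟨x, hvx, hx⟩ := h y hvy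
  refine ⟨pr l x, homog_pr _ _, by rw [Dv_pr, hvx, pr_zero], ?_⟩
  rw [totMap_pr, pr, hx l hl]
  exact hy.pr_eq

lemma assemble_Dv {x : ℕ × ℤ → Tot X} (hx : ∀ i, Dv X (x i) = 0) : Dv X (fun i => x i i) = 0 := by
  ext j
  exact congrFun (hx (vp j)) j

lemma assemble_totMap {x : ℕ × ℤ → Tot X} {y : Tot Y} (hx : ∀ i, totMap p (x i) = pr i y) :
    totMap p (fun i => x i i) = y := by
  ext j
  exact (congrFun (hx j) j).trans (pr_apply_self _ _)

lemma assemble_Dh {x : ℕ × ℤ → Tot X} {u : Tot X}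
    (hx : ∀ i : ℕ × ℤ, i.1 ≠ 0 → Dh X (x i) = pr (hn i) u) : Dh X (fun i => x i i) = u := by
  ext j
  have := congrFun (hx (hp j) (Nat.succ_ne_zero _)) j
  rw [hn_hp, pr_apply_self] at this
  exact this

/-- The equations do not interact across bidegrees: the component of the solution at `l` only sees
`y` at `l` and `u` at `hn l`. Solutions can be chosen independently and assembled in the product,
with `u` replaced by 0 in column 0. -/
lemma dLift_of_homog (h : ∀ (l : ℕ × ℤ) (y : Tot Y) (u : Tot X), Homog l y → Homog (hn l) u →
    (l.1 = 0 → u = 0) → Dh X u = 0 → totMap p u = Dh Y y →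
    ∃ x, Homog l x ∧ totMap p x = y ∧ Dh X x = u) : DLift p := by
  intro y u hu hpu
  have h' (i : ℕ × ℤ) : ∃ x : Tot X, totMap p x = pr i y ∧ (i.1 ≠ 0 → Dh X x = pr (hn i) u) := by
    by_cases hi : i.1 = 0
    · obtain ⟨x, -, hx, -⟩ := h i (pr i y) 0 (homog_pr _ _) (homog_zero _) (fun _ => rfl) (map_zero _)
        (by rw [map_zero, Dh_eq_zero_of_homog hi (homog_pr _ _)])
      exact ⟨x, hx, fun h => (h hi).elim⟩
    · obtain ⟨x, -, hx, hx'⟩ := h i (pr i y) (pr (hn i) u) (homog_pr _ _) (homog_pr _ _)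
        (fun h => (hi h).elim) (by
          by_cases h₀ : (hn i).1 = 0
          · exact Dh_eq_zero_of_homog h₀ (homog_pr _ _)
          · rw [Dh_pr h₀, hu, pr_zero]) (by rw [totMap_pr, hpu, Dh_pr hi])
      exact ⟨x, hx, fun _ => hx'⟩
  choose x hx hx' using h'
  exact ⟨_, assemble_totMap hx, assemble_Dh hx'⟩

lemma sLift_of_homog (h : ∀ (l : ℕ × ℤ) (y : Tot Y) (u : Tot X), Homog l y → Homog (hn l) u →
    (l.1 = 0 → u = 0) → Dv Y y = 0 → Dv X u = 0 → Dh X u = 0 → totMap p u = Dh Y y →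
    ∃ x, Homog l x ∧ Dv X x = 0 ∧ totMap p x = y ∧ Dh X x = u) : SLift p := by
  intro y u hy hvu hu hpu
  have h' (i : ℕ × ℤ) : ∃ x : Tot X, Dv X x = 0 ∧ totMap p x = pr i y ∧
      (i.1 ≠ 0 → Dh X x = pr (hn i) u) := by
    by_cases hi : i.1 = 0
    · obtain ⟨x, -, hv, hx, -⟩ := h i (pr i y) 0 (homog_pr _ _) (homog_zero _) (fun _ => rfl)
        (by rw [Dv_pr, hy, pr_zero]) (map_zero _) (map_zero _)
        (by rw [map_zero, Dh_eq_zero_of_homog hi (homog_pr _ _)])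
      exact ⟨x, hv, hx, fun h => (h hi).elim⟩
    · obtain ⟨x, -, hv, hx, hx'⟩ := h i (pr i y) (pr (hn i) u) (homog_pr _ _) (homog_pr _ _)
        (fun h => (hi h).elim) (by rw [Dv_pr, hy, pr_zero]) (by rw [Dv_pr, hvu, pr_zero]) (by
          by_cases h₀ : (hn i).1 = 0
          · exact Dh_eq_zero_of_homog h₀ (homog_pr _ _)
          · rw [Dh_pr h₀, hu, pr_zero]) (by rw [totMap_pr, hpu, Dh_pr hi])
      exact ⟨x, hv, hx, fun _ => hx'⟩
  choose x hv hx hx' using h'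
  exact ⟨_, assemble_Dv hv, assemble_totMap hx, assemble_Dh hx'⟩

lemma vSurj_of_homog (h : ∀ (l : ℕ × ℤ) (y : Tot Y), l.1 ≠ 0 → Homog l y → Dv Y y = 0 →
    ∃ x, Homog l x ∧ Dv X x = 0 ∧ totMap p x = y) : VSurj p := by
  intro y hy
  have h' (i : ℕ × ℤ) : ∃ x : Tot X, Dv X x = 0 ∧ (i.1 ≠ 0 → totMap p x = pr i y) := by
    by_cases hi : i.1 = 0
    · exact ⟨0, map_zero _, fun h => (h hi).elim⟩
    · obtain ⟨x, -, hv, hx⟩ := h i (pr i y) hi (homog_pr _ _) (by rw [Dv_pr, hy, pr_zero])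
      exact ⟨x, hv, fun _ => hx⟩
  choose x hv hx using h'
  exact ⟨_, assemble_Dv hv, fun i hi => (congrFun (hx i hi) i).trans (pr_apply_self _ _)⟩

open DiscPart

lemma hasLiftingProperty_iff {A B : Bicomplex k} (i : A ⟶ B) :
    HasLiftingProperty i p ↔ ∀ (φ : A ⟶ X) (ψ : B ⟶ Y), φ ≫ p = i ≫ ψ →
      ∃ l : B ⟶ X, i ≫ l = φ ∧ l ≫ p = ψ := by
  constructor
  · intro h φ ψ w
    have sq : CommSq φ i p ψ := ⟨w⟩
    exact ⟨sq.lift, sq.fac_left, sq.fac_right⟩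
  · intro h
    exact ⟨fun {φ ψ} sq => by
      obtain ⟨l, h₁, h₂⟩ := h φ ψ sq.w
      exact ⟨⟨l, h₁, h₂⟩⟩⟩

lemma zero_hasLiftingProperty_iff {n : ℕ} {q : ℤ} (T : DiscPart n q) :
    HasLiftingProperty (incl k (zero_subset T)) p ↔
      ∀ ψ : T.toBicomplex k ⟶ Y, ∃ l : T.toBicomplex k ⟶ X, l ≫ p = ψ := by
  rw [hasLiftingProperty_iff]
  constructor
  · intro h ψ
    obtain ⟨l, -, hl⟩ := h ((isZero_zero n q).to_ X) ψ ((isZero_zero n q).eq_of_src _ _)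
    exact ⟨l, hl⟩
  · intro h φ ψ _
    obtain ⟨l, hl⟩ := h ψ
    exact ⟨l, (isZero_zero n q).eq_of_src _ _, hl⟩

lemma zero_sphere_lifting_iff (n : ℕ) (q : ℤ) :
    HasLiftingProperty (incl k (zero_subset (sphere n q))) p ↔
      ∀ y : Tot Y, Homog (n, q - 1) y → Dh Y y = 0 → Dv Y y = 0 →
        ∃ x : Tot X, Homog (n, q - 1) x ∧ Dh X x = 0 ∧ Dv X x = 0 ∧ totMap p x = y := by
  rw [zero_hasLiftingProperty_iff]
  have hc : (n, q - 1) ∈ (sphere n q).carrier := rfl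
  constructor
  · intro h y hy hhy hvy
    obtain ⟨ψ, hψ⟩ := exists_sphere_hom (k := k) y hy hhy hvy
    obtain ⟨l, hl⟩ := h ψ
    refine ⟨totMap l (cell k _ _), (homog_cell _ _).totMap _, ?_, ?_, ?_⟩
    · rcases n with _ | n
      · exact Dh_eq_zero_of_homog rfl ((homog_cell _ (0, q - 1)).totMap _)
      · rw [← totMap_Dh, Dh_cell hc (Nat.succ_ne_zero n), cell_of_notMem, map_zero]
        simp [sphere]
    · rw [← totMap_Dv, Dv_cell hc, cell_of_notMem, smul_zero, map_zero]
      simp [sphere]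
    · rw [← totMap_comp, hl, hψ]
  · intro h ψ
    obtain ⟨x, hx, hhx, hvx, hpx⟩ := h (totMap ψ (cell k _ _)) ((homog_cell _ _).totMap _) (by
      rcases n with _ | n
      · exact Dh_eq_zero_of_homog rfl ((homog_cell _ (0, q - 1)).totMap _)
      · rw [← totMap_Dh, Dh_cell hc (Nat.succ_ne_zero n), cell_of_notMem, map_zero]
        simp [sphere]) (by
      rw [← totMap_Dv, Dv_cell hc, cell_of_notMem, smul_zero, map_zero]
      simp [sphere])
    obtain ⟨l, hl⟩ := exists_sphere_hom (k := k) x hx hhx hvx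
    exact ⟨l, sphere_hom_ext (by rw [totMap_comp, hl, hpx])⟩

/-- A horizontal boundary corepresents horizontal cycles, and in column 0 every element is one;
hence plain surjectivity. -/
lemma zero_horizontalBoundary_lifting_iff (q : ℤ) :
    HasLiftingProperty (incl k (zero_subset (horizontalBoundary 0 q))) p ↔
      ∀ y : Tot Y, Homog (0, q) y → ∃ x : Tot X, Homog (0, q) x ∧ totMap p x = y := by
  rw [zero_hasLiftingProperty_iff]
  constructor
  · intro h y hy
    obtain ⟨ψ, hψ⟩ := exists_horizontalBoundary_hom (k := k) y hy (Dh_eq_zero_of_homog rfl hy)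
    obtain ⟨l, hl⟩ := h ψ
    refine ⟨totMap l (cell k _ _), (homog_cell _ _).totMap _, ?_⟩
    rw [← totMap_comp, hl, hψ]
  · intro h ψ
    obtain ⟨x, hx, hpx⟩ := h (totMap ψ (cell k _ _)) ((homog_cell _ _).totMap _)
    obtain ⟨l, hl⟩ := exists_horizontalBoundary_hom (k := k) x hx (Dh_eq_zero_of_homog rfl hx)
    exact ⟨l, horizontalBoundary_hom_ext (by rw [totMap_comp, hl, hpx])⟩

lemma zero_verticalBoundary_lifting_iff (n : ℕ) (q : ℤ) :
    HasLiftingProperty (incl k (zero_subset (verticalBoundary n q))) p ↔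
      ∀ y : Tot Y, Homog (n + 1, q - 1) y → Dv Y y = 0 →
        ∃ x : Tot X, Homog (n + 1, q - 1) x ∧ Dv X x = 0 ∧ totMap p x = y := by
  rw [zero_hasLiftingProperty_iff]
  have hv {E : Bicomplex k} (ψ : (verticalBoundary n q).toBicomplex k ⟶ E) :
      Dv E (totMap ψ ((verticalBoundary n q).cell k (n + 1, q - 1))) = 0 := by
    rw [← totMap_Dv, Dv_cell (Or.inl rfl), cell_of_notMem, smul_zero, map_zero]
    simp [verticalBoundary]
  constructor
  · intro h y hy hvy
    obtain ⟨ψ, hψ⟩ := exists_verticalBoundary_hom (k := k) y hy hvy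
    obtain ⟨l, hl⟩ := h ψ
    refine ⟨totMap l (cell k _ _), (homog_cell _ _).totMap _, hv l, ?_⟩
    rw [← totMap_comp, hl, hψ]
  · intro h ψ
    obtain ⟨x, hx, hvx, hpx⟩ := h _ ((homog_cell _ _).totMap ψ) (hv ψ)
    obtain ⟨l, hl⟩ := exists_verticalBoundary_hom (k := k) x hx hvx
    exact ⟨l, verticalBoundary_hom_ext (by rw [totMap_comp, hl, hpx])⟩

/-- The sphere is included as the horizontal boundary of the top cell, so a commutative square is a
pair of elements with `totMap p u = Dh Y y` and a diagonal is a vertical cycle solving both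
equations. -/
lemma sphere_verticalBoundary_lifting_iff (n : ℕ) (q : ℤ) :
    HasLiftingProperty (incl k (sphere_subset n q)) p ↔
      ∀ (y : Tot Y) (u : Tot X), Homog (n + 1, q - 1) y → Homog (n, q - 1) u → Dv Y y = 0 →
        Dv X u = 0 → Dh X u = 0 → totMap p u = Dh Y y →
        ∃ x : Tot X, Homog (n + 1, q - 1) x ∧ Dv X x = 0 ∧ totMap p x = y ∧ Dh X x = u := by
  rw [hasLiftingProperty_iff]
  have hv {E : Bicomplex k} (ψ : (verticalBoundary n q).toBicomplex k ⟶ E) :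
      Dv E (totMap ψ ((verticalBoundary n q).cell k (n + 1, q - 1))) = 0 := by
    rw [← totMap_Dv, Dv_cell (Or.inl rfl), cell_of_notMem, smul_zero, map_zero]
    simp [verticalBoundary]
  have hi : totMap (incl k (sphere_subset n q)) ((sphere n q).cell k (n, q - 1)) =
      Dh _ ((verticalBoundary n q).cell k (n + 1, q - 1)) := by
    rw [totMap_incl_cell _ rfl, verticalBoundary_cell]
  constructor
  · intro h y u hy hu hvy hvu hhu hpu
    obtain ⟨ψ, hψ⟩ := exists_verticalBoundary_hom (k := k) y hy hvy
    obtain ⟨φ, hφ⟩ := exists_sphere_hom (k := k) u hu hhu hvu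
    obtain ⟨l, hl, hl'⟩ := h φ ψ (sphere_hom_ext (by
      rw [totMap_comp, totMap_comp, hφ, hi, totMap_Dh, hψ, hpu]))
    refine ⟨totMap l (cell k _ _), (homog_cell _ _).totMap _, hv l, ?_, ?_⟩
    · rw [← totMap_comp, hl', hψ]
    · rw [← totMap_Dh, ← hi, ← totMap_comp, hl, hφ]
  · intro h φ ψ w
    obtain ⟨x, hx, hvx, hpx, hu⟩ := h (totMap ψ (cell k _ _)) (totMap φ (cell k _ _))
      ((homog_cell _ _).totMap _) ((homog_cell _ _).totMap _) (hv ψ) (by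
        rw [← totMap_Dv, Dv_cell rfl, cell_of_notMem, smul_zero, map_zero]
        simp [sphere]) (by
      rcases n with _ | n
      · exact Dh_eq_zero_of_homog rfl ((homog_cell _ (0, q - 1)).totMap _)
      · rw [← totMap_Dh, Dh_cell rfl (Nat.succ_ne_zero n), cell_of_notMem, map_zero]
        simp [sphere]) (by rw [← totMap_comp, w, totMap_comp, hi, totMap_Dh])
    obtain ⟨l, hl⟩ := exists_verticalBoundary_hom (k := k) x hx hvx
    refine ⟨l, sphere_hom_ext ?_, verticalBoundary_hom_ext (by rw [totMap_comp, hl, hpx])⟩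
    rw [totMap_comp, hi, totMap_Dh, hl, hu]

lemma horizontalBoundary_disc_lifting_iff (n : ℕ) (q : ℤ) :
    HasLiftingProperty (incl k (horizontalBoundary_subset n q)) p ↔
      ∀ (y : Tot Y) (u : Tot X), Homog (n + 1, q) y → Homog (n, q) u → Dh X u = 0 →
        totMap p u = Dh Y y → ∃ x : Tot X, Homog (n + 1, q) x ∧ totMap p x = y ∧ Dh X x = u := by
  rw [hasLiftingProperty_iff]
  have hi : totMap (incl k (horizontalBoundary_subset n q)) ((horizontalBoundary n q).cell k (n, q)) =
      Dh _ ((disc n q).cell k (n + 1, q)) := by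
    rw [totMap_incl_cell _ (Or.inl rfl), disc_cell₁]
  constructor
  · intro h y u hy hu hhu hpu
    obtain ⟨ψ, hψ⟩ := exists_disc_hom (k := k) y hy
    obtain ⟨φ, hφ⟩ := exists_horizontalBoundary_hom (k := k) u hu hhu
    obtain ⟨l, hl, hl'⟩ := h φ ψ (horizontalBoundary_hom_ext (by
      rw [totMap_comp, totMap_comp, hφ, hi, totMap_Dh, hψ, hpu]))
    refine ⟨totMap l (cell k _ _), (homog_cell _ _).totMap _, ?_, ?_⟩
    · rw [← totMap_comp, hl', hψ]
    · rw [← totMap_Dh, ← hi, ← totMap_comp, hl, hφ]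
  · intro h φ ψ w
    obtain ⟨x, hx, hpx, hu⟩ := h (totMap ψ (cell k _ _)) (totMap φ (cell k _ _))
      ((homog_cell _ _).totMap _) ((homog_cell _ _).totMap _) (by
      rcases n with _ | n
      · exact Dh_eq_zero_of_homog rfl ((homog_cell _ (0, q)).totMap _)
      · rw [← totMap_Dh, Dh_cell (Or.inl rfl) (Nat.succ_ne_zero n), cell_of_notMem, map_zero]
        simp [horizontalBoundary]) (by rw [← totMap_comp, w, totMap_comp, hi, totMap_Dh])
    obtain ⟨l, hl⟩ := exists_disc_hom (k := k) x hx
    refine ⟨l, horizontalBoundary_hom_ext ?_, disc_hom_ext (by rw [totMap_comp, hl, hpx])⟩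
    rw [totMap_comp, hi, totMap_Dh, hl, hu]

/-- The disc inclusions solve the equations in positive columns and the maps from zero solve them in
column 0, where nothing is prescribed for the horizontal differential. -/
lemma dLift_iff : DLift p ↔
    (∀ q : ℤ, HasLiftingProperty (incl k (zero_subset (horizontalBoundary 0 q))) p) ∧
    ∀ i : ℕ × ℤ, HasLiftingProperty (incl k (horizontalBoundary_subset i.1 i.2)) p := by
  simp only [zero_horizontalBoundary_lifting_iff, horizontalBoundary_disc_lifting_iff]
  constructor
  · intro h
    refine ⟨fun q y hy => ?_, fun i y u hy hu hhu hpu => ?_⟩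
    · obtain ⟨x, hx, hpx, -⟩ := h.homog _ y 0 hy (homog_zero _) (fun _ => rfl) (map_zero _)
        (by rw [map_zero, hy.Dh_eq_zero])
      exact ⟨x, hx, hpx⟩
    · exact h.homog (i.1 + 1, i.2) y u hy hu (fun h => (Nat.succ_ne_zero _ h).elim) hhu hpu
  · rintro ⟨h₁, h₂⟩
    refine dLift_of_homog ?_
    rintro ⟨_ | n, q⟩ y u hy hu hl hhu hpu
    · obtain ⟨x, hx, hpx⟩ := h₁ q y hy
      exact ⟨x, hx, hpx, by rw [hx.Dh_eq_zero, hl rfl]⟩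
    · exact h₂ (n, q) y u hy hu hhu hpu

lemma sLift_iff : SLift p ↔
    (∀ q : ℤ, HasLiftingProperty (incl k (zero_subset (sphere 0 q))) p) ∧
    ∀ i : ℕ × ℤ, HasLiftingProperty (incl k (sphere_subset i.1 i.2)) p := by
  simp only [zero_sphere_lifting_iff, sphere_verticalBoundary_lifting_iff]
  constructor
  · intro h
    refine ⟨fun q y hy hhy hvy => ?_, fun i y u hy hu hvy hvu hhu hpu => ?_⟩
    · obtain ⟨x, hx, hvx, hpx, hhx⟩ := h.homog _ y 0 hy (homog_zero _) (fun _ => rfl) hvy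
        (map_zero _) (map_zero _) (by rw [map_zero, hy.Dh_eq_zero])
      exact ⟨x, hx, hhx, hvx, hpx⟩
    · exact h.homog (i.1 + 1, i.2 - 1) y u hy hu (fun h => (Nat.succ_ne_zero _ h).elim) hvy hvu
        hhu hpu
  · rintro ⟨h₁, h₂⟩
    refine sLift_of_homog ?_
    rintro ⟨n, q⟩ y u hy hu hl hvy hvu hhu hpu
    obtain ⟨q, rfl⟩ : ∃ r, q = r - 1 := ⟨q + 1, by ring⟩
    rcases n with _ | n
    · obtain ⟨x, hx, hhx, hvx, hpx⟩ := h₁ q y hy hy.Dh_eq_zero hvy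
      exact ⟨x, hx, hvx, hpx, by rw [hx.Dh_eq_zero, hl rfl]⟩
    · exact h₂ (n, q) y u hy hu hvy hvu hhu hpu

/-- The top cells of vertical boundaries lie in columns `n + 1`, which is why column 0 is absent
from `VSurj`. The shift `q = r - 1` runs through all rows. -/
lemma vSurj_iff : VSurj p ↔
    ∀ i : ℕ × ℤ, HasLiftingProperty (incl k (zero_subset (verticalBoundary i.1 i.2))) p := by
  simp only [zero_verticalBoundary_lifting_iff]
  constructor
  · intro h i y hy hvy
    exact h.homog (i.1 + 1, i.2 - 1) (Nat.succ_ne_zero _) y hy hvy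
  · intro h
    refine vSurj_of_homog ?_
    rintro ⟨n, q⟩ y hn hy hvy
    obtain ⟨q, rfl⟩ : ∃ r, q = r - 1 := ⟨q + 1, by ring⟩
    rcases n with _ | n
    · exact (hn rfl).elim
    · exact h (n, q) y hy hvy

lemma ceGeneratingCofibrations_rlp_iff :
    (ceGeneratingCofibrations k).rlp p ↔ DLift p ∧ SLift p := by
  rw [dLift_iff, sLift_iff]
  constructor
  · intro h
    exact ⟨⟨fun q => h _ (Or.inl (Or.inr ⟨q⟩)), fun i => h _ (Or.inr ⟨i⟩)⟩,
      fun q => h _ (Or.inl (Or.inl (Or.inl ⟨q⟩))), fun i => h _ (Or.inl (Or.inl (Or.inr ⟨i⟩)))⟩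
  · rintro ⟨⟨h₁, h₂⟩, h₃, h₄⟩ A B f (((h | h) | h) | h) <;> cases h
    exacts [h₃ _, h₄ _, h₁ _, h₂ _]

lemma ceFibrations_iff : ceFibrations k p ↔ DLift p ∧ VSurj p := by
  rw [dLift_iff, vSurj_iff]
  constructor
  · intro h
    exact ⟨⟨fun q => h _ (Or.inl (Or.inr ⟨q⟩)), fun i => h _ (Or.inr ⟨i⟩)⟩,
      fun i => h _ (Or.inl (Or.inl ⟨i⟩))⟩
  · rintro ⟨⟨h₁, h₂⟩, h₃⟩ A B f ((h | h) | h) <;> cases h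
    exacts [h₃ _, h₁ _, h₂ _]

end Bicomplex

end

/-! ### Trivial fibrations are the maps lifting against the generating cofibrations -/

noncomputable section

namespace Bicomplex

variable {k : Type u} [CommRing k] {X Y : Bicomplex k} {p : X ⟶ Y}

/-- Two uses of the property: horizontal cycles lift to horizontal cycles by prescribing 0, and then
an arbitrary element lifts once its boundary has been lifted. -/
lemma DLift.surjective (h : DLift p) (y : Tot Y) : ∃ x, totMap p x = y := by
  have hs (z : Tot Y) (hz : Dh Y z = 0) : ∃ x, totMap p x = z ∧ Dh X x = 0 :=
    h z 0 (map_zero _) (by rw [map_zero, hz])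
  obtain ⟨u, hu, hu'⟩ := hs (Dh Y y) (Dh_Dh _ _)
  obtain ⟨x, hx, -⟩ := h y u hu' hu
  exact ⟨x, hx⟩

lemma SLift.surjective (h : SLift p) (y : Tot Y) (hy : Dv Y y = 0) :
    ∃ x, Dv X x = 0 ∧ totMap p x = y := by
  have hs (z : Tot Y) (hz : Dv Y z = 0) (hz' : Dh Y z = 0) :
      ∃ x, Dv X x = 0 ∧ totMap p x = z ∧ Dh X x = 0 :=
    h z 0 hz (map_zero _) (map_zero _) (by rw [map_zero, hz'])
  obtain ⟨u, hv, hu, hu'⟩ := hs (Dh Y y) (by rw [Dv_Dh, hy, map_zero, neg_zero]) (Dh_Dh _ _)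
  obtain ⟨x, hx, hx', -⟩ := h y u hy hv hu' hu
  exact ⟨x, hx, hx'⟩

lemma SLift.vSurj (h : SLift p) : VSurj p := fun y hy => by
  obtain ⟨x, hx, hx'⟩ := h.surjective y hy
  exact ⟨x, hx, fun i _ => by rw [hx']⟩

/-- The truncation of an element of the total space to the columns `≤ n`. -/
def trunc (n : ℕ) (x : Tot X) : Tot X := fun i => if i.1 ≤ n then x i else 0

lemma trunc_add (n : ℕ) (x y : Tot X) : trunc n (x + y) = trunc n x + trunc n y := by
  ext i
  simp only [trunc, Pi.add_apply]
  split_ifs <;> simp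

lemma trunc_Dv (n : ℕ) (x : Tot X) : trunc n (Dv X x) = Dv X (trunc n x) := by
  ext i
  simp only [trunc, Dv_apply]
  split_ifs <;> simp

lemma trunc_Dh (n : ℕ) (x : Tot X) : trunc n (Dh X x) = Dh X (trunc (n + 1) x) := by
  ext i
  simp only [trunc, Dh_apply, add_le_add_iff_right]
  split_ifs <;> simp

lemma totMap_trunc (n : ℕ) (x : Tot X) : totMap p (trunc n x) = trunc n (totMap p x) := by
  ext i
  simp only [trunc, totMap_apply]
  split_ifs <;> simp

lemma trunc_zero (n : ℕ) : trunc n (0 : Tot X) = 0 := by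
  ext i
  simp [trunc]

lemma trunc_trunc (n : ℕ) (x : Tot X) : trunc n (trunc n x) = trunc n x := by
  ext i
  simp only [trunc]
  split_ifs <;> rfl

lemma Dh_trunc_zero (x : Tot X) : Dh X (trunc 0 x) = 0 := by
  ext i
  simp [trunc, Dh_apply]

lemma Homog.trunc_eq {i : ℕ × ℤ} {x : Tot X} (h : Homog i x) : trunc i.1 x = x := by
  ext j
  simp only [trunc]
  split_ifs with hj
  · rfl
  · rw [h j]
    rintro rfl
    exact hj le_rfl

/-- `VSurj` covers the positive columns. A vertical cycle in column 0 is automatically horizontally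
closed, so surjectivity on the second page lifts it up to boundary terms, and these lift by `VSurj`
and `DLift`. -/
lemma exists_vertical_cycle_lift (hv : VSurj p) (hd : DLift p) (hw : ceWeakEquivalences k p)
    (y : Tot Y) (hy : Dv Y y = 0) : ∃ x, Dv X x = 0 ∧ totMap p x = y := by
  obtain ⟨-, hs⟩ := (ceWeakEquivalences_iff p).1 hw
  have key (q : ℤ) : ∃ x, Dv X x = 0 ∧ totMap p x (0, q) = y (0, q) := by
    have h₀ : Homog (0, q) (pr (0, q) y) := homog_pr _ _
    have hv₀ : Dv Y (pr (0, q) y) = 0 := by rw [Dv_pr, hy, pr_zero]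
    obtain ⟨x, hx, y₁, y₂, hy₁, e⟩ := hs (pr (0, q) y)
      ⟨hv₀, 0, by rw [map_zero, h₀.Dh_eq_zero]⟩
    obtain ⟨x₁, hx₁, e₁⟩ := hv y₁ hy₁
    obtain ⟨x₂, rfl⟩ := hd.surjective y₂
    refine ⟨x + Dh X x₁ + Dv X x₂, ?_, ?_⟩
    · rw [map_add, map_add, hx.1, Dv_Dh, hx₁, Dv_Dv, map_zero, neg_zero, add_zero, add_zero]
    -- `VSurj` controls `x₁` only in positive columns, and column 0 of its horizontal boundary
    -- depends only on column 1.
    · have e₁' : Dh Y (totMap p x₁) (0, q) = Dh Y y₁ (0, q) := by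
        rw [Dh_apply, Dh_apply, e₁ _ (Nat.succ_ne_zero _)]
      have e' := congrFun (eq_add_of_sub_eq e) (0, q)
      rw [pr_apply_self] at e'
      rw [map_add, map_add, totMap_Dh, totMap_Dv, e']
      simp only [Pi.add_apply, e₁']
      abel
  choose x₀ hx₀ hx₀' using key
  obtain ⟨x, hx, hx'⟩ := hv y hy
  refine ⟨fun i => if i.1 = 0 then x₀ i.2 i else x i, ?_, ?_⟩
  · ext ⟨_ | n, q⟩
    · rw [Dv_apply]
      have := congrFun (hx₀ (q + 1)) (0, q)
      exact this
    · rw [Dv_apply]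
      exact congrFun hx (n + 1, q)
  · ext ⟨_ | n, q⟩
    · exact hx₀' q
    · exact hx' (n + 1, q) (Nat.succ_ne_zero n)

/-- Vertical cycles lift, so vertical homology is exact on kernel, source and target, and the
isomorphism on second pages kills the class of a closed vertical cycle of the kernel. The chase
produces bounding elements which themselves lie in the kernel. -/
lemma kernel_step (hd : DLift p) (hw : ceWeakEquivalences k p)
    (hz : ∀ y : Tot Y, Dv Y y = 0 → ∃ x, Dv X x = 0 ∧ totMap p x = y)
    (x : Tot X) (hv : Dv X x = 0) (hh : Dh X x = 0) (hp : totMap p x = 0) :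
    ∃ x₁ x₂, Dv X x₁ = 0 ∧ totMap p x₁ = 0 ∧ totMap p x₂ = 0 ∧ x = Dh X x₁ + Dv X x₂ := by
  obtain ⟨hi, hs⟩ := (ceWeakEquivalences_iff p).1 hw
  obtain ⟨x₁, x₂, hx₁, e⟩ := hi x ⟨hv, 0, by rw [hh, map_zero]⟩
    (hp ▸ ⟨0, 0, map_zero _, by rw [map_zero, map_zero, add_zero]⟩)
  have e' : Dh Y (totMap p x₁) = -Dv Y (totMap p x₂) := by
    rw [eq_neg_iff_add_eq_zero, ← totMap_Dh, ← totMap_Dv, ← map_add, ← e, hp]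
  obtain ⟨x₃, ⟨hx₃, x₅, hx₅⟩, y₃, y₄, hy₃, e₃⟩ := hs (totMap p x₁)
    ⟨by rw [← totMap_Dv, hx₁, map_zero], -totMap p x₂, by rw [e', map_neg]⟩
  obtain ⟨x₃', hx₃', rfl⟩ := hz y₃ hy₃
  obtain ⟨x₄, rfl⟩ := hd.surjective y₄
  -- Surjectivity on the second page gives `x₃` with the same class as the image of `x₁`.
  -- Subtracting it and lifts of the boundary terms moves `x₁` into the kernel; the change of its
  -- horizontal boundary is absorbed in the vertical term through `Dh X x₃ = Dv X x₅` and
  -- anticommutativity.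
  have hv₁ : Dv X (x₁ - x₃ - Dh X x₃' - Dv X x₄) = 0 := by
    rw [map_sub, map_sub, map_sub, hx₁, hx₃, Dv_Dh, hx₃', Dv_Dv]; simp
  have hp₁ : totMap p (x₁ - x₃ - Dh X x₃' - Dv X x₄) = 0 := by
    rw [map_sub, map_sub, map_sub, e₃, totMap_Dh, totMap_Dv]; abel
  have e₁ : x - Dh X (x₁ - x₃ - Dh X x₃' - Dv X x₄) = Dv X (x₂ + x₅ - Dh X x₄) := by
    rw [e, map_sub, map_sub, map_sub, map_sub, map_add, Dh_Dh, hx₅, Dh_Dv]; abel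
  -- The image of the new second term is a vertical cycle. Subtracting a vertical cycle lifting it
  -- puts this term in the kernel without changing its vertical boundary.
  obtain ⟨x₆, hx₆, e₆⟩ := hz (totMap p (x₂ + x₅ - Dh X x₄)) (by
    rw [← totMap_Dv, ← e₁, map_sub, hp, totMap_Dh, hp₁, map_zero, sub_zero])
  refine ⟨_, x₂ + x₅ - Dh X x₄ - x₆, hv₁, hp₁, by rw [map_sub, e₆, sub_self], ?_⟩
  rw [map_sub (Dv X) _ x₆, hx₆, sub_zero, ← e₁]
  abel

/-- Write x = Dh x₁ + Dv x₂ in the kernel. Then Dh x₂ is again a closed vertical cycle of the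
kernel, one column lower, so induction applies to it. -/
lemma kernel_acyclic (hd : DLift p) (hw : ceWeakEquivalences k p)
    (hz : ∀ y : Tot Y, Dv Y y = 0 → ∃ x, Dv X x = 0 ∧ totMap p x = y) (n : ℕ) :
    ∀ x : Tot X, trunc n x = x → Dv X x = 0 → Dh X x = 0 → totMap p x = 0 →
      ∃ w, Dv X w = 0 ∧ totMap p w = 0 ∧ Dh X w = x := by
  -- If a vertical cycle `w` of the kernel has the same horizontal boundary as `x₂`, then `x₂ - w`
  -- equals Dh m for some m in the kernel by `DLift`. Hence Dv x₂ = Dv Dh m = -Dh Dv m, and x₁ - Dv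
  -- m bounds `x`.
  have main (x x₁ x₂ w : Tot X) (hx₁ : Dv X x₁ = 0) (hp₁ : totMap p x₁ = 0)
      (hp₂ : totMap p x₂ = 0) (e : x = Dh X x₁ + Dv X x₂) (hw : Dv X w = 0)
      (hpw : totMap p w = 0) (hw' : Dh X w = Dh X x₂) :
      ∃ w, Dv X w = 0 ∧ totMap p w = 0 ∧ Dh X w = x := by
    obtain ⟨m, hm, hm'⟩ := hd 0 (x₂ - w) (by rw [map_sub, hw', sub_self])
      (by rw [map_sub, hp₂, hpw, sub_zero, map_zero])
    refine ⟨x₁ - Dv X m, by rw [map_sub, hx₁, Dv_Dv, sub_zero], by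
      rw [map_sub, totMap_Dv, hp₁, hm, map_zero, sub_zero], ?_⟩
    rw [map_sub, Dh_Dv, hm', map_sub, hw, e]
    abel
  -- Truncation commutes with `Dv` and shifts by one column under `Dh`, so `x₁` is cut at `n + 1`
  -- and `x₂` at `n`. The bound on `x₂` is what the induction uses.
  have step (n : ℕ) (x : Tot X) (hn : trunc n x = x) (hv : Dv X x = 0) (hh : Dh X x = 0)
      (hp : totMap p x = 0) : ∃ x₁ x₂, Dv X x₁ = 0 ∧ totMap p x₁ = 0 ∧ totMap p x₂ = 0 ∧
        x = Dh X x₁ + Dv X x₂ ∧ trunc n x₂ = x₂ := by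
    obtain ⟨x₁, x₂, hx₁, hp₁, hp₂, e⟩ := kernel_step hd hw hz x hv hh hp
    refine ⟨trunc (n + 1) x₁, trunc n x₂, by rw [← trunc_Dv, hx₁, trunc_zero],
      by rw [totMap_trunc, hp₁, trunc_zero], by rw [totMap_trunc, hp₂, trunc_zero], ?_,
      trunc_trunc _ _⟩
    rw [← hn, e, trunc_add, trunc_Dh, trunc_Dv]
  induction n with
  | zero =>
    intro x hn hv hh hp
    obtain ⟨x₁, x₂, hx₁, hp₁, hp₂, e, hn₂⟩ := step 0 x hn hv hh hp
    exact main x x₁ x₂ 0 hx₁ hp₁ hp₂ e (map_zero _) (map_zero _)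
      (by rw [map_zero, ← hn₂, Dh_trunc_zero])
  | succ n ih =>
    intro x hn hv hh hp
    obtain ⟨x₁, x₂, hx₁, hp₁, hp₂, e, hn₂⟩ := step (n + 1) x hn hv hh hp
    obtain ⟨w, hw, hpw, hw'⟩ := ih (Dh X x₂) (by rw [trunc_Dh, hn₂]) (by
      have : Dh X (Dv X x₂) = 0 := by rw [← sub_eq_iff_eq_add'.2 e, map_sub, hh, Dh_Dh, sub_zero]
      rw [Dv_Dh, this, neg_zero]) (Dh_Dh _ _) (by rw [totMap_Dh, hp₂, map_zero])
    exact main x x₁ x₂ w hx₁ hp₁ hp₂ e hw hpw hw'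

/-- Lift `y` to any vertical cycle and correct its horizontal boundary by an element of the kernel.
-/
lemma SLift.of_weakEquivalence (hd : DLift p) (hv : VSurj p) (hw : ceWeakEquivalences k p) :
    SLift p := by
  have hz := exists_vertical_cycle_lift hv hd hw
  refine sLift_of_homog ?_
  intro l y u hy hu hl hvy hvu hhu hpu
  obtain ⟨x, hx, rfl⟩ := hz y hvy
  have hvx : Dv X (pr l x) = 0 := by rw [Dv_pr, hx, pr_zero]
  have hpx : totMap p (pr l x) = totMap p x := by rw [totMap_pr, hy.pr_eq]
  by_cases h₀ : l.1 = 0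
  · exact ⟨pr l x, homog_pr _ _, hvx, hpx, by
      rw [hl h₀, Dh_eq_zero_of_homog h₀ (homog_pr _ _)]⟩
  -- The error sits in one bidegree, hence in finitely many columns; this is the reason for working
  -- with homogeneous elements when invoking `kernel_acyclic`.
  · have hh : Homog (hn l) (u - Dh X (pr l x)) := hu.sub (homog_pr _ _).Dh
    obtain ⟨w, hvw, hpw, hw'⟩ := kernel_acyclic hd hw hz _ (u - Dh X (pr l x)) hh.trunc_eq
      (by rw [map_sub, hvu, Dv_Dh, hvx]; simp) (by rw [map_sub, hhu, Dh_Dh, sub_zero])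
      (by rw [map_sub, hpu, totMap_Dh, hpx, sub_self])
    refine ⟨pr l x + pr l w, (homog_pr _ _).add (homog_pr _ _), ?_, ?_, ?_⟩
    · rw [map_add, hvx, Dv_pr, hvw, pr_zero, add_zero]
    · rw [map_add, hpx, totMap_pr, hpw, pr_zero, add_zero]
    · rw [map_add, Dh_pr h₀ w, hw', hh.pr_eq]
      abel

/-- The kernel and its vertical cycles are both horizontally acyclic, and vertical cycles lift.
Injectivity and surjectivity on the second page then follow by chasing these facts. -/
lemma weakEquivalence_of_lift (hd : DLift p) (hs : SLift p) : ceWeakEquivalences k p := by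
  rw [ceWeakEquivalences_iff]
  constructor
  · rintro x ⟨hv, x', hx'⟩ ⟨y₁, y₂, hy₁, e⟩
    obtain ⟨x₁, hx₁, rfl⟩ := hs.surjective y₁ hy₁
    obtain ⟨x₂, rfl⟩ := hd.surjective y₂
    obtain ⟨z, hz, hpz⟩ : ∃ z, x = z + Dh X x₁ + Dv X x₂ ∧ totMap p z = 0 :=
      ⟨x - Dh X x₁ - Dv X x₂, by abel, by rw [map_sub, map_sub, e, totMap_Dh, totMap_Dv]; abel⟩
    have hvz : Dv X z = 0 := by
      have := congrArg (Dv X) hz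
      rw [hv, map_add, map_add, Dv_Dh, hx₁, Dv_Dv, map_zero, neg_zero, add_zero, add_zero] at this
      exact this.symm
    have hhz : Dh X z = Dv X (x' + Dh X x₂) := by
      have := congrArg (Dh X) hz
      rw [hx', map_add, map_add, Dh_Dh, add_zero, Dh_Dv] at this
      rw [map_add, this]
      abel
    obtain ⟨x₃, hx₃, hpx₃⟩ := hs.surjective (totMap p (x' + Dh X x₂))
      (by rw [← totMap_Dv, ← hhz, totMap_Dh, hpz, map_zero])
    have hhz' : Dh X z = Dv X (x' + Dh X x₂ - x₃) := by rw [map_sub, hx₃, hhz, sub_zero]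
    have hp' : totMap p (x' + Dh X x₂ - x₃) = 0 := by rw [map_sub, hpx₃, sub_self]
    -- From here `z` and `w` lie in the kernel with Dh z = Dv w. Acyclicity of vertical cycles
    -- corrects `w` to a horizontal cycle w - t = Dh m; then z + Dv m is a closed vertical cycle of
    -- the kernel and is a horizontal boundary.
    generalize x' + Dh X x₂ - x₃ = w at hhz' hp'
    obtain ⟨t, hvt, hpt, hht⟩ := hs 0 (Dh X w) (map_zero _)
      (by rw [Dv_Dh, ← hhz', Dh_Dh, neg_zero]) (Dh_Dh _ _) (by rw [totMap_Dh, hp'])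
    obtain ⟨m, hpm, hm⟩ := hd 0 (w - t) (by rw [map_sub, hht, sub_self])
      (by rw [map_sub, hp', hpt, sub_zero, map_zero])
    have hzm : Dh X (z + Dv X m) = 0 := by
      rw [map_add, Dh_Dv, hm, map_sub, hvt, hhz']
      abel
    obtain ⟨s, hvs, hps, hhs⟩ := hs 0 (z + Dv X m) (map_zero _)
      (by rw [map_add, hvz, Dv_Dv, add_zero]) hzm
      (by rw [map_add, hpz, totMap_Dv, hpm, map_zero, map_zero, add_zero])
    refine ⟨s + x₁, x₂ - m, by rw [map_add, hvs, hx₁, add_zero], ?_⟩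
    rw [map_add, map_sub, hhs, hz]
    abel
  · rintro y ⟨hv, y', hy'⟩
    -- The witness `y'` of survival must be lifted together with `y`. Its horizontal boundary is a
    -- vertical cycle and is lifted first, then `y'` over it, and finally `y` with prescribed
    -- boundary `Dv X x'`.
    obtain ⟨u, hvu, hpu, hhu⟩ := hs (Dh Y y') 0
      (by rw [Dv_Dh, ← hy', Dh_Dh, neg_zero]) (map_zero _) (map_zero _)
      (by rw [map_zero, Dh_Dh])
    obtain ⟨x', hpx', hhx'⟩ := hd y' u hhu hpu
    obtain ⟨x, hvx, hpx, hhx⟩ := hs y (Dv X x') hv (Dv_Dv _ _)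
      (by rw [Dh_Dv, hhx', hvu, neg_zero]) (by rw [totMap_Dv, hpx', hy'])
    exact ⟨x, ⟨hvx, x', hhx⟩, 0, 0, map_zero _, by rw [hpx]; simp⟩

theorem ceGeneratingCofibrations_rlp :
    (ceGeneratingCofibrations k).rlp = ceFibrations k ⊓ ceWeakEquivalences k := by
  ext X Y p
  rw [MorphismProperty.inf_iff, ceGeneratingCofibrations_rlp_iff, ceFibrations_iff]
  exact ⟨fun ⟨hd, hs⟩ => ⟨⟨hd, hs.vSurj⟩, weakEquivalence_of_lift hd hs⟩,
    fun ⟨⟨hd, hv⟩, hw⟩ => ⟨hd, .of_weakEquivalence hd hv hw⟩⟩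

end Bicomplex

end

/-! ### Bicomplexes as complexes of complexes; limits and colimits -/

noncomputable section

namespace Bicomplex

variable {k : Type u} [CommRing k]

abbrev DoubleComplex (k : Type u) [CommRing k] :=
  HomologicalComplex (HomologicalComplex (ModuleCat.{u} k) (ComplexShape.down ℤ))
    (ComplexShape.down ℕ)

/-- The sign (-1)^p on the vertical differential of column p changes by -1 across a horizontal arrow
and cancels the sign of anticommutativity. -/
lemma dh_dv_comm (A : Bicomplex k) (p p' : ℕ) (q q' : ℤ) (hp : p' + 1 = p) (hq : q' + 1 = q) :
    A.dh (p, q) (p', q) ≫ ((p' : ℤ).negOnePow • A.dv (p', q) (p', q')) =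
      ((p : ℤ).negOnePow • A.dv (p, q) (p, q')) ≫ A.dh (p, q') (p', q') := by
  subst hp hq
  have h := eq_neg_of_add_eq_zero_left (A.anticomm p' q')
  rw [Linear.comp_units_smul, Linear.units_smul_comp, h, Nat.cast_succ, Int.negOnePow_succ,
    Units.neg_smul, smul_neg]

lemma comp_eq_comp_of_eq_zero {V W V' W' : ModuleCat.{u} k} {f : V ⟶ W} {g : W ⟶ W'}
    {f' : V ⟶ V'} {g' : V' ⟶ W'} (h : g = 0) (h' : f' = 0) : f ≫ g = f' ≫ g' := by
  rw [h, h', comp_zero, zero_comp]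

lemma comp_eq_comp_of_eq_zero' {V W V' W' : ModuleCat.{u} k} {f : V ⟶ W} {g : W ⟶ W'}
    {f' : V ⟶ V'} {g' : V' ⟶ W'} (h : f = 0) (h' : g' = 0) : f ≫ g = f' ≫ g' := by
  rw [h, h', comp_zero, zero_comp]

lemma comp_units_smul_eq_iff {V W V' W' : ModuleCat.{u} k} (e : ℤˣ) (f : V ⟶ W) (g : W ⟶ W')
    (f' : V ⟶ V') (g' : V' ⟶ W') : f ≫ (e • g) = (e • f') ≫ g' ↔ f ≫ g = f' ≫ g' := by
  rw [Linear.comp_units_smul, Linear.units_smul_comp, smul_left_cancel_iff]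

/-- A column of a bicomplex, with the sign that makes horizontal differentials commute with the
vertical ones. -/
def signedColumn (A : Bicomplex k) (p : ℕ) :
    HomologicalComplex (ModuleCat.{u} k) (ComplexShape.down ℤ) where
  X := fun q => A.X (p, q)
  d := fun q q' => (p : ℤ).negOnePow • A.dv (p, q) (p, q')
  shape := fun q q' h => by
    rw [A.dv_shape, smul_zero]
    rw [vShape_rel]
    exact fun h' => h h'.2
  d_comp_d' := fun q q' q'' _ _ => by
    rw [Linear.comp_units_smul, Linear.units_smul_comp, A.dv_comp_dv, smul_zero, smul_zero]

def signedColumnD (A : Bicomplex k) (p p' : ℕ) : A.signedColumn p ⟶ A.signedColumn p' where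
  f := fun q => A.dh (p, q) (p', q)
  comm' := fun q q' hq => by
    by_cases hp : p' + 1 = p
    · exact dh_dv_comm A p p' q q' hp hq
    · have h (r : ℤ) : A.dh (p, r) (p', r) = 0 :=
        A.dh_shape _ _ (by rw [hShape_rel]; exact fun h => hp h.1)
      exact comp_eq_comp_of_eq_zero' (h q) (h q')

def signedColumnMap {A B : Bicomplex k} (φ : A ⟶ B) (p : ℕ) :
    A.signedColumn p ⟶ B.signedColumn p where
  f := fun q => φ.f (p, q)
  comm' := fun q q' _ => by
    exact (comp_units_smul_eq_iff _ _ _ _ _).2 (φ.comm_v (p, q) (p, q'))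

def toDoubleObj (A : Bicomplex k) : DoubleComplex k where
  X := A.signedColumn
  d := A.signedColumnD
  shape := fun p p' h => by
    ext q : 1
    exact A.dh_shape _ _ (by rw [hShape_rel]; exact fun h' => h h'.1)
  d_comp_d' := fun p p' p'' _ _ => by
    ext q : 1
    exact A.dh_comp_dh _ _ _

/-- Bicomplexes with anticommuting differentials, seen as complexes of complexes. -/
def toDouble : Bicomplex k ⥤ DoubleComplex k where
  obj := toDoubleObj
  map φ :=
    { f := signedColumnMap φ
      comm' := fun p p' _ => by
        ext q : 1
        exact φ.comm_h _ _ }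
  map_id A := by
    ext p q : 2
    rfl
  map_comp φ ψ := by
    ext p q : 2
    rfl

instance : (toDouble (k := k)).Faithful where
  map_injective {A B φ ψ} h := by
    ext1 ⟨p, q⟩
    exact congrArg (fun f => HomologicalComplex.Hom.f (HomologicalComplex.Hom.f f p) q) h

instance : (toDouble (k := k)).Full where
  map_surjective {A B} ψ := by
    refine ⟨{ f := fun i => (ψ.f i.1).f i.2, comm_h := ?_, comm_v := ?_ }, rfl⟩
    · rintro ⟨p, q⟩ ⟨p', q'⟩
      by_cases h : hShape.Rel (p, q) (p', q')
      · obtain ⟨-, rfl⟩ := (hShape_rel _ _).1 h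
        exact congrArg (fun f => HomologicalComplex.Hom.f f q') (ψ.comm p p')
      · exact comp_eq_comp_of_eq_zero (B.dh_shape _ _ h) (A.dh_shape _ _ h)
    · rintro ⟨p, q⟩ ⟨p', q'⟩
      by_cases h : vShape.Rel (p, q) (p', q')
      · obtain ⟨rfl, -⟩ := (vShape_rel _ _).1 h
        exact (comp_units_smul_eq_iff _ _ _ _ _).1 ((ψ.f p').comm q q')
      · exact comp_eq_comp_of_eq_zero (B.dv_shape _ _ h) (A.dv_shape _ _ h)

/-- The bicomplex with anticommuting differentials associated to a complex of complexes. -/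
def ofDouble (K : DoubleComplex k) : Bicomplex k where
  X i := (K.X i.1).X i.2
  -- Only the rows are compared, to make the composite typecheck; the condition on columns is left
  -- to the vanishing of `K.d` off its shape.
  dh i j := if h : i.2 = j.2 then (K.d i.1 j.1).f i.2 ≫ ((K.X j.1).XIsoOfEq h).hom else 0
  dv i j := if h : i.1 = j.1 then
    (i.1 : ℤ).negOnePow • (K.X i.1).d i.2 j.2 ≫ eqToHom (by rw [h]) else 0
  dh_shape i j h := by
    split_ifs with h'
    · rw [K.shape, HomologicalComplex.zero_f, zero_comp]
      exact fun h'' => h ((hShape_rel _ _).2 ⟨h'', h'.symm⟩)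
    · rfl
  dv_shape i j h := by
    split_ifs with h'
    · rw [(K.X i.1).shape, zero_comp, smul_zero]
      exact fun h'' => h ((vShape_rel _ _).2 ⟨h'.symm, h''⟩)
    · rfl
  dh_comp_dh := by
    rintro ⟨p, q⟩ ⟨p', q'⟩ ⟨p'', q''⟩
    by_cases h : q = q'
    · subst h
      by_cases h : q = q''
      · subst h
        simp
      · simp [h]
    · simp [h]
  dv_comp_dv := by
    rintro ⟨p, q⟩ ⟨p', q'⟩ ⟨p'', q''⟩
    by_cases h : p = p'
    · subst h
      by_cases h : p = p''
      · subst h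
        simp
      · simp [h]
    · simp [h]
  anticomm p q := by
    simp [Int.negOnePow_succ]

lemma signedColumn_ofDouble_d (K : DoubleComplex k) (p : ℕ) (q q' : ℤ) :
    ((ofDouble K).signedColumn p).d q q' = (K.X p).d q q' := by
  simp [signedColumn, ofDouble, smul_smul, Int.units_mul_self]

lemma ofDouble_dh (K : DoubleComplex k) (p p' : ℕ) (q : ℤ) :
    (ofDouble K).dh (p, q) (p', q) = (K.d p p').f q := by
  simp [ofDouble]

lemma id_comp_eq_comp_id {V W : ModuleCat.{u} k} {f g : V ⟶ W} (h : f = g) :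
    𝟙 _ ≫ f = g ≫ 𝟙 _ := by
  rw [h, Category.id_comp, Category.comp_id]

/-- The complex of complexes associated to `ofDouble K` is `K`. -/
def toDoubleOfDouble (K : DoubleComplex k) : toDouble.obj (ofDouble K) ≅ K :=
  HomologicalComplex.Hom.isoOfComponents
    (fun p => HomologicalComplex.Hom.isoOfComponents (fun q => Iso.refl ((K.X p).X q))
      (fun q q' _ => id_comp_eq_comp_id (signedColumn_ofDouble_d K p q q').symm))
    (fun p p' _ => by
      ext q : 1
      exact id_comp_eq_comp_id (ofDouble_dh K p p' q).symm)

instance : (toDouble (k := k)).EssSurj where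
  mem_essImage K := ⟨ofDouble K, ⟨toDoubleOfDouble K⟩⟩

/-- Limits and colimits are transported along this equivalence, as is the use of a separator when
`tensorLeft` is shown to be a left adjoint. -/
instance : (toDouble (k := k)).IsEquivalence where

scoped instance : HasColimitsOfSize.{u, u} (Bicomplex k) :=
  Adjunction.has_colimits_of_equivalence toDouble

scoped instance : HasLimitsOfSize.{u, u} (Bicomplex k) :=
  Adjunction.has_limits_of_equivalence toDouble

scoped instance : HasFiniteLimits (Bicomplex k) := hasFiniteLimits_of_hasLimitsOfSize.{u, u} _

scoped instance : HasFiniteColimits (Bicomplex k) := hasFiniteColimits_of_hasColimitsOfSize.{u, u} _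

/-- The module in a given bidegree. -/
abbrev ev (i : ℕ × ℤ) : Bicomplex k ⥤ ModuleCat.{u} k :=
  toGraded ⋙ GradedObject.eval i

def evIso (i : ℕ × ℤ) : ev (k := k) i ≅
    toDouble ⋙ HomologicalComplex.eval _ _ i.1 ⋙ HomologicalComplex.eval _ _ i.2 :=
  Iso.refl _

instance (i : ℕ × ℤ) (J : Type*) [Category* J] [HasColimitsOfShape J (ModuleCat.{u} k)] :
    PreservesColimitsOfShape J (ev (k := k) i) :=
  preservesColimitsOfShape_of_natIso (evIso i).symm

end Bicomplex

end

/-! ### Tensor products preserve colimits; the closed structure -/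

noncomputable section

namespace Bicomplex

variable {k : Type u} [CommRing k]

open GradedObject.Monoidal

/-- Colimits of bicomplexes are detected in each bidegree. -/
def isColimitOfEv {J : Type*} [Category* J] {F : J ⥤ Bicomplex k} (s : Cocone F)
    (h : ∀ i, IsColimit ((ev i).mapCocone s)) : IsColimit s where
  desc t :=
    { f := fun i => (h i).desc ((ev i).mapCocone t)
      comm_h := fun i j => (h i).hom_ext fun a => by
        have e₁ := (h i).fac ((ev i).mapCocone t) a
        have e₂ := (h j).fac ((ev j).mapCocone t) a
        have e₃ := (s.ι.app a).comm_h i j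
        have e₄ := (t.ι.app a).comm_h i j
        refine ((reassoc_of% e₁) _).trans (e₄.trans ?_)
        exact (congrArg ((F.obj a).dh i j ≫ ·) e₂).symm.trans ((reassoc_of% e₃) _).symm
      comm_v := fun i j => (h i).hom_ext fun a => by
        have e₁ := (h i).fac ((ev i).mapCocone t) a
        have e₂ := (h j).fac ((ev j).mapCocone t) a
        have e₃ := (s.ι.app a).comm_v i j
        have e₄ := (t.ι.app a).comm_v i j
        refine ((reassoc_of% e₁) _).trans (e₄.trans ?_)
        exact (congrArg ((F.obj a).dv i j ≫ ·) e₂).symm.trans ((reassoc_of% e₃) _).symm }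
  fac t a := by
    ext1 i
    exact (h i).fac ((ev i).mapCocone t) a
  uniq t m hm := by
    ext1 i
    refine (h i).uniq ((ev i).mapCocone t) _ fun a => ?_
    exact congrArg (fun φ => Hom.f φ i) (hm a)

lemma ι_whiskerLeft (A : Bicomplex k) {B B' : Bicomplex k} (φ : B ⟶ B') (i₁ i₂ j : ℕ × ℤ)
    (h : i₁ + i₂ = j) :
    ι A B i₁ i₂ j h ≫ (A ◁ φ).f j = (A.X i₁ ◁ φ.f i₂) ≫ ι A B' i₁ i₂ j h := by
  refine (ι_tensorHom (𝟙 A.X) φ.f i₁ i₂ j h).trans ?_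
  rw [← MonoidalCategory.id_tensorHom]
  rfl

lemma ι_whiskerRight {A A' : Bicomplex k} (φ : A ⟶ A') (B : Bicomplex k) (i₁ i₂ j : ℕ × ℤ)
    (h : i₁ + i₂ = j) :
    ι A B i₁ i₂ j h ≫ (φ ▷ B).f j = (φ.f i₁ ▷ B.X i₂) ≫ ι A' B i₁ i₂ j h := by
  refine (ι_tensorHom φ.f (𝟙 B.X) i₁ i₂ j h).trans ?_
  rw [← MonoidalCategory.tensorHom_id]
  rfl

lemma tensor_hom_ext {A B C : Bicomplex k} {φ ψ : A ⊗ B ⟶ C}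
    (h : ∀ (i₁ i₂ j : ℕ × ℤ) (hj : i₁ + i₂ = j),
      ι A B i₁ i₂ j hj ≫ φ.f j = ι A B i₁ i₂ j hj ≫ ψ.f j) : φ = ψ := by
  ext1 j
  apply tensorObj_ext
  exact fun i₁ i₂ hj => h i₁ i₂ j hj

/-- The cocone on `A_{i₁} ⊗ F_{i₂}` induced by a cocone on `(A ⊗ F)_j`. -/
def summandCocone {J : Type*} [Category* J] (A : Bicomplex k) (F : J ⥤ Bicomplex k) {j : ℕ × ℤ}
    (t : Cocone (F ⋙ tensorLeft A ⋙ ev j)) (i₁ i₂ : ℕ × ℤ) (h : i₁ + i₂ = j) :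
    Cocone (F ⋙ ev i₂ ⋙ tensorLeft (A.X i₁)) where
  pt := t.pt
  ι :=
    { app := fun a => ι A (F.obj a) i₁ i₂ j h ≫ t.ι.app a
      naturality := fun a b f => by
        have e₁ := ι_whiskerLeft A (F.map f) i₁ i₂ j h
        have e₂ := t.w f
        refine ((reassoc_of% e₁) (t.ι.app b)).symm.trans ?_
        exact (congrArg (ι A (F.obj a) i₁ i₂ j h ≫ ·) e₂).trans (Category.comp_id _).symm }

/-- In each bidegree the tensor product is a direct sum of modules `A.X i₁ ⊗ -`, each of which
preserves the colimit; descent is therefore defined and checked one summand at a time. -/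
def isColimitTensorLeft {J : Type u} [Category.{u} J] (A : Bicomplex k) {F : J ⥤ Bicomplex k}
    {s : Cocone F} (hs : IsColimit s) : IsColimit ((tensorLeft A).mapCocone s) := by
  let H (i₁ i₂ : ℕ × ℤ) : IsColimit ((ev i₂ ⋙ tensorLeft (A.X i₁)).mapCocone s) :=
    isColimitOfPreserves _ hs
  refine isColimitOfEv _ fun j => ?_
  refine
    { desc := fun t => tensorObjDesc fun i₁ i₂ h => (H i₁ i₂).desc (summandCocone A F t i₁ i₂ h)
      fac := fun t a => ?_
      uniq := fun t m hm => ?_ }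
  · apply tensorObj_ext
    intro i₁ i₂ h
    have e₁ := ι_whiskerLeft A (s.ι.app a) i₁ i₂ j h
    have e₂ := (H i₁ i₂).fac (summandCocone A F t i₁ i₂ h) a
    refine ((reassoc_of% e₁) _).trans ?_
    refine (congrArg ((A.X i₁ ◁ (s.ι.app a).f i₂) ≫ ·) (ι_tensorObjDesc _ _ _ _)).trans e₂
  · apply tensorObj_ext
    intro i₁ i₂ h
    refine Eq.trans ?_ (ι_tensorObjDesc _ _ _ _).symm
    refine (H i₁ i₂).uniq (summandCocone A F t i₁ i₂ h) _ fun a => ?_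
    have e₁ := ι_whiskerLeft A (s.ι.app a) i₁ i₂ j h
    exact ((reassoc_of% e₁) m).symm.trans (congrArg (ι A (F.obj a) i₁ i₂ j h ≫ ·) (hm a))

instance (A : Bicomplex k) : PreservesColimitsOfSize.{u, u} (tensorLeft A) where
  preservesColimitsOfShape := { preservesColimit := { preserves := fun hc =>
    ⟨isColimitTensorLeft A hc⟩ } }

/-- An adjoint functor theorem: preservation of colimits suffices in the presence of a separator. It
is applied on complexes of complexes and carried back along the equivalence, so no explicit internal
hom is built. -/
instance (A : Bicomplex k) : (tensorLeft A).IsLeftAdjoint := by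
  let e := (toDouble (k := k)).asEquivalence
  have h : (e.inverse ⋙ tensorLeft A).IsLeftAdjoint :=
    isLeftAdjoint_of_preservesColimits_of_isSeparating
      (isSeparator_separator (DoubleComplex k)) _
  have : (e.functor ⋙ e.inverse ⋙ tensorLeft A).IsLeftAdjoint := inferInstance
  exact Functor.isLeftAdjoint_of_iso (F := e.functor ⋙ e.inverse ⋙ tensorLeft A)
    (Functor.isoWhiskerRight e.unitIso.symm (tensorLeft A) ≪≫ Functor.leftUnitor _)

instance : MonoidalClosed (Bicomplex k) where
  closed A := { rightAdj := (tensorLeft A).rightAdjoint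
                adj := Adjunction.ofIsLeftAdjoint (tensorLeft A) }

end Bicomplex

end

/-! ### Acyclic embeddings: composition, retracts and pushouts -/

noncomputable section

namespace Bicomplex

variable {k : Type u} [CommRing k]

/-- The morphisms `φ` which are injective, injective on vertical homology, and whose cokernel has
vanishing second page. -/
structure IsAcyclicEmbedding {A B : Bicomplex k} (φ : A ⟶ B) : Prop where
  injective : Function.Injective (totMap φ)
  exists_Dv (a : Tot A) (b : Tot B) (h : Dv B b = totMap φ a) : ∃ a', Dv A a' = a
  exists_eq (b b' : Tot B) (a : Tot A) (hb : Dv B b = 0) (h : Dh B b = Dv B b' + totMap φ a) :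
    ∃ b₁ b₂ a₁, Dv B b₁ = 0 ∧ b = Dh B b₁ + Dv B b₂ + totMap φ a₁

variable (k) in
/-- The class of acyclic embeddings. -/
def acyclicEmbeddings : MorphismProperty (Bicomplex k) := fun _ _ φ => IsAcyclicEmbedding φ

section

variable {A B C : Bicomplex k} {φ : A ⟶ B}

namespace IsAcyclicEmbedding

lemma eq_zero (h : IsAcyclicEmbedding φ) {a : Tot A} (ha : totMap φ a = 0) : a = 0 :=
  h.injective (ha.trans (map_zero _).symm)

/-- Injectivity on vertical homology gives a short exact sequence of horizontal complexes on the
first page, whose third term is acyclic. The proof is the corresponding part of the long exact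
sequence: subtract off the cokernel part, then descend vertical boundaries along `φ` by `exists_Dv`.
-/
lemma weakEquivalence (h : IsAcyclicEmbedding φ) : ceWeakEquivalences k φ := by
  rw [ceWeakEquivalences_iff]
  constructor
  · rintro x ⟨hvx, -⟩ ⟨y, w, hvy, hy⟩
    obtain ⟨b₁, b₂, a₁, hb₁, rfl⟩ := h.exists_eq y (-w) x hvy (by rw [hy, map_neg]; abel)
    have ha₁ : Dv A a₁ = 0 := h.eq_zero (by simpa [totMap_Dv, Dv_Dh, hb₁] using hvy)
    obtain ⟨a', ha'⟩ := h.exists_Dv (x - Dh A a₁) (w - Dh B b₂) (by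
      rw [map_sub (totMap φ), hy, totMap_Dh, map_sub, Dv_Dh]
      simp
      abel)
    exact ⟨a₁, a', ha₁, by rw [ha']; abel⟩
  · rintro y ⟨hvy, w, hw⟩
    obtain ⟨b₁, b₂, a₁, hb₁, rfl⟩ := h.exists_eq y w 0 hvy (by rw [hw, map_zero, add_zero])
    have ha₁ : Dv A a₁ = 0 := h.eq_zero (by simpa [totMap_Dv, Dv_Dh, hb₁] using hvy)
    obtain ⟨a', ha'⟩ := h.exists_Dv (Dh A a₁) (w + Dh B b₂) (by
      rw [map_add, ← hw, Dv_Dh, totMap_Dh]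
      simp)
    exact ⟨a₁, ⟨ha₁, a', ha'.symm⟩, b₁, b₂, hb₁, by abel⟩

/-- The cokernel of the composite is an extension of the two cokernels. An element of `C` is first
reduced to one of `B`, whose defect equation is brought down to `B` by `hψ.exists_Dv`. -/
lemma comp {ψ : B ⟶ C} (hφ : IsAcyclicEmbedding φ) (hψ : IsAcyclicEmbedding ψ) :
    IsAcyclicEmbedding (φ ≫ ψ) where
  injective := hψ.injective.comp hφ.injective
  exists_Dv a c h := by
    obtain ⟨b, hb⟩ := hψ.exists_Dv _ c h
    exact hφ.exists_Dv a b hb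
  exists_eq c c' a hc h := by
    obtain ⟨c₁, c₂, b₁, hc₁, rfl⟩ := hψ.exists_eq c c' (totMap φ a) hc h
    have hb₁ : Dv B b₁ = 0 := hψ.eq_zero (by simpa [totMap_Dv, Dv_Dh, hc₁] using hc)
    obtain ⟨b', hb'⟩ := hψ.exists_Dv (Dh B b₁ - totMap φ a) (c' + Dh C c₂) (by
      rw [map_sub, totMap_Dh, map_add, Dv_Dh, ← totMap_comp, eq_sub_iff_add_eq]
      simp only [map_add, Dh_Dh, zero_add] at h
      rw [add_right_comm, ← h]
      abel)
    obtain ⟨b₂, b₃, a₁, hb₂, rfl⟩ := hφ.exists_eq b₁ b' a hb₁ (by rw [hb']; abel)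
    refine ⟨c₁ + totMap ψ b₂, c₂ + totMap ψ b₃, a₁, ?_, ?_⟩
    · rw [map_add, hc₁, ← totMap_Dv, hb₂, map_zero, add_zero]
    · simp only [map_add, totMap_Dh, totMap_Dv, totMap_comp]
      abel

lemma of_isIso (φ : A ⟶ B) [IsIso φ] : IsAcyclicEmbedding φ where
  injective a a' h := by
    have := congrArg (totMap (inv φ)) h
    rwa [← totMap_comp, ← totMap_comp, IsIso.hom_inv_id] at this
  exists_Dv a b h := by
    refine ⟨totMap (inv φ) b, ?_⟩
    rw [← totMap_Dv, h, ← totMap_comp, IsIso.hom_inv_id, totMap_id]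
  exists_eq b b' a _ _ := by
    refine ⟨0, 0, totMap (inv φ) b, map_zero _, ?_⟩
    rw [← totMap_comp, IsIso.inv_hom_id, totMap_id, map_zero, map_zero, zero_add, zero_add]

lemma of_retract {A' B' : Bicomplex k} {ψ : A' ⟶ B'} (i : A ⟶ A') (r : A' ⟶ A) (i' : B ⟶ B')
    (r' : B' ⟶ B) (hri : i ≫ r = 𝟙 A) (hri' : i' ≫ r' = 𝟙 B) (wi : i ≫ ψ = φ ≫ i')
    (wr : r ≫ φ = ψ ≫ r') (h : IsAcyclicEmbedding ψ) : IsAcyclicEmbedding φ := by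
  have hl (x : Tot A) : totMap r (totMap i x) = x := by rw [← totMap_comp, hri, totMap_id]
  have hr (x : Tot B) : totMap r' (totMap i' x) = x := by rw [← totMap_comp, hri', totMap_id]
  have hi (x : Tot A) : totMap ψ (totMap i x) = totMap i' (totMap φ x) := by
    rw [← totMap_comp, ← totMap_comp, wi]
  have hr' (x : Tot A') : totMap φ (totMap r x) = totMap r' (totMap ψ x) := by
    rw [← totMap_comp, ← totMap_comp, wr]
  constructor
  · intro a a' haa'
    rw [← hl a, ← hl a']
    congr 1
    exact h.injective (by rw [hi, hi, haa'])
  · intro a b hab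
    obtain ⟨a', ha'⟩ := h.exists_Dv (totMap i a) (totMap i' b)
      (by rw [hi, ← hab, totMap_Dv])
    exact ⟨totMap r a', by rw [← totMap_Dv, ha', hl]⟩
  · intro b b' a hb hab
    obtain ⟨b₁, b₂, a₁, hb₁, e⟩ := h.exists_eq (totMap i' b) (totMap i' b')
      (totMap i a) (by rw [← totMap_Dv, hb, map_zero])
      (by rw [← totMap_Dh, hab, map_add, totMap_Dv, hi])
    refine ⟨totMap r' b₁, totMap r' b₂, totMap r a₁,
      by rw [← totMap_Dv, hb₁, map_zero], ?_⟩
    rw [← hr b, e, hr', map_add, map_add, totMap_Dh, totMap_Dv]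

/-- It suffices to consider homogeneous elements. -/
lemma of_homog (h₁ : Function.Injective (totMap φ))
    (h₂ : ∀ (l : ℕ × ℤ) (a : Tot A) (b : Tot B), Homog (vn l) a → Homog l b →
      Dv B b = totMap φ a → ∃ a', Dv A a' = a)
    (h₃ : ∀ (l : ℕ × ℤ) (b b' : Tot B) (a : Tot A), Homog l b → Homog (vp (hn l)) b' →
      Homog (hn l) a → Dv B b = 0 → Dh B b = Dv B b' + totMap φ a →
      ∃ b₁ b₂ a₁, Dv B b₁ = 0 ∧ b = Dh B b₁ + Dv B b₂ + totMap φ a₁) :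
    IsAcyclicEmbedding φ := by
  refine ⟨h₁, fun a b h => ?_, fun b b' a hb h => ?_⟩
  · choose a' ha' using fun l => h₂ l (pr (vn l) a) (pr l b) (homog_pr _ _) (homog_pr _ _)
      (by rw [Dv_pr, h, totMap_pr])
    refine ⟨fun l => a' l l, ?_⟩
    ext j
    have := congrFun (ha' (vp j)) j
    rw [vn_vp, pr_apply_self] at this
    exact this
  · have H (l : ℕ × ℤ) : ∃ b₁ b₂ a₁, Dv B b₁ = 0 ∧ pr l b = Dh B b₁ + Dv B b₂ + totMap φ a₁ := by
      by_cases hl : l.1 = 0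
      · exact h₃ l (pr l b) 0 0 (homog_pr _ _) (homog_zero _) (homog_zero _)
          (by rw [Dv_pr, hb, pr_zero])
          (by rw [Dh_eq_zero_of_homog hl (homog_pr _ _), map_zero, map_zero, add_zero])
      · refine h₃ l (pr l b) (pr (vp (hn l)) b') (pr (hn l) a) (homog_pr _ _) (homog_pr _ _)
          (homog_pr _ _) (by rw [Dv_pr, hb, pr_zero]) ?_
        rw [Dh_pr hl, h, pr_add, totMap_pr, Dv_pr, vn_vp]
    choose b₁ b₂ a₁ hb₁ e using H
    -- The piece for bidegree `l` contributes its first term only at `hp l` and its second only at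
    -- `vp l`, hence the indices `hn j` and `vn j`. The value of the first term in column 0 is
    -- irrelevant for `Dh`.
    refine ⟨fun j => b₁ (hn j) j, fun j => b₂ (vn j) j, fun j => a₁ j j, ?_, ?_⟩
    · ext j
      exact congrFun (hb₁ (hn (vp j))) j
    · ext j
      have e' := congrFun (e j) j
      rw [pr_apply_self] at e'
      rw [e']
      simp only [Pi.add_apply, Dh_apply, Dv_apply, totMap_apply, hn_hp, vn_vp]

end IsAcyclicEmbedding

lemma acyclicEmbeddings_le : acyclicEmbeddings k ≤ ceWeakEquivalences k :=
  fun _ _ _ h => h.weakEquivalence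

instance : (acyclicEmbeddings k).IsMultiplicative where
  id_mem A := IsAcyclicEmbedding.of_isIso (𝟙 A)
  comp_mem _ _ h h' := h.comp h'

instance : (acyclicEmbeddings k).RespectsIso :=
  MorphismProperty.respectsIso_of_isStableUnderComposition
    fun _ _ f (_ : IsIso f) => IsAcyclicEmbedding.of_isIso f

instance : (acyclicEmbeddings k).IsStableUnderRetracts where
  of_retract r h := h.of_retract _ _ _ _ r.retract_left r.retract_right r.i_w r.r_w

end

section Pushout

lemma isPushout_exists_rep {X Y Z P : ModuleCat.{u} k} {f : Z ⟶ X} {g : Z ⟶ Y} {inl : X ⟶ P}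
    {inr : Y ⟶ P} (h : IsPushout f g inl inr) (p : P) : ∃ x y, p = inl x + inr y := by
  let R : Submodule k P := LinearMap.range inl.hom ⊔ LinearMap.range inr.hom
  have : ModuleCat.ofHom R.mkQ = 0 := by
    apply h.hom_ext
    · ext x
      exact (Submodule.Quotient.mk_eq_zero R).2 (Submodule.mem_sup_left ⟨x, rfl⟩)
    · ext x
      exact (Submodule.Quotient.mk_eq_zero R).2 (Submodule.mem_sup_right ⟨x, rfl⟩)
  obtain ⟨_, ⟨x, rfl⟩, _, ⟨y, rfl⟩, e⟩ := Submodule.mem_sup.1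
    ((Submodule.Quotient.mk_eq_zero R).1 (ConcreteCategory.congr_hom this p))
  exact ⟨x, y, e.symm⟩

/-- The abstract pushout maps to the concrete one, a quotient of `X × Y`, where the vanishing of a
class exhibits the element of `Z`. -/
lemma isPushout_exact {X Y Z P : ModuleCat.{u} k} {f : Z ⟶ X} {g : Z ⟶ Y} {inl : X ⟶ P}
    {inr : Y ⟶ P} (h : IsPushout f g inl inr) (x : X) (y : Y) (e : inl x + inr y = 0) :
    ∃ z, x = f z ∧ y = -g z := by
  let R : Submodule k (X × Y) := LinearMap.range (f.hom.prod (-g.hom))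
  let Q : ModuleCat.{u} k := ModuleCat.of k ((X × Y) ⧸ R)
  let a : X ⟶ Q := ModuleCat.ofHom (R.mkQ ∘ₗ LinearMap.inl k X Y)
  let b : Y ⟶ Q := ModuleCat.ofHom (R.mkQ ∘ₗ LinearMap.inr k X Y)
  have w : f ≫ a = g ≫ b := by
    ext z
    exact (Submodule.Quotient.eq R).2
      ⟨z, Prod.ext (sub_zero (f z)).symm (zero_sub (g z)).symm⟩
  have ha := ConcreteCategory.congr_hom (h.inl_desc a b w) x
  have hb := ConcreteCategory.congr_hom (h.inr_desc a b w) y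
  have e' : a x + b y = 0 := by
    rw [← ha, ← hb, ConcreteCategory.comp_apply, ConcreteCategory.comp_apply, ← map_add, e,
      map_zero]
  have e'' : (Submodule.Quotient.mk (x, y) : (X × Y) ⧸ R) = 0 := by
    rw [← e']
    exact congrArg R.mkQ (by simp : (x, y) = (x, 0) + (0, y))
  obtain ⟨z, hz⟩ := (Submodule.Quotient.mk_eq_zero R).1 e''
  exact ⟨z, (congrArg Prod.fst hz).symm, (congrArg Prod.snd hz).symm⟩

variable {A A' B B' : Bicomplex k} {f : A ⟶ A'} {u : A ⟶ B} {g : B ⟶ B'} {v : A' ⟶ B'}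

lemma tot_isPushout_exists_rep (h : IsPushout u f g v) (x : Tot B') :
    ∃ b a, x = totMap g b + totMap v a := by
  choose b a hba using fun i => isPushout_exists_rep (h.map (ev i)) (x i)
  exact ⟨b, a, funext hba⟩

lemma tot_isPushout_exact (h : IsPushout u f g v) {b : Tot B} {a : Tot A'}
    (e : totMap g b + totMap v a = 0) : ∃ z, b = totMap u z ∧ a = -totMap f z := by
  choose z hz hz' using fun i => isPushout_exact (h.map (ev i)) (b i) (a i) (congrFun e i)
  exact ⟨z, funext hz, funext hz'⟩

/-- Cobase change keeps the cokernel. Elements of the pushout are split as a sum from the two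
corners, and relations between the parts come from `A`, where the properties of `f` apply. -/
lemma IsAcyclicEmbedding.of_isPushout (sq : IsPushout u f g v) (h : IsAcyclicEmbedding f) :
    IsAcyclicEmbedding g := by
  have hw (z : Tot A) : totMap g (totMap u z) = totMap v (totMap f z) := by
    rw [← totMap_comp, ← totMap_comp, sq.w]
  refine ⟨?_, fun b x hx => ?_, fun y y' b hy hb => ?_⟩
  · rw [injective_iff_map_eq_zero]
    intro b hb
    obtain ⟨z, rfl, hz⟩ := tot_isPushout_exact sq (b := b) (a := 0) (by rw [hb, map_zero, add_zero])
    rw [h.eq_zero (neg_eq_zero.1 hz.symm), map_zero]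
  · obtain ⟨b₀, a₀, rfl⟩ := tot_isPushout_exists_rep sq x
    obtain ⟨z, hz, hz'⟩ := tot_isPushout_exact sq (b := Dv B b₀ - b) (a := Dv A' a₀) (by
      rw [map_add] at hx
      rw [map_sub, totMap_Dv, totMap_Dv, ← hx]
      abel)
    obtain ⟨z', rfl⟩ := h.exists_Dv z (-a₀) (by rw [map_neg, hz', neg_neg])
    exact ⟨b₀ - totMap u z', by rw [map_sub, ← totMap_Dv, ← hz]; abel⟩
  · obtain ⟨b₀, a₀, rfl⟩ := tot_isPushout_exists_rep sq y
    obtain ⟨b₀', a₀', rfl⟩ := tot_isPushout_exists_rep sq y'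
    obtain ⟨z, hz, hz'⟩ := tot_isPushout_exact sq (b := Dv B b₀) (a := Dv A' a₀) (by
      rw [totMap_Dv, totMap_Dv, ← map_add, hy])
    obtain ⟨z', rfl⟩ := h.exists_Dv z (-a₀) (by rw [map_neg, hz', neg_neg])
    -- The splitting of `y` is only unique up to `A`. Moving `z'` from one part to the other makes
    -- both parts vertical cycles, as `exists_eq` for `f` requires.
    obtain ⟨a, ha, rfl⟩ : ∃ a, Dv A' a = 0 ∧ a₀ = a - totMap f z' :=
      ⟨a₀ + totMap f z', by rw [map_add, hz', totMap_Dv]; abel, by abel⟩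
    obtain ⟨c, hc, rfl⟩ : ∃ c, Dv B c = 0 ∧ b₀ = c + totMap u z' :=
      ⟨b₀ - totMap u z', by rw [map_sub, hz, totMap_Dv]; abel, by abel⟩
    have e : totMap g (c + totMap u z') + totMap v (a - totMap f z') =
        totMap g c + totMap v a := by
      rw [map_add, map_sub, hw]; abel
    rw [e] at hb ⊢
    obtain ⟨z, hz, hz'⟩ := tot_isPushout_exact sq (b := Dh B c - Dv B b₀' - b)
      (a := Dh A' a - Dv A' a₀') (by
        simp only [map_add, map_sub, totMap_Dh, totMap_Dv] at hb ⊢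
        rw [eq_sub_of_add_eq hb]; abel)
    obtain ⟨x₁, x₂, x₃, hx₁, rfl⟩ := h.exists_eq a a₀' (-z) ha (by
      rw [map_neg, ← hz']; abel)
    refine ⟨totMap v x₁, totMap v x₂, c + totMap u x₃, by rw [← totMap_Dv, hx₁, map_zero], ?_⟩
    simp only [map_add, totMap_Dh, totMap_Dv, hw]
    abel

instance : (acyclicEmbeddings k).IsStableUnderCobaseChange where
  of_isPushout sq h := h.of_isPushout sq

end Pushout

end Bicomplex

end

/-! ### Acyclic embeddings: filtered colimits and coproducts -/

noncomputable section

namespace Bicomplex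

variable {k : Type u} [CommRing k]

section Filtered

variable {J : Type u} [Category.{u} J] {F : J ⥤ Bicomplex k} {s : Cocone F}

lemma totMap_w (s : Cocone F) {a b : J} (f : a ⟶ b) (x : Tot (F.obj a)) :
    totMap (s.ι.app b) (totMap (F.map f) x) = totMap (s.ι.app a) x := by
  rw [← totMap_comp, s.w]

lemma totMap_naturality {F' : J ⥤ Bicomplex k} (α : F ⟶ F') {a b : J} (f : a ⟶ b)
    (x : Tot (F.obj a)) :
    totMap (F'.map f) (totMap (α.app a) x) = totMap (α.app b) (totMap (F.map f) x) := by
  rw [← totMap_comp, ← totMap_comp, α.naturality]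

variable [IsFiltered J]

/-- Homogeneity is essential: an element of the infinite product need not come from a single stage
of the colimit. This is why `IsAcyclicEmbedding.of_homog` is used for colimits. -/
lemma exists_rep_of_homog (hs : IsColimit s) {i : ℕ × ℤ} {x : Tot s.pt} (hx : Homog i x) :
    ∃ (a : J) (y : Tot (F.obj a)), Homog i y ∧ totMap (s.ι.app a) y = x := by
  obtain ⟨a, y, hy⟩ : ∃ (a : J) (y : (F.obj a).X i), (s.ι.app a).f i y = x i :=
    Concrete.isColimit_exists_rep (F ⋙ ev i)
      (isColimitOfPreserves (ev i) hs) (x i)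
  refine ⟨a, single i y, homog_single _ _, ?_⟩
  rw [totMap_single, hx.eq_single]
  exact congrArg _ hy

lemma exists_map_eq_zero_of_homog (hs : IsColimit s) {i : ℕ × ℤ} {a : J} {x : Tot (F.obj a)}
    (hx : Homog i x) (h : totMap (s.ι.app a) x = 0) :
    ∃ (b : J) (f : a ⟶ b), totMap (F.map f) x = 0 := by
  obtain ⟨b, f, g, hfg⟩ := Concrete.isColimit_exists_of_rep_eq (F ⋙ ev i)
    (isColimitOfPreserves (ev i) hs) (x i) (0 : (F.obj a).X i)
    ((congrFun h i).trans (map_zero _).symm)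
  refine ⟨b, f, ?_⟩
  rw [hx.eq_single, totMap_single, ← single_zero (A := F.obj b) i]
  congr 1
  exact hfg.trans (map_zero _)

/-- Elements with the same image in a filtered colimit become equal. -/
lemma exists_map_eq_of_homog (hs : IsColimit s) {i : ℕ × ℤ} {a : J} {x y : Tot (F.obj a)}
    (hx : Homog i x) (hy : Homog i y) (h : totMap (s.ι.app a) x = totMap (s.ι.app a) y) :
    ∃ (b : J) (f : a ⟶ b), totMap (F.map f) x = totMap (F.map f) y := by
  obtain ⟨b, f, hf⟩ := exists_map_eq_zero_of_homog hs (hx.sub hy)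
    (by rw [map_sub, h, sub_self])
  exact ⟨b, f, by rwa [map_sub, sub_eq_zero] at hf⟩

/-- Each defining condition involves finitely many homogeneous elements and equations. These already
hold at some stage, where the hypothesis on `α` gives the answer. -/
lemma isAcyclicEmbedding_of_isColimit {F' : J ⥤ Bicomplex k} {s' : Cocone F'} (hs : IsColimit s)
    (hs' : IsColimit s') (α : F ⟶ F') (hα : ∀ a, IsAcyclicEmbedding (α.app a)) (φ : s.pt ⟶ s'.pt)
    (hφ : ∀ a, s.ι.app a ≫ φ = α.app a ≫ s'.ι.app a) : IsAcyclicEmbedding φ := by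
  have hφ' (a : J) (x : Tot (F.obj a)) :
      totMap φ (totMap (s.ι.app a) x) = totMap (s'.ι.app a) (totMap (α.app a) x) := by
    rw [← totMap_comp, ← totMap_comp, hφ]
  refine IsAcyclicEmbedding.of_homog ?_ ?_ ?_
  · rw [injective_iff_map_eq_zero]
    intro x hx
    ext1 i
    obtain ⟨a, y, hy, e⟩ := exists_rep_of_homog hs (homog_pr i x)
    obtain ⟨b, f, hf⟩ := exists_map_eq_zero_of_homog hs' (hy.totMap (α.app a))
      (by rw [← hφ', e, totMap_pr, hx, pr_zero])
    rw [totMap_naturality] at hf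
    rw [← pr_apply_self i x, ← e, ← totMap_w s f, (hα b).eq_zero hf, map_zero]
  · intro l x y hx hy hxy
    obtain ⟨a₁, x, hx₁, rfl⟩ := exists_rep_of_homog hs hx
    obtain ⟨a₂, y, hy₁, rfl⟩ := exists_rep_of_homog hs' hy
    obtain ⟨b, f₁, f₂, -⟩ := IsFilteredOrEmpty.cocone_objs a₁ a₂
    have hx' := hx₁.totMap (F.map f₁)
    have hy' := hy₁.totMap (F'.map f₂)
    clear hx hy hx₁ hy₁
    rw [← totMap_w s f₁] at hxy ⊢
    rw [← totMap_w s' f₂] at hxy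
    generalize totMap (F.map f₁) x = x at *
    generalize totMap (F'.map f₂) y = y at *
    rw [hφ', ← totMap_Dv] at hxy
    obtain ⟨c, g, hg⟩ := exists_map_eq_of_homog hs' hy'.Dv (hx'.totMap _) hxy
    rw [totMap_Dv, totMap_naturality] at hg
    obtain ⟨x', hx'⟩ := (hα c).exists_Dv _ _ hg
    exact ⟨totMap (s.ι.app c) x', by rw [← totMap_Dv, hx', totMap_w]⟩
  · intro l y y' x hy hy' hx hvy hxy
    obtain ⟨a₁, y, hy₁, rfl⟩ := exists_rep_of_homog hs' hy
    obtain ⟨a₂, y', hy₁', rfl⟩ := exists_rep_of_homog hs' hy'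
    obtain ⟨a₃, x, hx₁, rfl⟩ := exists_rep_of_homog hs hx
    clear hx hy hy'
    obtain ⟨b, f₁, f₂, f₃, -⟩ : ∃ (b : J) (_ : a₁ ⟶ b) (_ : a₂ ⟶ b) (_ : a₃ ⟶ b), True :=
      ⟨IsFiltered.max₃ a₁ a₂ a₃, IsFiltered.firstToMax₃ _ _ _, IsFiltered.secondToMax₃ _ _ _,
        IsFiltered.thirdToMax₃ _ _ _, trivial⟩
    have hy := hy₁.totMap (F'.map f₁)
    have hy' := hy₁'.totMap (F'.map f₂)
    have hx := hx₁.totMap (F.map f₃)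
    clear hy₁ hy₁' hx₁
    rw [← totMap_w s' f₁] at hvy hxy ⊢
    rw [← totMap_w s' f₂, ← totMap_w s f₃] at hxy
    generalize totMap (F'.map f₁) y = y at *
    generalize totMap (F'.map f₂) y' = y' at *
    generalize totMap (F.map f₃) x = x at *
    rw [← totMap_Dv] at hvy
    obtain ⟨c, g, hg⟩ := exists_map_eq_zero_of_homog hs' hy.Dv hvy
    replace hy := hy.totMap (F'.map g)
    replace hy' := hy'.totMap (F'.map g)
    replace hx := hx.totMap (F.map g)
    rw [← totMap_w s' g y] at hxy ⊢
    rw [← totMap_w s' g y', ← totMap_w s g] at hxy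
    rw [totMap_Dv] at hg
    generalize totMap (F'.map g) y = y at *
    generalize totMap (F'.map g) y' = y' at *
    generalize totMap (F.map g) x = x at *
    rw [← totMap_Dh, ← totMap_Dv, hφ', ← map_add] at hxy
    -- Both sides of the equation must lie in one bidegree, `hn l`. This is why `of_homog` places
    -- the auxiliary element in `vp (hn l)`, which also makes sense in column 0.
    obtain ⟨d, g', hg'⟩ := exists_map_eq_of_homog hs' hy.Dh
      ((vn_vp (hn l) ▸ hy'.Dv).add (hx.totMap _)) hxy
    rw [totMap_Dh, map_add, totMap_Dv, totMap_naturality] at hg'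
    obtain ⟨b₁, b₂, x₁, hb₁, e⟩ := (hα d).exists_eq _ _ _ (by rw [← totMap_Dv, hg, map_zero]) hg'
    refine ⟨totMap (s'.ι.app d) b₁, totMap (s'.ι.app d) b₂, totMap (s.ι.app d) x₁,
      by rw [← totMap_Dv, hb₁, map_zero], ?_⟩
    rw [← totMap_w s' g', e, map_add, map_add, totMap_Dh, totMap_Dv, hφ']
    rfl

instance : MorphismProperty.IsStableUnderFilteredColimits.{u, u} (acyclicEmbeddings k) where
  isStableUnderColimitsOfShape _ _ _ :=
    { condition := fun _ _ _ _ h₁ h₂ f hf φ hφ =>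
        isAcyclicEmbedding_of_isColimit h₁ h₂ f hf φ hφ }

end Filtered

section Coproducts

instance : HasZeroMorphisms (Bicomplex k) where
  zero A B := ⟨{ f := fun _ => 0, comm_h := by simp, comm_v := by simp }⟩
  comp_zero f _ := by ext1 i; exact comp_zero
  zero_comp _ {_ _} f := by ext1 i; exact zero_comp

lemma totMap_zero {A B : Bicomplex k} (x : Tot A) : totMap (0 : A ⟶ B) x = 0 := rfl

lemma iSup_range_eq_top {J : Type*} [Category* J] {F : J ⥤ ModuleCat.{u} k} {s : Cocone F}
    (hs : IsColimit s) : ⨆ a, LinearMap.range (ModuleCat.Hom.hom (A := F.obj a) (B := s.pt) (s.ι.app a)) = ⊤ := by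
  rw [← Submodule.ker_mkQ (⨆ a, LinearMap.range (ModuleCat.Hom.hom (A := F.obj a) (B := s.pt) (s.ι.app a))), LinearMap.ker_eq_top]
  have : ModuleCat.ofHom (⨆ a, LinearMap.range (ModuleCat.Hom.hom (A := F.obj a) (B := s.pt) (s.ι.app a))).mkQ = 0 := by
    refine hs.hom_ext fun a => ?_
    ext x
    exact (Submodule.Quotient.mk_eq_zero _).2 (Submodule.mem_iSup_of_mem a ⟨x, rfl⟩)
  exact congrArg ModuleCat.Hom.hom this

variable {J : Type u} [DecidableEq J] (A : J → Bicomplex k)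

lemma coproduct_π_ι (x : J) (y : J) (z : Tot (A x)) :
    totMap (Sigma.π A y) (totMap (Sigma.ι A x) z) = if h : x = y then h ▸ z else 0 := by
  rw [← totMap_comp]
  split_ifs with h
  · subst h
    rw [Sigma.ι_π_eq_id, totMap_id]
  · rw [Sigma.ι_π_of_ne _ h, totMap_zero]

/-- The elements that are finite sums of their components form a submodule containing the images of
all inclusions, and these span the coproduct. -/
lemma coproduct_eq_sum {i : ℕ × ℤ} {x : Tot (∐ A)} (hx : Homog i x) :
    ∃ s : Finset J, x = ∑ a ∈ s, totMap (Sigma.ι A a) (totMap (Sigma.π A a) x) := by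
  -- Asking for the formula over every finite set containing `s` lets two elements share the union
  -- of their index sets, which gives closure under addition.
  let P : Submodule k ((∐ A).X i) :=
    { carrier := {z | ∃ s : Finset J, ∀ t, s ⊆ t →
        single i z = ∑ a ∈ t, totMap (Sigma.ι A a) (totMap (Sigma.π A a) (single i z))}
      zero_mem' := ⟨∅, fun t _ => by simp⟩
      add_mem' := by
        rintro y z ⟨s, hs⟩ ⟨s', hs'⟩
        refine ⟨s ∪ s', fun t ht => ?_⟩
        have e : single i (y + z) = single i y + single i z :=
          Pi.single_add (f := fun j => (∐ A).X j) i _ _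
        simp only [e, map_add, Finset.sum_add_distrib]
        rw [← hs t (Finset.union_subset_left ht), ← hs' t (Finset.union_subset_right ht)]
      smul_mem' := by
        rintro c y ⟨s, hs⟩
        refine ⟨s, fun t ht => ?_⟩
        have e : single i (c • y) = c • single i y :=
          Pi.single_smul (f := fun j => (∐ A).X j) i c y
        simp only [e, map_smul, ← Finset.smul_sum]
        rw [← hs t ht] }
  have hP : P = ⊤ := by
    rw [eq_top_iff]
    refine (iSup_range_eq_top
      (isColimitOfPreserves (ev i) (coproductIsCoproduct A))).ge.trans (iSup_le ?_)
    rintro ⟨a⟩ _ ⟨y, rfl⟩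
    refine ⟨{a}, fun t ht => ?_⟩
    have e : single (A := ∐ A) i ((Sigma.ι A a).f i y) = totMap (Sigma.ι A a) (single i y) :=
      (totMap_single _ _ _).symm
    change single i ((Sigma.ι A a).f i y) = ∑ b ∈ t, totMap (Sigma.ι A b)
      (totMap (Sigma.π A b) (single i ((Sigma.ι A a).f i y)))
    rw [e, Finset.sum_eq_single_of_mem a (ht (Finset.mem_singleton_self a))]
    · rw [coproduct_π_ι, dif_pos rfl]
    · intro b _ hb
      rw [coproduct_π_ι, dif_neg hb.symm, map_zero]
  obtain ⟨s, hs⟩ := hP.symm ▸ Submodule.mem_top (x := x i)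
  refine ⟨s, ?_⟩
  rw [hx.eq_single]
  exact hs s subset_rfl

/-- Project to a component, solve there, and reassemble. Only finitely many components of a
homogeneous element matter, so the reassembly is a finite sum. -/
lemma isAcyclicEmbedding_sigmaMap {A B : J → Bicomplex k} (f : ∀ a, A a ⟶ B a)
    (hf : ∀ a, IsAcyclicEmbedding (f a)) : IsAcyclicEmbedding (Limits.Sigma.map f) := by
  have hι (a : J) (x : Tot (A a)) : totMap (Limits.Sigma.map f) (totMap (Sigma.ι A a) x) =
      totMap (Sigma.ι B a) (totMap (f a) x) := by
    rw [← totMap_comp, ← totMap_comp, Sigma.ι_map]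
  have hπ (a : J) (x : Tot (∐ A)) : totMap (Sigma.π B a) (totMap (Limits.Sigma.map f) x) =
      totMap (f a) (totMap (Sigma.π A a) x) := by
    rw [← totMap_comp, ← totMap_comp]
    congr 2
    refine Sigma.hom_ext _ _ fun b => ?_
    rw [Sigma.ι_map_assoc]
    by_cases h : b = a
    · subst h
      rw [Sigma.ι_π_eq_id, Sigma.ι_π_eq_id_assoc, Category.comp_id]
    · rw [Sigma.ι_π_of_ne _ h, Sigma.ι_π_of_ne_assoc _ h, comp_zero, zero_comp]
  refine IsAcyclicEmbedding.of_homog ?_ ?_ ?_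
  · rw [injective_iff_map_eq_zero]
    intro x hx
    ext1 i
    obtain ⟨s, hs⟩ := coproduct_eq_sum A (homog_pr i x)
    have h (a : J) : totMap (Sigma.π A a) (pr i x) = 0 :=
      (hf a).eq_zero (by rw [← hπ, totMap_pr, hx, pr_zero, map_zero])
    rw [← pr_apply_self i x, hs, Finset.sum_eq_zero fun a _ => by rw [h, map_zero]]
  · intro l x y hx hy hxy
    obtain ⟨s, hs⟩ := coproduct_eq_sum A hx
    choose z hz using fun a => (hf a).exists_Dv (totMap (Sigma.π A a) x) (totMap (Sigma.π B a) y)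
      (by rw [← totMap_Dv, hxy, hπ])
    refine ⟨∑ a ∈ s, totMap (Sigma.ι A a) (z a), ?_⟩
    rw [map_sum, hs]
    exact Finset.sum_congr rfl fun a _ => by rw [← totMap_Dv, hz]
  · intro l y y' x hy _ _ hvy hxy
    obtain ⟨s, hs⟩ := coproduct_eq_sum B hy
    choose b₁ b₂ x₁ hb₁ e using fun a => (hf a).exists_eq (totMap (Sigma.π B a) y)
      (totMap (Sigma.π B a) y') (totMap (Sigma.π A a) x) (by rw [← totMap_Dv, hvy, map_zero])
      (by rw [← totMap_Dh, hxy, map_add, hπ, totMap_Dv])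
    refine ⟨∑ a ∈ s, totMap (Sigma.ι B a) (b₁ a), ∑ a ∈ s, totMap (Sigma.ι B a) (b₂ a),
      ∑ a ∈ s, totMap (Sigma.ι A a) (x₁ a), ?_, ?_⟩
    · rw [map_sum]
      exact Finset.sum_eq_zero fun a _ => by rw [← totMap_Dv, hb₁, map_zero]
    · rw [hs, map_sum, map_sum, map_sum, ← Finset.sum_add_distrib, ← Finset.sum_add_distrib]
      exact Finset.sum_congr rfl fun a _ => by
        rw [e, map_add, map_add, totMap_Dh, totMap_Dv, hι]

instance : MorphismProperty.IsStableUnderCoproducts.{u} (acyclicEmbeddings k) where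
  isStableUnderCoproductsOfShape J := MorphismProperty.IsStableUnderCoproductsOfShape.mk _ _
    fun _ _ _ _ f hf => by
      classical
      exact isAcyclicEmbedding_sigmaMap f hf

end Coproducts

end Bicomplex

end

/-! ### Contractions, and tensoring generating trivial cofibrations -/

noncomputable section

namespace Bicomplex

variable {k : Type u} [CommRing k]

open GradedObject.Monoidal

section Contractions

variable {A : Bicomplex k}

/-- A contraction of the vertical complexes. -/
structure VContraction (A : Bicomplex k) where
  h (i : ℕ × ℤ) : A.X i ⟶ A.X (vp i)
  comm (i : ℕ × ℤ) : h (vp i) ≫ A.dv (vp (vp i)) (vp i) + A.dv (vp i) i ≫ h i = 𝟙 _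

/-- A contraction of the horizontal complexes which anticommutes with vertical differentials. -/
structure HContraction (A : Bicomplex k) where
  h (i : ℕ × ℤ) : A.X i ⟶ A.X (hp i)
  comm (i : ℕ × ℤ) : h (hp i) ≫ A.dh (hp (hp i)) (hp i) + A.dh (hp i) i ≫ h i = 𝟙 _
  comm_zero (q : ℤ) : h (0, q) ≫ A.dh (1, q) (0, q) = 𝟙 _
  anticomm (i : ℕ × ℤ) : h (vp i) ≫ A.dv (hp (vp i)) (hp i) + A.dv (vp i) i ≫ h i = 0

lemma VContraction.exists_eq_Dv (V : VContraction A) (x : Tot A) (hx : Dv A x = 0) :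
    ∃ y, x = Dv A y := by
  obtain ⟨y, hy⟩ := exists_tot_vp (A := A) fun j => V.h j (x j)
  refine ⟨y, ?_⟩
  ext j
  rw [Dv_apply, hy]
  obtain ⟨j, rfl⟩ : ∃ i, vp i = j := ⟨vn j, vp_vn j⟩
  have h : A.dv (vp (vp j)) (vp j) (V.h (vp j) (x (vp j))) + V.h j (A.dv (vp j) j (x (vp j))) =
    x (vp j) := ConcreteCategory.congr_hom (V.comm j) (x (vp j))
  have h' : A.dv (vp j) j (x (vp j)) = 0 := congrFun hx j
  rw [h', map_zero, add_zero] at h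
  exact h.symm

/-- The contraction as an endomorphism of the total space. -/
def HContraction.op (H : HContraction A) (x : Tot A) : Tot A
  | (0, _) => 0
  | (p + 1, q) => H.h (p, q) (x (p, q))

lemma HContraction.Dh_op_add (H : HContraction A) (x : Tot A) :
    Dh A (H.op x) + H.op (Dh A x) = x := by
  ext ⟨_ | p, q⟩
  · exact (add_zero _).trans (ConcreteCategory.congr_hom (H.comm_zero q) (x (0, q)))
  · exact ConcreteCategory.congr_hom (H.comm (p, q)) (x (p + 1, q))

lemma HContraction.Dv_op_add (H : HContraction A) (x : Tot A) :
    Dv A (H.op x) + H.op (Dv A x) = 0 := by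
  ext ⟨_ | p, q⟩
  · exact (add_zero _).trans (map_zero (A.dv (vp (0, q)) (0, q)).hom)
  · exact ConcreteCategory.congr_hom (H.anticomm (p, q)) (x (p, q + 1))

/-- The homotopy formula gives x = Dh (h x) + h (Dh x). Anticommuting with `Dv` makes h x a vertical
cycle and turns h (Dv w) into the vertical boundary of -h w. -/
lemma HContraction.exists_eq (H : HContraction A) (x w : Tot A) (hx : Dv A x = 0)
    (h : Dh A x = Dv A w) : ∃ y z, Dv A y = 0 ∧ x = Dh A y + Dv A z := by
  have h₀ : H.op 0 = 0 := by
    ext ⟨_ | p, q⟩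
    · rfl
    · exact map_zero _
  refine ⟨H.op x, -H.op w, ?_, ?_⟩
  · have := H.Dv_op_add x
    rwa [hx, h₀, add_zero] at this
  · have := H.Dv_op_add w
    rw [map_neg, ← eq_neg_of_add_eq_zero_right this, ← h, H.Dh_op_add]

lemma add_eq_vp {i₁ i₂ i : ℕ × ℤ} (h : i₁ + i₂ = i) : vp i₁ + i₂ = vp i := by
  subst h
  ext
  · rfl
  · exact add_right_comm _ _ _

lemma add_eq_hp {i₁ i₂ i : ℕ × ℤ} (h : i₁ + i₂ = i) : hp i₁ + i₂ = hp i := by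
  subst h
  ext
  · exact Nat.add_right_comm _ _ _
  · rfl

lemma add_eq_hp' {i₁ i₂ i : ℕ × ℤ} (h : i₁ + i₂ = i) : i₁ + hp i₂ = hp i := by
  rw [add_comm] at h ⊢
  exact add_eq_hp h

lemma add_eq_vp' {i₁ i₂ i : ℕ × ℤ} (h : i₁ + i₂ = i) : i₁ + vp i₂ = vp i := by
  rw [add_comm] at h ⊢
  exact add_eq_vp h

lemma sgn_vp (i : ℕ × ℤ) : sgn (vp i) = -sgn i := sgn_v i.1 i.2

lemma sgn_hp (i : ℕ × ℤ) : sgn (hp i) = -sgn i := sgn_h i.1 i.2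

variable (Z : Bicomplex k)

/-- The extension of a family of maps of vertical degree one to the tensor product. -/
def vExtend (h : ∀ i, A.X i ⟶ A.X (vp i)) (i : ℕ × ℤ) : tensorX A Z i ⟶ tensorX A Z (vp i) :=
  tensorObjDesc fun i₁ i₂ e => h i₁ ▷ Z.X i₂ ≫ ι A Z (vp i₁) i₂ (vp i) (add_eq_vp e)

lemma ι_vExtend (h : ∀ i, A.X i ⟶ A.X (vp i)) (i₁ i₂ i : ℕ × ℤ) (e : i₁ + i₂ = i) :
    ι A Z i₁ i₂ i e ≫ vExtend Z h i = h i₁ ▷ Z.X i₂ ≫ ι A Z (vp i₁) i₂ (vp i) (add_eq_vp e) :=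
  ι_tensorObjDesc _ _ _ _

/-- The extension of a family of maps of horizontal degree one to the tensor product. -/
def hExtend (h : ∀ i, A.X i ⟶ A.X (hp i)) (i : ℕ × ℤ) : tensorX A Z i ⟶ tensorX A Z (hp i) :=
  tensorObjDesc fun i₁ i₂ e => h i₁ ▷ Z.X i₂ ≫ ι A Z (hp i₁) i₂ (hp i) (add_eq_hp e)

lemma ι_hExtend (h : ∀ i, A.X i ⟶ A.X (hp i)) (i₁ i₂ i : ℕ × ℤ) (e : i₁ + i₂ = i) :
    ι A Z i₁ i₂ i e ≫ hExtend Z h i = h i₁ ▷ Z.X i₂ ≫ ι A Z (hp i₁) i₂ (hp i) (add_eq_hp e) :=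
  ι_tensorObjDesc _ _ _ _

/-- The contraction of the tensor product is h ⊗ 1. As h has total degree one, the two terms with
the differential of `Z` carry opposite Koszul signs and cancel, leaving the identity for `A`. -/
lemma vExtend_comm (V : VContraction A) (i : ℕ × ℤ) :
    vExtend Z V.h (vp i) ≫ tensorDv A Z (vp (vp i)) (vp i) +
      tensorDv A Z (vp i) i ≫ vExtend Z V.h i = 𝟙 _ := by
  apply tensorObj_ext
  intro i₁ i₂ e
  change ι A Z _ _ _ e ≫ _ = ι A Z _ _ _ e ≫ _
  obtain ⟨i₁, rfl⟩ : ∃ a, vp a = i₁ := ⟨vn i₁, vp_vn i₁⟩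
  obtain ⟨i₂, rfl⟩ : ∃ a, vp a = i₂ := ⟨vn i₂, vp_vn i₂⟩
  have e₁ : i₁ + vp i₂ = i := by rw [← vn_vp i, ← e, add_eq_vp rfl, vn_vp]
  have e₂ : vp i₁ + i₂ = i := by rw [← vn_vp i, ← e, add_eq_vp' rfl, vn_vp]
  rw [Preadditive.comp_add, reassoc_of% (ι_vExtend Z V.h _ _ _ e),
    reassoc_of% (ι_tensorDv A Z _ _ _ i e), ι_tensorDv, Preadditive.comp_add,
    dv₁_eq A Z _ _ _ _ (vRel_vp (vp i₁)) e, dv₂_eq A Z _ _ _ _ (vRel_vp i₂) (add_eq_vp e₂),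
    dv₁_eq A Z _ _ _ _ (vRel_vp i₁) e₁, dv₂_eq A Z _ _ _ _ (vRel_vp i₂) e₂,
    Preadditive.add_comp, Category.assoc, Linear.units_smul_comp, Category.assoc, ι_vExtend,
    ι_vExtend, Linear.comp_units_smul, whisker_exchange_assoc, sgn_vp (vp i₁), Units.neg_smul,
    Category.comp_id]
  have := congrArg (fun f => f ▷ Z.X (vp i₂) ≫ ι A Z _ _ _ e) (V.comm i₁)
  simp only [MonoidalPreadditive.add_whiskerRight, comp_whiskerRight, id_whiskerRight,
    Category.id_comp, Preadditive.add_comp, Category.assoc] at this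
  refine Eq.trans ?_ this
  abel

/-- The vertical contraction of a tensor product. -/
def VContraction.tensor (V : VContraction A) : VContraction (A ⊗ Z) where
  h := vExtend Z V.h
  comm := vExtend_comm Z V

lemma hExtend_anticomm (H : HContraction A) (i : ℕ × ℤ) :
    hExtend Z H.h (vp i) ≫ tensorDv A Z (hp (vp i)) (hp i) +
      tensorDv A Z (vp i) i ≫ hExtend Z H.h i = 0 := by
  apply tensorObj_ext
  intro i₁ i₂ e
  change ι A Z _ _ _ e ≫ _ = ι A Z _ _ _ e ≫ _
  obtain ⟨i₁, rfl⟩ : ∃ a, vp a = i₁ := ⟨vn i₁, vp_vn i₁⟩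
  obtain ⟨i₂, rfl⟩ : ∃ a, vp a = i₂ := ⟨vn i₂, vp_vn i₂⟩
  have e₁ : i₁ + vp i₂ = i := by rw [← vn_vp i, ← e, add_eq_vp rfl, vn_vp]
  have e₂ : vp i₁ + i₂ = i := by rw [← vn_vp i, ← e, add_eq_vp' rfl, vn_vp]
  rw [Preadditive.comp_add, reassoc_of% (ι_hExtend Z H.h _ _ _ e),
    reassoc_of% (ι_tensorDv A Z _ _ _ i e), ι_tensorDv, Preadditive.comp_add,
    dv₁_eq A Z (hp (vp i₁)) _ (hp i₁) _ (vRel_vp (hp i₁)) (add_eq_hp e₁),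
    dv₂_eq A Z _ _ _ _ (vRel_vp i₂) (add_eq_hp e₂),
    dv₁_eq A Z _ _ _ _ (vRel_vp i₁) e₁, dv₂_eq A Z _ _ _ _ (vRel_vp i₂) e₂,
    Preadditive.add_comp, Category.assoc, Linear.units_smul_comp, Category.assoc, ι_hExtend,
    ι_hExtend, Linear.comp_units_smul, whisker_exchange_assoc, sgn_hp (vp i₁), Units.neg_smul,
    comp_zero]
  have := congrArg (fun f => f ▷ Z.X (vp i₂) ≫ ι A Z _ _ _ (add_eq_hp e₁)) (H.anticomm i₁)
  simp only [MonoidalPreadditive.add_whiskerRight, comp_whiskerRight,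
    MonoidalPreadditive.zero_whiskerRight, zero_comp, Preadditive.add_comp, Category.assoc] at this
  refine Eq.trans ?_ this
  abel

lemma hExtend_comm_zero (H : HContraction A) (q : ℤ) :
    hExtend Z H.h (0, q) ≫ tensorDh A Z (1, q) (0, q) = 𝟙 _ := by
  apply tensorObj_ext
  rintro ⟨p₁, q₁⟩ ⟨p₂, q₂⟩ e
  change ι A Z _ _ _ e ≫ _ = ι A Z _ _ _ e ≫ _
  obtain ⟨rfl, rfl⟩ : p₁ = 0 ∧ p₂ = 0 := by
    have := congrArg Prod.fst e
    simp only [Prod.fst_add] at this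
    omega
  rw [reassoc_of% (ι_hExtend Z H.h _ _ _ e), ι_tensorDh, Preadditive.comp_add, dh₂_zero,
    comp_zero, add_zero, dh₁_eq A Z _ _ _ _ (hRel_hp (0, q₁)) e, Category.comp_id]
  have := congrArg (fun f => f ▷ Z.X (0, q₂) ≫ ι A Z _ _ _ e) (H.comm_zero q₁)
  simpa using this

lemma hExtend_comm (H : HContraction A) (i : ℕ × ℤ) :
    hExtend Z H.h (hp i) ≫ tensorDh A Z (hp (hp i)) (hp i) +
      tensorDh A Z (hp i) i ≫ hExtend Z H.h i = 𝟙 _ := by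
  -- The terms involving the differential of `Z` cancel by the Koszul sign. Column 0 of `Z` is
  -- separate because no horizontal differential leaves it.
  have key (i₁ i₂ : ℕ × ℤ) (e : i₁ + i₂ = hp i) :
      H.h i₁ ▷ Z.X i₂ ≫ dh₂ A Z (hp i₁) i₂ (hp i) + dh₂ A Z i₁ i₂ i ≫ hExtend Z H.h i = 0 := by
    obtain ⟨_ | p, q⟩ := i₂
    · rw [dh₂_zero, dh₂_zero, comp_zero, zero_comp, add_zero]
    · have e₂ : i₁ + (p, q) = i := by rw [← hn_hp i, ← e, ← hn_hp (i₁ + (p, q)), ← add_eq_hp' rfl]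
      rw [dh₂_eq A Z _ _ _ _ (hRel_hp (p, q)) (add_eq_hp e₂),
        dh₂_eq A Z _ _ _ _ (hRel_hp (p, q)) e₂, Linear.units_smul_comp, Category.assoc, ι_hExtend,
        Linear.comp_units_smul, whisker_exchange_assoc, sgn_hp, Units.neg_smul, neg_add_cancel]
  apply tensorObj_ext
  intro i₁ i₂ e
  change ι A Z _ _ _ e ≫ _ = ι A Z _ _ _ e ≫ _
  rw [Preadditive.comp_add, reassoc_of% (ι_hExtend Z H.h _ _ _ e),
    reassoc_of% (ι_tensorDh A Z _ _ _ i e), ι_tensorDh, Preadditive.comp_add, Preadditive.add_comp,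
    add_add_add_comm, key _ _ e, add_zero, dh₁_eq A Z _ _ _ _ (hRel_hp i₁) e, Category.comp_id]
  -- In column 0 of `A` the term in which the differential comes first is missing, and `comm_zero`
  -- supplies the identity.
  obtain ⟨_ | p, q⟩ := i₁
  · rw [dh₁_zero, zero_comp, add_zero]
    have := congrArg (fun f => f ▷ Z.X i₂ ≫ ι A Z _ _ _ e) (H.comm_zero q)
    simpa using this
  · have e₁ : (p, q) + i₂ = i := by rw [← hn_hp i, ← e, ← hn_hp ((p, q) + i₂), ← add_eq_hp rfl]
    rw [dh₁_eq A Z _ _ _ _ (hRel_hp (p, q)) e₁, Category.assoc, ι_hExtend]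
    have := congrArg (fun f => f ▷ Z.X i₂ ≫ ι A Z _ _ _ e) (H.comm (p, q))
    simpa using this

/-- The horizontal contraction of a tensor product. -/
def HContraction.tensor (H : HContraction A) : HContraction (A ⊗ Z) where
  h := hExtend Z H.h
  comm := hExtend_comm Z H
  comm_zero := hExtend_comm_zero Z H
  anticomm := hExtend_anticomm Z H

end Contractions

namespace DiscPart

variable {n : ℕ} {q : ℤ}

lemma columnSign_mul_self (i : ℕ × ℤ) : (columnSign n i * columnSign n i : k) = 1 := by
  unfold columnSign
  split_ifs <;> simp

open scoped Classical in
/-- A union of columns of a disc is vertically contractible. -/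
def vContraction (S : DiscPart n q) (hS : ∀ i, vp i ∈ S.carrier →
    (i ∈ S.carrier ↔ vp (vp i) ∉ S.carrier)) : VContraction (S.toBicomplex k) where
  -- Within a column the vertical differential is multiplication by a sign that squares to 1, so
  -- multiplying by the same sign inverts it. The hypothesis `hS` says that exactly one vertical
  -- neighbour of each corner is present.
  h i := ModuleCat.ofHom (cellMap S.carrier i (vp i) (columnSign n i))
  comm i := by
    ext x
    refine Subtype.ext ?_
    simp only [toBicomplex, if_pos (vRel_vp _)]
    change (if vp i ∈ S.carrier then columnSign n i *
        (if vp (vp i) ∈ S.carrier then columnSign n i * x.1 else 0) else 0) +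
      (if vp i ∈ S.carrier then columnSign n i *
        (if i ∈ S.carrier then columnSign n i * x.1 else 0) else 0) = x.1
    by_cases hi : vp i ∈ S.carrier
    · have := hS i hi
      by_cases hi' : i ∈ S.carrier
      · rw [if_pos hi, if_pos hi, if_pos hi', if_neg (this.1 hi'), mul_zero, zero_add, ← mul_assoc,
          columnSign_mul_self, one_mul]
      · rw [if_pos hi, if_pos hi, if_neg hi', if_pos (by_contra fun h => hi' (this.2 h)), mul_zero,
          add_zero, ← mul_assoc, columnSign_mul_self, one_mul]
    · rw [if_neg hi, if_neg hi, add_zero]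
      exact (x.2 hi).symm

lemma mem_verticalBoundary_iff (i : ℕ × ℤ) :
    i ∈ (verticalBoundary n q).carrier ↔ (i.1 = n ∨ i.1 = n + 1) ∧ i.2 = q - 1 := by
  simp only [verticalBoundary, Set.mem_insert_iff, Set.mem_singleton_iff, Prod.ext_iff]
  tauto

lemma mem_horizontalBoundary_iff (i : ℕ × ℤ) :
    i ∈ (horizontalBoundary n q).carrier ↔ i.1 = n ∧ (i.2 = q ∨ i.2 = q - 1) := by
  simp only [horizontalBoundary, Set.mem_insert_iff, Set.mem_singleton_iff, Prod.ext_iff]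
  tauto

lemma mem_disc_iff (i : ℕ × ℤ) :
    i ∈ (disc n q).carrier ↔ (i.1 = n ∨ i.1 = n + 1) ∧ (i.2 = q ∨ i.2 = q - 1) := Iff.rfl

open scoped Classical in
/-- The horizontal contraction of a row of a disc. -/
def hContractionVerticalBoundary (n : ℕ) (q : ℤ) :
    HContraction ((verticalBoundary n q).toBicomplex k) where
  h i := ModuleCat.ofHom (cellMap (verticalBoundary n q).carrier i (hp i) 1)
  comm i := by
    ext x
    refine Subtype.ext ?_
    simp only [toBicomplex, if_pos (hRel_hp _)]
    change (if hp i ∈ (verticalBoundary n q).carrier then 1 *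
        (if hp (hp i) ∈ (verticalBoundary n q).carrier then 1 * x.1 else 0) else 0) +
      (if hp i ∈ (verticalBoundary n q).carrier then 1 *
        (if i ∈ (verticalBoundary n q).carrier then 1 * x.1 else 0) else 0) = x.1
    by_cases hi : hp i ∈ (verticalBoundary n q).carrier
    · by_cases hi' : i ∈ (verticalBoundary n q).carrier
      · rw [if_pos hi, if_pos hi, if_pos hi', if_neg, mul_zero, zero_add, one_mul, one_mul]
        simp only [mem_verticalBoundary_iff] at *
        omega
      · rw [if_pos hi, if_pos hi, if_neg hi', if_pos, mul_zero, add_zero, one_mul, one_mul]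
        simp only [mem_verticalBoundary_iff] at *
        omega
    · rw [if_neg hi, if_neg hi, add_zero]
      exact (x.2 hi).symm
  comm_zero r := by
    ext x
    refine Subtype.ext ?_
    simp only [toBicomplex, if_pos (hRel_hp (0, r))]
    change (if (0, r) ∈ (verticalBoundary n q).carrier then 1 *
        (if hp (0, r) ∈ (verticalBoundary n q).carrier then 1 * x.1 else 0) else 0) = x.1
    by_cases hi : (0, r) ∈ (verticalBoundary n q).carrier
    · rw [if_pos hi, if_pos, one_mul, one_mul]
      simp only [mem_verticalBoundary_iff] at *
      omega
    · rw [if_neg hi]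
      exact (x.2 hi).symm
  anticomm i := by
    ext x
    refine Subtype.ext ?_
    simp only [toBicomplex, if_pos (vRel_vp _), if_pos (vRel_vp (hp i))]
    change (if hp i ∈ (verticalBoundary n q).carrier then columnSign n (hp i) *
        (if hp (vp i) ∈ (verticalBoundary n q).carrier then 1 * x.1 else 0) else 0) +
      (if hp i ∈ (verticalBoundary n q).carrier then 1 *
        (if i ∈ (verticalBoundary n q).carrier then columnSign n i * x.1 else 0) else 0) = 0
    -- The vertical boundary occupies a single row, so `vp i` and `hp i` are never both corners and
    -- every term vanishes.
    by_cases hi : vp i ∈ (verticalBoundary n q).carrier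
    · have : hp i ∉ (verticalBoundary n q).carrier := by
        simp only [mem_verticalBoundary_iff] at *
        omega
      rw [if_neg this, if_neg this, add_zero]
    · have : x.1 = 0 := x.2 hi
      simp [this]

def vContractionDisc (n : ℕ) (q : ℤ) : VContraction ((disc n q).toBicomplex k) :=
  (disc n q).vContraction fun i hi => by
    simp only [mem_disc_iff] at *
    omega

def vContractionHorizontalBoundary (n : ℕ) (q : ℤ) :
    VContraction ((horizontalBoundary n q).toBicomplex k) :=
  (horizontalBoundary n q).vContraction fun i hi => by
    simp only [mem_horizontalBoundary_iff] at *
    omega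

open scoped Classical in
/-- The inclusion of parts of discs has a retraction in each bidegree. -/
lemma exists_retraction {S T : DiscPart n q} (h : S.carrier ⊆ T.carrier) :
    ∃ r : toGraded.obj (T.toBicomplex k) ⟶ toGraded.obj (S.toBicomplex k), toGraded.map (incl k h) ≫ r = 𝟙 _ := by
  let r (i : ℕ × ℤ) : cellModule k T.carrier i →ₗ[k] cellModule k S.carrier i :=
    { toFun := fun x => ⟨if i ∈ S.carrier then x.1 else 0, fun hi => if_neg hi⟩
      map_add' := fun x y => by
        ext
        by_cases hi : i ∈ S.carrier <;> simp [hi]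
      map_smul' := fun c x => by
        ext
        by_cases hi : i ∈ S.carrier <;> simp [hi] }
  refine ⟨fun i => ModuleCat.ofHom (r i), ?_⟩
  funext i
  ext x
  by_cases hi : i ∈ S.carrier
  · exact Subtype.ext (if_pos hi)
  · exact (X_eq_zero hi _).trans (X_eq_zero hi _).symm

end DiscPart

section Tensored

variable {A B : Bicomplex k}

/-- With both vertical homologies zero, every vertical cycle is a vertical boundary and only
injectivity has content. -/
lemma isAcyclicEmbedding_of_vContraction (φ : A ⟶ B) (hφ : Function.Injective (totMap φ))
    (V : VContraction A) (V' : VContraction B) : IsAcyclicEmbedding φ where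
  injective := hφ
  exists_Dv a b h := by
    have ha : Dv A a = 0 := hφ (by rw [totMap_Dv, ← h, Dv_Dv, map_zero])
    obtain ⟨a', rfl⟩ := V.exists_eq_Dv a ha
    exact ⟨a', rfl⟩
  exists_eq b _ _ hb _ := by
    obtain ⟨c, rfl⟩ := V'.exists_eq_Dv b hb
    exact ⟨0, c, 0, map_zero _, by rw [map_zero, map_zero, zero_add, add_zero]⟩

lemma tot_eq_zero_of_isZero (hA : IsZero A) (x : Tot A) : x = 0 := by
  have : totMap (𝟙 A) x = totMap (0 : A ⟶ A) x := by rw [hA.eq_of_src (𝟙 A) 0]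
  exact this

lemma isAcyclicEmbedding_of_hContraction (φ : A ⟶ B) (hA : IsZero A) (H : HContraction B) :
    IsAcyclicEmbedding φ where
  injective x y _ := by rw [tot_eq_zero_of_isZero hA x, tot_eq_zero_of_isZero hA y]
  exists_Dv a _ _ := ⟨0, by rw [tot_eq_zero_of_isZero hA a, map_zero]⟩
  exists_eq b b' a hb h := by
    rw [tot_eq_zero_of_isZero hA a, map_zero, add_zero] at h
    obtain ⟨y, z, hy, rfl⟩ := H.exists_eq b b' hb h
    exact ⟨y, z, 0, hy, by rw [map_zero, add_zero]⟩

lemma isZero_tensor (hA : IsZero A) (Z : Bicomplex k) : IsZero (A ⊗ Z) := by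
  rw [IsZero.iff_id_eq_zero] at hA ⊢
  rw [← id_whiskerRight, hA]
  refine tensor_hom_ext fun i₁ i₂ j hj => ?_
  rw [ι_whiskerRight]
  exact (congrArg (· ≫ ι A Z i₁ i₂ j hj) (MonoidalPreadditive.zero_whiskerRight)).trans
    (zero_comp.trans comp_zero.symm)

lemma gMod_whiskerRight_retraction {X Y : GMod k} (f : X ⟶ Y) (r : Y ⟶ X) (hr : f ≫ r = 𝟙 _)
    (Z : GMod k) : f ▷ Z ≫ r ▷ Z = 𝟙 _ := by
  rw [← comp_whiskerRight, hr, id_whiskerRight]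

/-- A splitting as graded modules, not compatible with the differentials, is enough and survives
tensoring with an arbitrary, possibly non-flat, `Z`. -/
lemma totMap_whiskerRight_injective (φ : A ⟶ B) (Z : Bicomplex k)
    (r : toGraded.obj B ⟶ toGraded.obj A) (hr : toGraded.map φ ≫ r = 𝟙 _) :
    Function.Injective (totMap (φ ▷ Z)) := by
  have h := gMod_whiskerRight_retraction (toGraded.map φ) r hr Z.X
  intro x y hxy
  ext1 i
  have h' (z : (A ⊗ Z).X i) := ConcreteCategory.congr_hom (congrFun h i) z
  exact (h' (x i)).symm.trans ((congrArg _ (congrFun hxy i)).trans (h' (y i)))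

open DiscPart

/-- Contractions pass to the tensor product with `Z`. A row of a disc contracts horizontally, so its
second page vanishes; whole discs and their columns contract vertically. -/
lemma isAcyclicEmbedding_whiskerRight {A B : Bicomplex k} (j : A ⟶ B)
    (hj : ceGeneratingTrivialCofibrations k j) (Z : Bicomplex k) :
    IsAcyclicEmbedding (j ▷ Z) := by
  rcases hj with (⟨⟨n, q⟩⟩ | ⟨⟨q⟩⟩) | ⟨⟨n, q⟩⟩
  · exact isAcyclicEmbedding_of_hContraction _ (isZero_tensor (isZero_zero n q) Z)
      ((hContractionVerticalBoundary n q).tensor Z)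
  · obtain ⟨r, hr⟩ := exists_retraction (k := k) (zero_subset (horizontalBoundary 0 q))
    exact isAcyclicEmbedding_of_vContraction _ (totMap_whiskerRight_injective _ Z r hr)
      (VContraction.tensor Z ((zero 0 q).vContraction fun i hi => hi.elim))
      ((vContractionHorizontalBoundary 0 q).tensor Z)
  · obtain ⟨r, hr⟩ := exists_retraction (k := k) (horizontalBoundary_subset n q)
    exact isAcyclicEmbedding_of_vContraction _ (totMap_whiskerRight_injective _ Z r hr)
      ((vContractionHorizontalBoundary n q).tensor Z) ((vContractionDisc n q).tensor Z)

end Tensored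

end Bicomplex

end

/-! ### The small object argument, and relative cell complexes are acyclic embeddings -/

noncomputable section

namespace Bicomplex

variable {k : Type u} [CommRing k]

section Small

variable {J : Type u} [Category.{u} J] [IsFiltered J] (F : J ⥤ Bicomplex k)

lemma preservesColimit_coyoneda_of_isZero {A : Bicomplex k} (hA : IsZero A) :
    PreservesColimit F (coyoneda.obj (Opposite.op A)) where
  preserves {s} _ := by
    refine ⟨Types.FilteredColimit.isColimitOf' _ _ (fun x => ?_) (fun a x y _ => ?_)⟩
    · exact ⟨IsFiltered.nonempty.some, hA.to_ _, hA.eq_of_src _ _⟩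
    · exact ⟨a, 𝟙 _, hA.eq_of_src _ _⟩

/-- A bicomplex generated by one homogeneous element `x` with the relation `d_h x = 0`, and
possibly `d_v x = 0`, is compact. -/
lemma preservesColimit_coyoneda {A : Bicomplex k} {i : ℕ × ℤ} {x : Tot A} (hx : Homog i x)
    (c : Prop) (hh : Dh A x = 0) (hv : c → Dv A x = 0)
    (hA : ∀ (E : Bicomplex k) (y : Tot E), Homog i y → Dh E y = 0 → (c → Dv E y = 0) →
      ∃ φ : A ⟶ E, totMap φ x = y)
    (hom_ext : ∀ (E : Bicomplex k) (φ ψ : A ⟶ E), totMap φ x = totMap ψ x → φ = ψ) :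
    PreservesColimit F (coyoneda.obj (Opposite.op A)) where
  preserves {s} hs := by
    refine ⟨Types.FilteredColimit.isColimitOf' _ _ (fun φ => ?_) (fun a φ ψ h => ?_)⟩
    · change A ⟶ s.pt at φ
      -- The image of the generator is represented at some stage, and each relation becomes true at
      -- a later one.
      obtain ⟨a, y, hy, e⟩ := exists_rep_of_homog hs (hx.totMap φ)
      obtain ⟨b, f, hf⟩ := exists_map_eq_zero_of_homog hs hy.Dh
        (by rw [totMap_Dh, e, ← totMap_Dh, hh, map_zero])
      obtain ⟨b', f', hf'⟩ : ∃ (b' : J) (f' : a ⟶ b'),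
          c → totMap (F.map f') (Dv _ y) = 0 := by
        by_cases hc : c
        · obtain ⟨b', f', hf'⟩ := exists_map_eq_zero_of_homog hs hy.Dv
            (by rw [totMap_Dv, e, ← totMap_Dv, hv hc, map_zero])
          exact ⟨b', f', fun _ => hf'⟩
        · exact ⟨a, 𝟙 a, fun h => (hc h).elim⟩
      obtain ⟨d, g, g', w⟩ := IsFilteredOrEmpty.cocone_objs b b'
      -- The two relations were reached along different maps out of `a`. Equalizing these makes both
      -- relations hold for one and the same element.
      obtain ⟨l, m, w⟩ := IsFilteredOrEmpty.cocone_maps (f ≫ g) (f' ≫ g')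
      obtain ⟨ψ, hψ⟩ := hA (F.obj l) (totMap (F.map ((f ≫ g) ≫ m)) y) (hy.totMap _)
        (by rw [← totMap_Dh, Category.assoc, F.map_comp, totMap_comp, hf, map_zero])
        (fun hc => by rw [← totMap_Dv, w, Category.assoc, F.map_comp, totMap_comp, hf' hc, map_zero])
      refine ⟨l, ψ, hom_ext _ _ _ ?_⟩
      change _ = totMap (ψ ≫ s.ι.app l) x
      rw [totMap_comp, hψ, totMap_w, e]
    · change A ⟶ F.obj a at φ ψ
      have h : φ ≫ s.ι.app a = ψ ≫ s.ι.app a := h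
      obtain ⟨b, f, hf⟩ := exists_map_eq_of_homog hs (hx.totMap φ) (hx.totMap ψ)
        (by rw [← totMap_comp, h, totMap_comp])
      exact ⟨b, f, hom_ext _ _ _ (by
        change totMap (φ ≫ F.map f) x = totMap (ψ ≫ F.map f) x
        rw [totMap_comp, hf, totMap_comp])⟩

open DiscPart

lemma preservesColimit_coyoneda_sphere (n : ℕ) (q : ℤ) :
    PreservesColimit F (coyoneda.obj (Opposite.op ((sphere n q).toBicomplex k))) := by
  have hx := homog_cell (k := k) (sphere n q) (n, q - 1)
  refine preservesColimit_coyoneda F hx True ?_ (fun _ => ?_)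
    (fun E y hy h h' => exists_sphere_hom y hy h (h' trivial)) (fun E φ ψ => sphere_hom_ext)
  · by_cases h : n = 0
    · subst h
      exact hx.Dh_eq_zero
    · rw [Dh_cell (by rfl) h, cell_of_notMem]
      simp [sphere, Prod.ext_iff]
      omega
  · rw [Dv_cell (by rfl), cell_of_notMem, smul_zero]
    simp [sphere, Prod.ext_iff]

lemma preservesColimit_coyoneda_horizontalBoundary (n : ℕ) (q : ℤ) :
    PreservesColimit F (coyoneda.obj (Opposite.op ((horizontalBoundary n q).toBicomplex k))) := by
  have hx := homog_cell (k := k) (horizontalBoundary n q) (n, q)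
  refine preservesColimit_coyoneda F hx False ?_ (fun h => h.elim)
    (fun E y hy h _ => exists_horizontalBoundary_hom y hy h)
    (fun E φ ψ => horizontalBoundary_hom_ext)
  by_cases h : n = 0
  · subst h
    exact hx.Dh_eq_zero
  · rw [Dh_cell (Or.inl rfl) h, cell_of_notMem]
    simp [horizontalBoundary, Prod.ext_iff]
    omega

lemma preservesColimit_coyoneda_of_ceGeneratingCofibrations {A B : Bicomplex k} {f : A ⟶ B}
    (hf : ceGeneratingCofibrations k f) : PreservesColimit F (coyoneda.obj (Opposite.op A)) := by
  rcases hf with ((⟨⟨q⟩⟩ | ⟨⟨n, q⟩⟩) | ⟨⟨q⟩⟩) | ⟨⟨n, q⟩⟩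
  · exact preservesColimit_coyoneda_of_isZero F (DiscPart.isZero_zero _ _)
  · exact preservesColimit_coyoneda_sphere F _ _
  · exact preservesColimit_coyoneda_of_isZero F (DiscPart.isZero_zero _ _)
  · exact preservesColimit_coyoneda_horizontalBoundary F _ _

lemma preservesColimit_coyoneda_of_ceGeneratingTrivialCofibrations {A B : Bicomplex k}
    {f : A ⟶ B} (hf : ceGeneratingTrivialCofibrations k f) :
    PreservesColimit F (coyoneda.obj (Opposite.op A)) := by
  rcases hf with (⟨⟨n, q⟩⟩ | ⟨⟨q⟩⟩) | ⟨⟨n, q⟩⟩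
  · exact preservesColimit_coyoneda_of_isZero F (DiscPart.isZero_zero _ _)
  · exact preservesColimit_coyoneda_of_isZero F (DiscPart.isZero_zero _ _)
  · exact preservesColimit_coyoneda_horizontalBoundary F _ _

end Small

instance (W W' : MorphismProperty (Bicomplex k))
    [MorphismProperty.IsSmall.{u} W] [MorphismProperty.IsSmall.{u} W'] :
    MorphismProperty.IsSmall.{u} (W ⊔ W') where
  small_toSet := inferInstanceAs (Small.{u} (W.toSet ∪ W'.toSet : Set _))

instance {ι : Type} [Countable ι] {A B : ι → Bicomplex k} (f : ∀ i, A i ⟶ B i) :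
    MorphismProperty.IsSmall.{u} (MorphismProperty.ofHoms f) := by
  have : Small.{u} ι := Countable.toSmall ι
  exact MorphismProperty.isSmall_ofHoms f

instance : MorphismProperty.IsSmall.{u} (ceGeneratingCofibrations k) := by
  unfold ceGeneratingCofibrations
  infer_instance

instance : MorphismProperty.IsSmall.{u} (ceGeneratingTrivialCofibrations k) := by
  unfold ceGeneratingTrivialCofibrations
  infer_instance

/-- Compact sources allow the smallest regular cardinal: countable iteration suffices. -/
lemma hasSmallObjectArgument (I : MorphismProperty (Bicomplex k))
    [MorphismProperty.IsSmall.{u} I]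
    (hI : ∀ (J : Type u) [Category.{u} J] [IsFiltered J] (F : J ⥤ Bicomplex k)
      {A B : Bicomplex k} (f : A ⟶ B), I f →
        PreservesColimit F (coyoneda.obj (Opposite.op A))) :
    MorphismProperty.HasSmallObjectArgument.{u} I := by
  have : Fact Cardinal.aleph0.{u}.IsRegular := ⟨Cardinal.isRegular_aleph0⟩
  let := WellFoundedLT.toOrderBot Cardinal.aleph0.{u}.ord.ToType
  exact ⟨Cardinal.aleph0.{u}, inferInstance, inferInstance,
    { preservesColimit := fun {A B X Y} i hi f hf => hI _ hf.F i hi }⟩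

instance : MorphismProperty.HasSmallObjectArgument.{u} (ceGeneratingCofibrations k) :=
  hasSmallObjectArgument _ fun _ _ _ F _ _ _ hf =>
    preservesColimit_coyoneda_of_ceGeneratingCofibrations F hf

instance : MorphismProperty.HasSmallObjectArgument.{u} (ceGeneratingTrivialCofibrations k) :=
  hasSmallObjectArgument _ fun _ _ _ F _ _ _ hf =>
    preservesColimit_coyoneda_of_ceGeneratingTrivialCofibrations F hf

section Acyclic

open MorphismProperty

lemma isStableUnderColimitsOfShape_inverseImage {C D : Type*} [Category* C] [Category* D]
    (F : C ⥤ D) (J : Type*) [Category* J] [PreservesColimitsOfShape J F]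
    (W : MorphismProperty D) [W.IsStableUnderColimitsOfShape J] :
    (W.inverseImage F).IsStableUnderColimitsOfShape J where
  condition X₁ X₂ c₁ c₂ h₁ h₂ f hf φ hφ :=
    IsStableUnderColimitsOfShape.condition (W := W) (X₁ ⋙ F) (X₂ ⋙ F) (F.mapCocone c₁)
      (F.mapCocone c₂) (isColimitOfPreserves F h₁) (isColimitOfPreserves F h₂)
      (Functor.whiskerRight f F) hf (F.map φ) fun j => by
        change F.map _ ≫ F.map _ = F.map _ ≫ F.map _
        rw [← F.map_comp, ← F.map_comp, hφ]

instance (Z : Bicomplex k) :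
    IsStableUnderFilteredColimits.{u, u} ((acyclicEmbeddings k).inverseImage (tensorRight Z)) where
  isStableUnderColimitsOfShape J _ _ := isStableUnderColimitsOfShape_inverseImage _ J _

instance (Z : Bicomplex k) :
    IsStableUnderCoproducts.{u} ((acyclicEmbeddings k).inverseImage (tensorRight Z)) where
  isStableUnderCoproductsOfShape _ := isStableUnderColimitsOfShape_inverseImage _ _ _

instance (Z : Bicomplex k) :
    IsStableUnderCobaseChange ((acyclicEmbeddings k).inverseImage (tensorRight Z)) where
  of_isPushout sq h := of_isPushout (P := acyclicEmbeddings k) (sq.map (tensorRight Z)) h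

instance (Z : Bicomplex k) :
    IsStableUnderRetracts ((acyclicEmbeddings k).inverseImage (tensorRight Z)) where
  of_retract r h := of_retract (P := acyclicEmbeddings k) (r.map (tensorRight Z)) h

instance (Z : Bicomplex k) :
    IsMultiplicative ((acyclicEmbeddings k).inverseImage (tensorRight Z)) where

/-- The maps in `(rlp J).llp` become acyclic embeddings after tensoring with any bicomplex. -/
lemma isAcyclicEmbedding_whiskerRight_of_llp {A B : Bicomplex k} {f : A ⟶ B}
    (hf : (ceGeneratingTrivialCofibrations k).rlp.llp f) (Z : Bicomplex k) :
    IsAcyclicEmbedding (f ▷ Z) := by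
  rw [llp_rlp_of_hasSmallObjectArgument] at hf
  -- By the small object argument the maps in question are retracts of transfinite compositions of
  -- pushouts of coproducts of generators. Since `tensorRight Z` preserves colimits, the inverse
  -- image is closed under each operation in turn.
  have h₁ : ceGeneratingTrivialCofibrations k ≤ (acyclicEmbeddings k).inverseImage (tensorRight Z) :=
    fun _ _ j hj => isAcyclicEmbedding_whiskerRight j hj Z
  have h₂ := coproducts_le_iff.{u}.2 h₁
  have h₃ := pushouts_le_iff.2 h₂
  have h₄ := transfiniteCompositions_le_iff.{u}.2 h₃
  exact retracts_le_iff.2 h₄ _ hf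

/-- The case of the tensor unit, up to the unit isomorphism. -/
lemma isAcyclicEmbedding_of_llp {A B : Bicomplex k} {f : A ⟶ B}
    (hf : (ceGeneratingTrivialCofibrations k).rlp.llp f) : IsAcyclicEmbedding f :=
  ((acyclicEmbeddings k).arrow_mk_iso_iff
    (Arrow.isoMk (ρ_ A) (ρ_ B) (MonoidalCategory.rightUnitor_naturality f).symm)).1
    (isAcyclicEmbedding_whiskerRight_of_llp hf (𝟙_ _))

end Acyclic

end Bicomplex

end

/-! ### The model structure and the monoid axiom -/

noncomputable section

namespace Bicomplex

variable {k : Type u} [CommRing k]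

open MorphismProperty

instance : (ceWeakEquivalences k).HasTwoOutOfThreeProperty where
  comp_mem f g hf hg i := by
    have := hf i
    have := hg i
    rw [Functor.map_comp]
    infer_instance
  of_postcomp f g hg hfg i := by
    have := hg i
    have := hfg i
    rw [Functor.map_comp] at this
    exact IsIso.of_isIso_comp_right _ ((E₂ i).map g)
  of_precomp f g hf hfg i := by
    have := hf i
    have := hfg i
    rw [Functor.map_comp] at this
    exact IsIso.of_isIso_comp_left ((E₂ i).map f) _

/-- One inclusion combines antitonicity of `llp` with acyclic embeddings being weak equivalences;
the other is the retract argument. -/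
lemma ceGeneratingTrivialCofibrations_rlp_llp :
    (ceGeneratingTrivialCofibrations k).rlp.llp = ceCofibrations k ⊓ ceWeakEquivalences k := by
  refine le_antisymm (le_inf ?_ fun _ _ _ hf => acyclicEmbeddings_le _ (isAcyclicEmbedding_of_llp hf))
    fun A B f hf => ?_
  · refine antitone_llp ?_
    rw [ceGeneratingCofibrations_rlp]
    exact inf_le_left
  -- Two-out-of-three makes the fibration in this factorization trivial. The cofibration then lifts
  -- against it and is a retract of the first factor.
  · let d := factorizationData (ceGeneratingTrivialCofibrations k).rlp.llp
      (ceGeneratingTrivialCofibrations k).rlp f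
    have hp : (ceGeneratingCofibrations k).rlp d.p := by
      rw [ceGeneratingCofibrations_rlp]
      refine ⟨d.hp, of_precomp (ceWeakEquivalences k) d.i _
        (acyclicEmbeddings_le _ (isAcyclicEmbedding_of_llp d.hi)) ?_⟩
      rw [d.fac]
      exact hf.2
    have := hf.1 _ hp
    exact of_retract (RetractArrow.ofLeftLiftingProperty d.fac) d.hi

section

local instance : CategoryWithCofibrations (Bicomplex k) := ⟨ceCofibrations k⟩
local instance : CategoryWithFibrations (Bicomplex k) := ⟨ceFibrations k⟩
local instance : CategoryWithWeakEquivalences (Bicomplex k) := ⟨ceWeakEquivalences k⟩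

lemma cofibrations_eq : cofibrations (Bicomplex k) = (ceGeneratingCofibrations k).rlp.llp := rfl

lemma trivialFibrations_eq :
    trivialFibrations (Bicomplex k) = (ceGeneratingCofibrations k).rlp :=
  ceGeneratingCofibrations_rlp.symm

lemma trivialCofibrations_eq :
    trivialCofibrations (Bicomplex k) = (ceGeneratingTrivialCofibrations k).rlp.llp :=
  ceGeneratingTrivialCofibrations_rlp_llp.symm

lemma isWeakFactorizationSystem_of_hasSmallObjectArgument (I : MorphismProperty (Bicomplex k))
    [HasSmallObjectArgument.{u} I] : IsWeakFactorizationSystem I.rlp.llp I.rlp :=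
  .mk' _ _ fun _ p hi hp => hi p hp

instance : (weakEquivalences (Bicomplex k)).HasTwoOutOfThreeProperty :=
  inferInstanceAs (ceWeakEquivalences k).HasTwoOutOfThreeProperty

instance : IsWeakFactorizationSystem (cofibrations (Bicomplex k))
    (trivialFibrations (Bicomplex k)) := by
  rw [cofibrations_eq, trivialFibrations_eq]
  exact isWeakFactorizationSystem_of_hasSmallObjectArgument _

instance : IsWeakFactorizationSystem (trivialCofibrations (Bicomplex k))
    (fibrations (Bicomplex k)) := by
  rw [trivialCofibrations_eq]
  exact isWeakFactorizationSystem_of_hasSmallObjectArgument _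

variable (k) in
/-- The Cartan–Eilenberg model structure on bicomplexes. -/
@[reducible]
def ceModelCategory : ModelCategory (Bicomplex k) := ModelCategory.mk' _

end

section

attribute [local instance] ceModelCategory

lemma trivialCofibrations_ce :
    trivialCofibrations (Bicomplex k) = (ceGeneratingTrivialCofibrations k).rlp.llp :=
  ceGeneratingTrivialCofibrations_rlp_llp.symm

lemma isAcyclicEmbedding_whiskerRight_of_trivialCofibrations {A B : Bicomplex k} {f : A ⟶ B}
    (hf : trivialCofibrations (Bicomplex k) f) (Z : Bicomplex k) : IsAcyclicEmbedding (f ▷ Z) :=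
  isAcyclicEmbedding_whiskerRight_of_llp (trivialCofibrations_ce.le _ hf) Z

/-- Weak equivalences themselves are not known to be stable under pushouts, but the smaller class of
acyclic embeddings is, and it contains the tensored trivial cofibrations. -/
lemma monoidAxiom_ce : MonoidAxiom (Bicomplex k) := by
  refine le_trans ?_ (acyclicEmbeddings_le (k := k))
  rw [transfiniteCompositions_le_iff, pushouts_le_iff]
  rintro _ _ _ ⟨⟨_, ⟨f, hf⟩, Z⟩⟩
  exact isAcyclicEmbedding_whiskerRight_of_trivialCofibrations hf Z

end

end Bicomplex

end

/-! ### Elements of tensor products; maps out of tensor products of parts of discs -/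

noncomputable section

namespace Bicomplex

variable {k : Type u} [CommRing k] {A A' B B' E : Bicomplex k}

open GradedObject.Monoidal

open scoped TensorProduct

lemma units_smul_apply {M N : ModuleCat.{u} k} (s : ℤˣ) (f : M ⟶ N) (x : M) :
    (s • f) x = (s : ℤ) • f x := by
  obtain rfl | rfl := Int.units_eq_one_or s
  · simp
  · simp

/-- The element `a ⊗ b` of a tensor product, in bidegree `l`. -/
def tmulX {i j l : ℕ × ℤ} (h : i + j = l) (a : A.X i) (b : B.X j) : (A ⊗ B).X l :=
  ι A B i j l h (a ⊗ₜ[k] b)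

/-- The element `a ⊗ b` of a tensor product. -/
def tmul {i j : ℕ × ℤ} (a : A.X i) (b : B.X j) : Tot (A ⊗ B) := single (i + j) (tmulX rfl a b)

lemma single_tmulX {i j l : ℕ × ℤ} (h : i + j = l) (a : A.X i) (b : B.X j) :
    single l (tmulX h a b) = tmul a b := by
  subst h
  rfl

lemma homog_tmul {i j : ℕ × ℤ} (a : A.X i) (b : B.X j) : Homog (i + j) (tmul a b) :=
  homog_single _ _

lemma totMap_whiskerRight_tmul (φ : A ⟶ A') {i j : ℕ × ℤ} (a : A.X i) (b : B.X j) :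
    totMap (φ ▷ B) (tmul a b) = tmul (φ.f i a) b := by
  rw [tmul, totMap_single]
  exact congrArg _ (ConcreteCategory.congr_hom (ι_whiskerRight φ B i j (i + j) rfl) (a ⊗ₜ[k] b))

lemma totMap_whiskerLeft_tmul (φ : B ⟶ B') {i j : ℕ × ℤ} (a : A.X i) (b : B.X j) :
    totMap (A ◁ φ) (tmul a b) = tmul a (φ.f j b) := by
  rw [tmul, totMap_single]
  exact congrArg _ (ConcreteCategory.congr_hom (ι_whiskerLeft A φ i j (i + j) rfl) (a ⊗ₜ[k] b))

lemma tmulX_smul_left {i j l : ℕ × ℤ} (h : i + j = l) (c : k) (a : A.X i) (b : B.X j) :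
    tmulX h (c • a) b = c • tmulX h a b :=
  (congrArg _ (TensorProduct.smul_tmul' c a b).symm).trans (map_smul (ι A B i j l h).hom _ _)

lemma tmulX_smul_right {i j l : ℕ × ℤ} (h : i + j = l) (c : k) (a : A.X i) (b : B.X j) :
    tmulX h a (c • b) = c • tmulX h a b :=
  (congrArg _ (TensorProduct.tmul_smul c a b)).trans (map_smul (ι A B i j l h).hom _ _)

lemma single_smul {C : Bicomplex k} (i : ℕ × ℤ) (c : k) (x : C.X i) :
    single i (c • x) = c • single i x :=
  Pi.single_smul (f := fun j => C.X j) i c x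

lemma smul_tmul {i j : ℕ × ℤ} (c : k) (a : A.X i) (b : B.X j) : tmul (c • a) b = c • tmul a b := by
  rw [tmul, tmulX_smul_left, single_smul, tmul]

lemma tmul_smul {i j : ℕ × ℤ} (c : k) (a : A.X i) (b : B.X j) : tmul a (c • b) = c • tmul a b := by
  rw [tmul, tmulX_smul_right, single_smul, tmul]

lemma zero_tmul {i j : ℕ × ℤ} (b : B.X j) : tmul (0 : A.X i) b = 0 := by
  rw [← zero_smul k (0 : A.X i), smul_tmul, zero_smul]

lemma tmul_zero {i j : ℕ × ℤ} (a : A.X i) : tmul a (0 : B.X j) = 0 := by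
  rw [← zero_smul k (0 : B.X j), tmul_smul, zero_smul]

lemma single_add' {C : Bicomplex k} (i : ℕ × ℤ) (x y : C.X i) :
    single i (x + y) = single i x + single i y :=
  Pi.single_add (f := fun j => C.X j) i _ _

lemma single_zsmul {C : Bicomplex k} (i : ℕ × ℤ) (n : ℤ) (x : C.X i) :
    single i (n • x) = n • single i x :=
  Pi.single_smul (f := fun j => C.X j) i n x

lemma Dv_tmul {i j : ℕ × ℤ} (a : A.X i) (b : B.X j) :
    Dv (A ⊗ B) (tmul a b) =
      tmul (A.dv i (vn i) a) b + (sgn i : ℤ) • tmul a (B.dv j (vn j) b) := by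
  have e₁ : vn i + j = vn (i + j) := by
    rw [← vn_vp (vn i + j), ← add_eq_vp rfl, vp_vn]
  have e₂ : i + vn j = vn (i + j) := by
    rw [← vn_vp (i + vn j), ← add_eq_vp' rfl, vp_vn]
  have h := ι_tensorDv A B i j (i + j) (vn (i + j)) rfl
  rw [dv₁_eq A B _ _ _ _ (vRel_vn i) e₁, dv₂_eq A B _ _ _ _ (vRel_vn j) e₂] at h
  rw [tmul, Dv_single, ← single_tmulX e₁, ← single_tmulX e₂, ← single_zsmul, ← single_add']
  refine congrArg (single (A := A ⊗ B) (vn (i + j)))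
    ((ConcreteCategory.congr_hom h (a ⊗ₜ[k] b)).trans ?_)
  exact congrArg (fun z => ι A B (vn i) j (vn (i + j)) e₁ (A.dv i (vn i) a ⊗ₜ[k] b) + z)
    (units_smul_apply _ _ _)

/-- The case distinctions prepare the form used in `IsPairing`: in column 0 one has `hn i = i`, so
without them the formula for a pairing would involve its value at `(i, j)` itself. -/
lemma Dh_tmul {i j : ℕ × ℤ} (a : A.X i) (b : B.X j) :
    Dh (A ⊗ B) (tmul a b) = (if i.1 = 0 then 0 else tmul (A.dh i (hn i) a) b) +
      (sgn i : ℤ) • (if j.1 = 0 then 0 else tmul a (B.dh j (hn j) b)) := by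
  have h := ι_tensorDh A B i j (i + j) (hn (i + j)) rfl
  have h' : Dh (A ⊗ B) (tmul a b) = single (A := A ⊗ B) (hn (i + j))
      (dh₁ A B i j (hn (i + j)) (a ⊗ₜ[k] b)) + single (A := A ⊗ B) (hn (i + j))
      (dh₂ A B i j (hn (i + j)) (a ⊗ₜ[k] b)) := by
    rw [tmul, Dh_single]
    exact (congrArg (single (A := A ⊗ B) (hn (i + j)))
      (ConcreteCategory.congr_hom h (a ⊗ₜ[k] b))).trans (single_add' _ _ _)
  rw [h']
  congr 1
  · split_ifs with hi
    · obtain ⟨p, q⟩ := i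
      obtain rfl : p = 0 := hi
      rw [dh₁_zero]
      exact single_zero _
    · have e : hn i + j = hn (i + j) := by
        ext
        · simp; omega
        · simp
      rw [dh₁_eq A B _ _ _ _ (by rw [hShape_rel]; simp; omega) e, ← single_tmulX e]
      rfl
  · split_ifs with hj
    · obtain ⟨p, q⟩ := j
      obtain rfl : p = 0 := hj
      rw [dh₂_zero, smul_zero]
      exact single_zero _
    · have e : i + hn j = hn (i + j) := by
        ext
        · simp; omega
        · simp
      rw [dh₂_eq A B _ _ _ _ (by rw [hShape_rel]; simp; omega) e, ← single_tmulX e]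
      exact (congrArg _ (units_smul_apply _ _ _)).trans (single_zsmul _ _ _)

namespace DiscPart

variable {n n' : ℕ} {q q' : ℤ}

variable (k) in
/-- The tensor product of two cells. -/
def tcell (S : DiscPart n q) (S' : DiscPart n' q') (i j : ℕ × ℤ) :
    Tot (S.toBicomplex k ⊗ S'.toBicomplex k) :=
  tmul (S.gen k i) (S'.gen k j)

variable {S T : DiscPart n q} {S' T' : DiscPart n' q'}

/-- Families of elements which satisfy, for the pairs of bidegrees in `D`, the relations between
the tensor products of cells. -/
structure IsPairing (T : DiscPart n q) (T' : DiscPart n' q') (D : ℕ × ℤ → ℕ × ℤ → Prop)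
    (H : ℕ × ℤ → ℕ × ℤ → Tot E) : Prop where
  homog (i j : ℕ × ℤ) : Homog (i + j) (H i j)
  left {i : ℕ × ℤ} (hi : i ∉ T.carrier) (j : ℕ × ℤ) : H i j = 0
  right (i : ℕ × ℤ) {j : ℕ × ℤ} (hj : j ∉ T'.carrier) : H i j = 0
  dh {i j : ℕ × ℤ} (hi : i ∈ T.carrier) (hj : j ∈ T'.carrier) (hD : D i j) :
    Dh E (H i j) = (if i.1 = 0 then 0 else H (hn i) j) +
      (sgn i : ℤ) • (if j.1 = 0 then 0 else H i (hn j))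
  dv {i j : ℕ × ℤ} (hi : i ∈ T.carrier) (hj : j ∈ T'.carrier) (hD : D i j) :
    Dv E (H i j) = (columnSign n i : k) • H (vn i) j +
      (sgn i : ℤ) • (columnSign n' j : k) • H i (vn j)

lemma isPairing_tcell (T : DiscPart n q) (T' : DiscPart n' q') :
    IsPairing T T' (fun _ _ => True) (tcell k T T') where
  homog i j := homog_tmul _ _
  left hi j := by rw [tcell, gen_of_notMem hi, zero_tmul]
  right i j hj := by rw [tcell, gen_of_notMem hj, tmul_zero]
  dh {i j} hi hj _ := by
    rw [tcell, Dh_tmul]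
    refine congrArg₂ (fun x y => x + (sgn i : ℤ) • y) ?_ ?_
    · split_ifs with h
      · rfl
      · rw [dh_gen hi (by rw [hShape_rel]; simp; omega), tcell]
    · split_ifs with h
      · rfl
      · rw [dh_gen hj (by rw [hShape_rel]; simp; omega), tcell]
  dv {i j} hi hj _ := by
    rw [tcell, Dv_tmul, dv_gen hi (vRel_vn i), dv_gen hj (vRel_vn j), smul_tmul, tmul_smul]
    rfl

lemma IsPairing.map {D : ℕ × ℤ → ℕ × ℤ → Prop} {H : ℕ × ℤ → ℕ × ℤ → Tot E}
    (h : IsPairing T T' D H) {F : Bicomplex k} (φ : E ⟶ F) :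
    IsPairing T T' D (fun i j => totMap φ (H i j)) where
  homog i j := (h.homog i j).totMap φ
  left hi j := by rw [h.left hi, map_zero]
  right i j hj := by rw [h.right i hj, map_zero]
  dh hi hj hD := by
    rw [← totMap_Dh, h.dh hi hj hD, map_add, map_zsmul]
    congr 2
    · split_ifs <;> simp
    · split_ifs <;> simp
  dv hi hj hD := by
    rw [← totMap_Dv, h.dv hi hj hD, map_add, map_zsmul, map_smul, map_smul]

lemma totMap_whiskerRight_tcell (h : S.carrier ⊆ T.carrier) {i : ℕ × ℤ} (hi : i ∈ S.carrier)
    (j : ℕ × ℤ) : totMap (incl k h ▷ S'.toBicomplex k) (tcell k S S' i j) = tcell k T S' i j := by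
  rw [tcell, totMap_whiskerRight_tmul, incl_gen h hi, tcell]

lemma totMap_whiskerLeft_tcell (h : S'.carrier ⊆ T'.carrier) (i : ℕ × ℤ) {j : ℕ × ℤ}
    (hj : j ∈ S'.carrier) :
    totMap (S.toBicomplex k ◁ incl k h) (tcell k S S' i j) = tcell k S T' i j := by
  rw [tcell, totMap_whiskerLeft_tmul, incl_gen h hj, tcell]

lemma tmul_eq_smul {i j : ℕ × ℤ} (x : (T.toBicomplex k).X i) (y : (T'.toBicomplex k).X j) :
    (x ⊗ₜ[k] y : (T.toBicomplex k).X i ⊗[k] (T'.toBicomplex k).X j) =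
      ((x : cellModule k T.carrier i).1 * (y : cellModule k T'.carrier j).1) •
        (T.gen k i ⊗ₜ[k] T'.gen k j) := by
  conv_lhs => rw [eq_smul_gen x, eq_smul_gen y]
  rw [← TensorProduct.smul_tmul', TensorProduct.tmul_smul, smul_smul]

lemma summand_hom_ext {i j : ℕ × ℤ} {M : ModuleCat.{u} k}
    {f g : (T.toBicomplex k).X i ⊗ (T'.toBicomplex k).X j ⟶ M}
    (h : i ∈ T.carrier → j ∈ T'.carrier →
      f (T.gen k i ⊗ₜ[k] T'.gen k j) = g (T.gen k i ⊗ₜ[k] T'.gen k j)) : f = g := by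
  apply ModuleCat.hom_ext
  apply TensorProduct.ext'
  intro x y
  change f (x ⊗ₜ[k] y) = g (x ⊗ₜ[k] y)
  by_cases hi : i ∈ T.carrier
  · by_cases hj : j ∈ T'.carrier
    · rw [tmul_eq_smul, map_smul, map_smul, h hi hj]
    · rw [X_eq_zero hj y, TensorProduct.tmul_zero, map_zero, map_zero]
  · rw [X_eq_zero hi x, TensorProduct.zero_tmul, map_zero, map_zero]

lemma tensor_hom_ext_tcell {φ ψ : T.toBicomplex k ⊗ T'.toBicomplex k ⟶ E}
    (h : ∀ i ∈ T.carrier, ∀ j ∈ T'.carrier,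
      totMap φ (tcell k T T' i j) = totMap ψ (tcell k T T' i j)) : φ = ψ := by
  refine tensor_hom_ext fun i j l hl => summand_hom_ext fun hi hj => ?_
  subst hl
  have := congrFun (h i hi j hj) (i + j)
  rw [tcell, tmul, totMap_single, totMap_single, single_self, single_self] at this
  exact this

variable (k) in
/-- The multiplication `T_i × T'_j → k`. -/
def cellMul (T : DiscPart n q) (T' : DiscPart n' q') (i j : ℕ × ℤ) :
    cellModule k T.carrier i →ₗ[k] cellModule k T'.carrier j →ₗ[k] k :=
  (LinearMap.mul k k).compl₁₂ (cellModule k T.carrier i).subtype (cellModule k T'.carrier j).subtype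

/-- The linear map on a summand of `T ⊗ T'` with given value at the generator. -/
def summandDesc (T : DiscPart n q) (T' : DiscPart n' q') {i j : ℕ × ℤ} {M : ModuleCat.{u} k}
    (x : M) : (T.toBicomplex k).X i ⊗ (T'.toBicomplex k).X j ⟶ M :=
  ModuleCat.ofHom (X := (T.toBicomplex k).X i ⊗[k] (T'.toBicomplex k).X j)
    ((LinearMap.toSpanSingleton k M x).comp (TensorProduct.lift (cellMul k T T' i j)))

lemma summandDesc_gen {i j : ℕ × ℤ} {M : ModuleCat.{u} k} (x : M) (hi : i ∉ T.carrier → x = 0)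
    (hj : j ∉ T'.carrier → x = 0) :
    summandDesc T T' x (T.gen k i ⊗ₜ[k] T'.gen k j) = x := by
  change (T.coeff k i * T'.coeff k j) • x = x
  by_cases hi' : i ∈ T.carrier
  · by_cases hj' : j ∈ T'.carrier
    · rw [coeff_of_mem hi', coeff_of_mem hj', one_mul, one_smul]
    · rw [hj hj', smul_zero]
  · rw [hi hi', smul_zero]

/-- A morphism out of the tensor product of two parts of discs is given by the images of the
tensor products of cells. -/
lemma exists_tensor_hom (H : ℕ × ℤ → ℕ × ℤ → Tot E) (h : IsPairing T T' (fun _ _ => True) H) :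
    ∃ φ : T.toBicomplex k ⊗ T'.toBicomplex k ⟶ E, ∀ i j, totMap φ (tcell k T T' i j) = H i j := by
  let f (l : ℕ × ℤ) : tensorX (T.toBicomplex k) (T'.toBicomplex k) l ⟶ E.X l :=
    tensorObjDesc fun i j _ => summandDesc T T' (H i j l)
  have hf (i j l : ℕ × ℤ) (hl : i + j = l) :
      f l (tmulX hl (T.gen k i) (T'.gen k j)) = H i j l := by
    have e : ι (T.toBicomplex k) (T'.toBicomplex k) i j l hl ≫ f l = summandDesc T T' (H i j l) :=
      ι_tensorObjDesc _ i j hl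
    refine (ConcreteCategory.congr_hom e _).trans
      (summandDesc_gen _ (fun hi => ?_) (fun hj => ?_))
    · rw [h.left hi]; rfl
    · rw [h.right i hj]; rfl
  have hf' (i j l : ℕ × ℤ) : f l (tcell k T T' i j l) = H i j l := by
    by_cases hl : l = i + j
    · subst hl
      rw [tcell, tmul, single_self]
      exact hf _ _ _ rfl
    · rw [h.homog i j l hl, tcell, homog_tmul _ _ l hl]
      exact map_zero (f l).hom
  have hι (i j l : ℕ × ℤ) (hl : i + j = l) :
      single l (tmulX hl (T.gen k i) (T'.gen k j)) = tcell k T T' i j := single_tmulX hl _ _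
  have hz (i j l : ℕ × ℤ) (c : Prop) [Decidable c] :
      f l ((if c then 0 else tcell k T T' i j) l) = (if c then 0 else H i j) l := by
    split_ifs
    · exact map_zero (f l).hom
    · exact hf' i j l
  refine ⟨{
    f := f
    comm_h := fun l l' => ?_
    comm_v := fun l l' => ?_ }, fun i j => ?_⟩
  · by_cases hll : hShape.Rel l l'
    · apply tensorObj_ext
      intro i j hl
      refine summand_hom_ext fun hi hj => ?_
      change E.dh l l' (f l (tmulX hl (T.gen k i) (T'.gen k j))) =
        f l' ((T.toBicomplex k ⊗ T'.toBicomplex k).dh l l'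
          (tmulX hl (T.gen k i) (T'.gen k j)))
      have e := Dh_apply_of_rel _ (single l (tmulX hl (T.gen k i) (T'.gen k j))) hll
      rw [single_self, hι, (isPairing_tcell T T').dh hi hj trivial] at e
      rw [hf, ← Dh_apply_of_rel _ _ hll, h.dh hi hj trivial]
      refine Eq.trans ?_ (congrArg (f l') e)
      refine Eq.trans ?_ (map_add (f l').hom _ _).symm
      refine congrArg₂ (fun x y : E.X l' => x + y) (hz (hn i) j l' (i.1 = 0)).symm ?_
      exact (congrArg _ (hz i (hn j) l' (j.1 = 0))).symm.trans (map_zsmul (f l').hom _ _).symm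
    · rw [E.dh_shape _ _ hll, Bicomplex.dh_shape _ _ _ hll]
      exact comp_zero.trans zero_comp.symm
  · by_cases hll : vShape.Rel l l'
    · apply tensorObj_ext
      intro i j hl
      refine summand_hom_ext fun hi hj => ?_
      change E.dv l l' (f l (tmulX hl (T.gen k i) (T'.gen k j))) =
        f l' ((T.toBicomplex k ⊗ T'.toBicomplex k).dv l l'
          (tmulX hl (T.gen k i) (T'.gen k j)))
      have e := Dv_apply_of_rel _ (single l (tmulX hl (T.gen k i) (T'.gen k j))) hll
      rw [single_self, hι, (isPairing_tcell T T').dv hi hj trivial] at e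
      rw [hf, ← Dv_apply_of_rel _ _ hll, h.dv hi hj trivial]
      refine Eq.trans ?_ (congrArg (f l') e)
      refine Eq.trans ?_ (map_add (f l').hom _ _).symm
      refine congrArg₂ (fun x y : E.X l' => x + y) ?_ ?_
      · exact (congrArg _ (hf' _ _ _)).symm.trans (map_smul (f l').hom _ _).symm
      · refine Eq.trans ?_ (map_zsmul (f l').hom _ _).symm
        exact congrArg _ ((congrArg _ (hf' _ _ _)).symm.trans (map_smul (f l').hom _ _).symm)
    · rw [E.dv_shape _ _ hll, Bicomplex.dv_shape _ _ _ hll]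
      exact comp_zero.trans zero_comp.symm
  · ext l
    exact hf' i j l

end DiscPart

end Bicomplex

end

/-! ### Extending pairings and lifting against pushout-products -/

noncomputable section

namespace Bicomplex

namespace DiscPart

open scoped Classical

variable {k : Type u} [CommRing k] {X Y E : Bicomplex k} {p : X ⟶ Y}
  {n n' : ℕ} {q q' : ℤ} {S T : DiscPart n q} {S' T' : DiscPart n' q'}

lemma hn_mem_of_mem {i : ℕ × ℤ} (hi : i ∈ S.carrier) (h : i.1 ≠ 0)
    (h' : hn i ∈ T.carrier) : hn i ∈ S.carrier :=
  S.closed i hi _ (T.subset h') (Or.inl (by rw [hShape_rel]; simp; omega))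

lemma vn_mem_of_mem {i : ℕ × ℤ} (hi : i ∈ S.carrier)
    (h' : vn i ∈ T.carrier) : vn i ∈ S.carrier :=
  S.closed i hi _ (T.subset h') (Or.inr (vRel_vn i))

lemma mem_corners {i : ℕ × ℤ} (hi : i ∈ T.carrier) :
    (i.1 = n ∨ i.1 = n + 1) ∧ (i.2 = q ∨ i.2 = q - 1) := T.subset hi

lemma vn_vn_notMem {i : ℕ × ℤ} (hi : i ∈ T.carrier) : vn (vn i) ∉ T.carrier := fun h => by
  have := mem_corners hi
  have := mem_corners h
  simp only [vn] at *
  omega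

lemma hn_hn_notMem {i : ℕ × ℤ} (hi : i ∈ T.carrier) (h₂ : (hn i).1 ≠ 0) :
    hn (hn i) ∉ T.carrier := fun h => by
  have := mem_corners hi
  have := mem_corners h
  simp only [hn] at *
  omega

lemma vn_hn_notMem_of_hn_notMem {i : ℕ × ℤ} (hi : i ∈ T.carrier) (h₁ : i.1 ≠ 0)
    (h : hn i ∉ T.carrier) : vn (hn i) ∉ T.carrier := fun h' => by
  refine h (T.closed i hi _ ?_ (Or.inl (by rw [hShape_rel]; simp; omega)))
  have h₁ := mem_corners hi
  have h₂ := mem_corners h'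
  simp only [hn, vn] at *
  exact ⟨h₂.1, h₁.2⟩

lemma vn_hn_notMem_of_vn_notMem {i : ℕ × ℤ} (hi : i ∈ T.carrier)
    (h : vn i ∉ T.carrier) : vn (hn i) ∉ T.carrier := fun h' => by
  refine h (T.closed i hi _ ?_ (Or.inr (vRel_vn i)))
  have h₁ := mem_corners hi
  have h₂ := mem_corners h'
  simp only [vn] at *
  exact ⟨h₁.1, h₂.2⟩

lemma columnSign_hn {i : ℕ × ℤ} (hi : i ∈ T.carrier) (h : i.1 ≠ 0) (h' : hn i ∈ T.carrier) :
    (columnSign n (hn i) : k) = -columnSign n i := by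
  have h₁ := mem_corners hi
  have h₂ := mem_corners h'
  simp only at h₂
  have e₁ : i.1 ≠ n := by omega
  have e₂ : i.1 - 1 = n := by omega
  rw [columnSign, columnSign, if_neg e₁, if_pos e₂, neg_neg]

lemma columnSign_eq (i : ℕ × ℤ) : (columnSign n i : k) = 1 ∨ (columnSign n i : k) = -1 :=
  ite_eq_or_eq _ _ _

lemma sgn_eq (i : ℕ × ℤ) : (sgn i : ℤ) = 1 ∨ (sgn i : ℤ) = -1 := by
  obtain h | h := Int.units_eq_one_or (sgn i) <;> simp [h]

lemma sgn_hn {i : ℕ × ℤ} (h : i.1 ≠ 0) : (sgn (hn i) : ℤ) = -sgn i := by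
  obtain ⟨_ | m, r⟩ := i
  · exact (h rfl).elim
  · rw [sgn_h, Units.val_neg, neg_neg]; rfl

lemma sgn_vn (i : ℕ × ℤ) : (sgn (vn i) : ℤ) = -sgn i := by
  rw [← vp_vn i, sgn_vp, vn_vp, Units.val_neg, neg_neg]

lemma hn_add {i j : ℕ × ℤ} (h : i.1 ≠ 0) : hn i + j = hn (i + j) := by
  ext
  · simp; omega
  · simp

lemma add_hn {i j : ℕ × ℤ} (h : j.1 ≠ 0) : i + hn j = hn (i + j) := by
  ext
  · simp; omega
  · simp

lemma vn_add (i j : ℕ × ℤ) : vn i + j = vn (i + j) := by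
  ext <;> simp; ring

lemma add_vn (i j : ℕ × ℤ) : i + vn j = vn (i + j) := by
  ext <;> simp; ring

/-- The pairs of bidegrees of the cells of `S ⊗ T' ∪ T ⊗ S'`. -/
def Boundary (S : DiscPart n q) (S' : DiscPart n' q') (i j : ℕ × ℤ) : Prop :=
  i ∈ S.carrier ∨ j ∈ S'.carrier

/-- The prescribed horizontal differential of the value of a pairing at `(i, j)`. -/
def pairingDh (H : ℕ × ℤ → ℕ × ℤ → Tot E) (i j : ℕ × ℤ) : Tot E :=
  (if i.1 = 0 then 0 else H (hn i) j) + (sgn i : ℤ) • (if j.1 = 0 then 0 else H i (hn j))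

variable {D : ℕ × ℤ → ℕ × ℤ → Prop} {G : ℕ × ℤ → ℕ × ℤ → Tot X} {K : ℕ × ℤ → ℕ × ℤ → Tot Y}

lemma IsPairing.dh' (hG : IsPairing T T' D G) {i j : ℕ × ℤ} (hi : i ∈ T.carrier)
    (hj : j ∈ T'.carrier) (hD : D i j) : Dh X (G i j) = pairingDh G i j := hG.dh hi hj hD

lemma IsPairing.homog_pairingDh (hG : IsPairing T T' D G) (i j : ℕ × ℤ) :
    Homog (hn (i + j)) (pairingDh G i j) := by
  refine Homog.add ?_ (Homog.zsmul ?_ _)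
  · split_ifs with h
    · exact homog_zero _
    · rw [← hn_add h]
      exact hG.homog _ _
  · split_ifs with h
    · exact homog_zero _
    · rw [← add_hn h]
      exact hG.homog _ _

lemma pairingDh_congr {G H : ℕ × ℤ → ℕ × ℤ → Tot X} {i j : ℕ × ℤ}
    (h : i.1 ≠ 0 → H (hn i) j = G (hn i) j) (h' : j.1 ≠ 0 → H i (hn j) = G i (hn j)) :
    pairingDh H i j = pairingDh G i j := by
  rw [pairingDh, pairingDh]
  split_ifs with h₁ h₂ h₂
  · rfl
  · rw [h' h₂]
  · rw [h h₁]
  · rw [h h₁, h' h₂]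

lemma pairingDh_eq_zero (G : ℕ × ℤ → ℕ × ℤ → Tot X) {i j : ℕ × ℤ} (h : (i + j).1 = 0) :
    pairingDh G i j = 0 := by
  have h' : i.1 + j.1 = 0 := h
  rw [pairingDh, if_pos (by omega), if_pos (by omega), smul_zero, add_zero]

/-- The mixed terms cancel because the sign changes along `hn`, and terms with two steps in one
factor vanish because a disc is only two columns wide. All values used have a factor in `S` or `S'`,
so the cell `(i, j)` itself may be missing. -/
lemma IsPairing.Dh_pairingDh (hG : IsPairing T T' (Boundary S S') G) {i j : ℕ × ℤ}
    (hi : i ∈ T.carrier) (hj : j ∈ T'.carrier) (hi' : i.1 ≠ 0 → hn i ∈ S.carrier)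
    (hj' : j.1 ≠ 0 → hn j ∈ S'.carrier) (hST : S.carrier ⊆ T.carrier)
    (hST' : S'.carrier ⊆ T'.carrier) : Dh X (pairingDh G i j) = 0 := by
  have h₁ : Dh X (if i.1 = 0 then 0 else G (hn i) j) =
      if i.1 = 0 then 0 else -((sgn i : ℤ) • (if j.1 = 0 then 0 else G (hn i) (hn j))) := by
    split_ifs with h h'
    · rw [map_zero]
    all_goals
      rw [hG.dh (hST (hi' h)) hj (Or.inl (hi' h)), sgn_hn h, neg_smul]
      split_ifs with h₀
      · simp
      · rw [hG.left (hn_hn_notMem hi h₀)]; simp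
  have h₂ : Dh X (if j.1 = 0 then 0 else G i (hn j)) =
      if j.1 = 0 then 0 else (if i.1 = 0 then 0 else G (hn i) (hn j)) := by
    split_ifs with h h'
    · rw [map_zero]
    all_goals
      rw [hG.dh hi (hST' (hj' h)) (Or.inr (hj' h))]
      split_ifs with h₀
      · simp
      · rw [hG.right _ (hn_hn_notMem hj h₀)]; simp
  rw [pairingDh, map_add, map_zsmul, h₁, h₂]
  split_ifs <;> simp

lemma totMap_pairingDh (hpG : ∀ i j, Boundary S S' i j → totMap p (G i j) = K i j) {i j : ℕ × ℤ}
    (hi' : i.1 ≠ 0 → hn i ∈ S.carrier) (hj' : j.1 ≠ 0 → hn j ∈ S'.carrier) :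
    totMap p (pairingDh G i j) = pairingDh K i j := by
  rw [pairingDh, pairingDh, map_add, map_zsmul]
  congr 2
  · split_ifs with h
    · rw [map_zero]
    · exact hpG _ _ (Or.inl (hi' h))
  · split_ifs with h
    · rw [map_zero]
    · exact hpG _ _ (Or.inr (hj' h))

/-- Extension of pairings along the attachment of a single product of two cells which are
vertical cycles. -/
lemma exists_extension_of_sLift (hp : SLift p) (hST : S.carrier ⊆ T.carrier)
    (hST' : S'.carrier ⊆ T'.carrier) {e e' : ℕ × ℤ} (he : e ∈ T.carrier) (heS : e ∉ S.carrier)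
    (hT : ∀ i ∈ T.carrier, i ∉ S.carrier → i = e) (he' : e' ∈ T'.carrier)
    (heS' : e' ∉ S'.carrier) (hT' : ∀ i ∈ T'.carrier, i ∉ S'.carrier → i = e')
    (hn_e : e.1 ≠ 0 → hn e ∈ S.carrier) (hn_e' : e'.1 ≠ 0 → hn e' ∈ S'.carrier)
    (hv : ∀ i ∈ T.carrier, vn i ∉ T.carrier) (hv' : ∀ i ∈ T'.carrier, vn i ∉ T'.carrier)
    (hG : IsPairing T T' (Boundary S S') G) (hK : IsPairing T T' (fun _ _ => True) K)
    (hpG : ∀ i j, Boundary S S' i j → totMap p (G i j) = K i j) :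
    ∃ H : ℕ × ℤ → ℕ × ℤ → Tot X, IsPairing T T' (fun _ _ => True) H ∧
      (∀ i j, Boundary S S' i j → H i j = G i j) ∧ ∀ i j, totMap p (H i j) = K i j := by
  have hGv {i j : ℕ × ℤ} (hi : i ∈ T.carrier) (hj : j ∈ T'.carrier) (hD : Boundary S S' i j) :
      Dv X (G i j) = 0 := by
    rw [hG.dv hi hj hD, hG.left (hv i hi), hG.right _ (hv' j hj)]
    simp
  have hKv : Dv Y (K e e') = 0 := by
    rw [hK.dv he he' trivial, hK.left (hv e he), hK.right _ (hv' e' he')]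
    simp
  -- Only the value at `(e, e')` is missing. The vertical relations force it to be a vertical cycle,
  -- since neither part has vertical differentials, and its horizontal boundary is prescribed by
  -- known values: exactly an `SLift` problem.
  obtain ⟨x, hx, hvx, hpx, hhx⟩ := hp.homog (e + e') (K e e') (pairingDh G e e') (hK.homog _ _)
    (hG.homog_pairingDh _ _) (fun h => pairingDh_eq_zero G h) hKv (by
      rw [pairingDh, map_add, map_zsmul]
      split_ifs with h₁ h₂ h₂
      · simp
      · rw [hGv he (hST' (hn_e' h₂)) (Or.inr (hn_e' h₂))]; simp
      · rw [hGv (hST (hn_e h₁)) he' (Or.inl (hn_e h₁))]; simp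
      · rw [hGv he (hST' (hn_e' h₂)) (Or.inr (hn_e' h₂)),
          hGv (hST (hn_e h₁)) he' (Or.inl (hn_e h₁))]; simp)
    (hG.Dh_pairingDh he he' hn_e hn_e' hST hST')
    ((totMap_pairingDh hpG hn_e hn_e').trans (hK.dh' he he' trivial).symm)
  obtain ⟨H, hHe, hH⟩ : ∃ H : ℕ × ℤ → ℕ × ℤ → Tot X, H e e' = x ∧
      ∀ i j, i ≠ e ∨ j ≠ e' → H i j = G i j :=
    ⟨fun i j => if i = e ∧ j = e' then x else G i j, if_pos ⟨rfl, rfl⟩,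
      fun i j h => if_neg (by tauto)⟩
  have hD' {i j : ℕ × ℤ} (hD : Boundary S S' i j) : i ≠ e ∨ j ≠ e' :=
    hD.imp (fun h h' => heS (h' ▸ h)) (fun h h' => heS' (h' ▸ h))
  have hcell {i j : ℕ × ℤ} (hi : i ∈ T.carrier) (hj : j ∈ T'.carrier) :
      (i = e ∧ j = e') ∨ Boundary S S' i j := by
    by_contra! h
    exact h.1 (hT i hi fun h' => h.2 (Or.inl h')) (hT' j hj fun h' => h.2 (Or.inr h'))
  have hne {i : ℕ × ℤ} (h : i.1 ≠ 0) : hn i ≠ i := fun h' => by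
    have := congrArg Prod.fst h'
    simp only at this
    omega
  refine ⟨H, ⟨fun i j => ?_, fun {i} hi j => ?_, fun i j hj => ?_, fun {i j} hi hj _ => ?_,
    fun {i j} hi hj _ => ?_⟩, fun i j hD => hH i j (hD' hD), fun i j => ?_⟩
  · by_cases h : i = e ∧ j = e'
    · rw [h.1, h.2, hHe]; exact hx
    · rw [hH i j (by tauto)]; exact hG.homog i j
  · rw [hH i j (Or.inl fun h => hi (h ▸ he)), hG.left hi]
  · rw [hH i j (Or.inr fun h => hj (h ▸ he')), hG.right _ hj]
  · change _ = pairingDh H i j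
    obtain ⟨rfl, rfl⟩ | hD := hcell hi hj
    · rw [hHe, hhx]
      exact (pairingDh_congr (fun h => hH _ _ (Or.inl (hne h)))
        (fun h => hH _ _ (Or.inr (hne h)))).symm
    · rw [hH _ _ (hD' hD), hG.dh' hi hj hD]
      refine (pairingDh_congr (fun h => ?_) (fun h => ?_)).symm
      · refine hH _ _ (hD.imp (fun hD h' => ?_) fun hD h' => heS' (h' ▸ hD))
        exact heS (h' ▸ hn_mem_of_mem hD h (h' ▸ he))
      · refine hH _ _ (hD.imp (fun hD h' => heS (h' ▸ hD)) fun hD h' => ?_)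
        exact heS' (h' ▸ hn_mem_of_mem hD h (h' ▸ he'))
  · rw [hH (vn i) j (Or.inl fun h => hv i hi (h ▸ he)), hG.left (hv i hi),
      hH i (vn j) (Or.inr fun h => hv' j hj (h ▸ he')), hG.right _ (hv' j hj)]
    simp only [smul_zero, add_zero]
    obtain ⟨rfl, rfl⟩ | hD := hcell hi hj
    · rw [hHe, hvx]
    · rw [hH _ _ (hD' hD)]
      exact hGv hi hj hD
  · by_cases hi : i ∈ T.carrier
    · by_cases hj : j ∈ T'.carrier
      · obtain ⟨rfl, rfl⟩ | hD := hcell hi hj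
        · rw [hHe, hpx]
        · rw [hH _ _ (hD' hD), hpG _ _ hD]
      · rw [hH i j (Or.inr fun h => hj (h ▸ he')), hG.right _ hj, hK.right _ hj, map_zero]
    · rw [hH i j (Or.inl fun h => hi (h ▸ he)), hG.left hi, hK.left hi, map_zero]

/-- Extension of pairings along the attachment of a cell and its vertical boundary in the first
factor. -/
lemma exists_extension_of_dLift (hp : DLift p) (hST : S.carrier ⊆ T.carrier)
    (hST' : S'.carrier ⊆ T'.carrier) {e : ℕ × ℤ} (he : e ∈ T.carrier) (heS : e ∉ S.carrier)
    (hve : vn e ∈ T.carrier) (hveS : vn e ∉ S.carrier)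
    (hT : ∀ i ∈ T.carrier, i ∉ S.carrier → i = e ∨ i = vn e)
    (hn_e : e.1 ≠ 0 → hn e ∈ S.carrier)
    (hT' : ∀ j ∈ T'.carrier, j ∉ S'.carrier → j.1 ≠ 0 → hn j ∈ S'.carrier)
    (hG : IsPairing T T' (Boundary S S') G) (hK : IsPairing T T' (fun _ _ => True) K)
    (hpG : ∀ i j, Boundary S S' i j → totMap p (G i j) = K i j) :
    ∃ H : ℕ × ℤ → ℕ × ℤ → Tot X, IsPairing T T' (fun _ _ => True) H ∧
      (∀ i j, Boundary S S' i j → H i j = G i j) ∧ ∀ i j, totMap p (H i j) = K i j := by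
  -- The values on `e ⊗ -`. For a new cell `j` the horizontal faces of both `e` and `j` are old, so
  -- the prescribed boundary is known and the problems for different `j` are independent.
  have hx (j : ℕ × ℤ) : ∃ x : Tot X, Homog (e + j) x ∧ totMap p x = K e j ∧
      (j ∈ T'.carrier → Dh X x = pairingDh G e j) ∧ (j ∈ S'.carrier → x = G e j) ∧
      (j ∉ T'.carrier → x = 0) := by
    by_cases hj : j ∈ T'.carrier
    · by_cases hj' : j ∈ S'.carrier
      · exact ⟨G e j, hG.homog _ _, hpG _ _ (Or.inr hj'), fun _ => hG.dh' he hj (Or.inr hj'),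
          fun _ => rfl, fun h => (h hj).elim⟩
      · obtain ⟨x, hx, hpx, hhx⟩ := hp.homog (e + j) (K e j) (pairingDh G e j) (hK.homog _ _)
          (hG.homog_pairingDh _ _) (fun h => pairingDh_eq_zero G h)
          (hG.Dh_pairingDh he hj hn_e (hT' j hj hj') hST hST')
          ((totMap_pairingDh hpG hn_e (hT' j hj hj')).trans (hK.dh' he hj trivial).symm)
        exact ⟨x, hx, hpx, fun _ => hhx, fun h => (hj' h).elim, fun h => (h hj).elim⟩
    · exact ⟨0, homog_zero _, by rw [hK.right _ hj, map_zero], fun h => (hj h).elim,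
        fun h => (hj (hST' h)).elim, fun _ => rfl⟩
  choose x hx hpx hhx hxG hx₀ using hx
  have hvne : vn e ≠ e := fun h => by
    have := congrArg Prod.snd h
    simp only at this
    omega
  -- The sign depends only on the column, so `e` and `vn e` share it; being its own inverse it can
  -- be moved to the other side of the vertical relation.
  obtain ⟨c, hc, hc'⟩ : ∃ c : k, (columnSign n e : k) = c ∧ (c = 1 ∨ c = -1) :=
    ⟨_, rfl, columnSign_eq e⟩
  have hcc : c * c = 1 := by obtain rfl | rfl := hc' <;> simp
  have hcv : (columnSign n (vn e) : k) = c := hc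
  -- No lifting is needed at `vn e`: the vertical relation at `(e, j)` leaves exactly one possible
  -- value. The remaining relations there are consequences of the differentials squaring to zero and
  -- anticommuting.
  let v (j : ℕ × ℤ) : Tot X := if j ∈ T'.carrier then
    c • (Dv X (x j) - (sgn e : ℤ) • (columnSign n' j : k) • x (vn j)) else 0
  have hv {j : ℕ × ℤ} (hj : j ∈ T'.carrier) : v j =
    c • (Dv X (x j) - (sgn e : ℤ) • (columnSign n' j : k) • x (vn j)) := if_pos hj
  have hv₀ {j : ℕ × ℤ} (hj : j ∉ T'.carrier) : v j = 0 := if_neg hj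
  have hDv {j : ℕ × ℤ} (hj : j ∈ T'.carrier) :
      Dv X (x j) = c • v j + (sgn e : ℤ) • (columnSign n' j : k) • x (vn j) := by
    rw [hv hj, smul_smul, hcc, one_smul, sub_add_cancel]
  clear_value v
  have hxvn {j : ℕ × ℤ} (hj : j ∈ S'.carrier) : x (vn j) = G e (vn j) := by
    by_cases h : vn j ∈ T'.carrier
    · exact hxG _ (vn_mem_of_mem hj h)
    · rw [hx₀ _ h, hG.right _ h]
  have hxhn {j : ℕ × ℤ} (hj : j ∈ T'.carrier) (h : j.1 ≠ 0) : x (hn j) = G e (hn j) := by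
    by_cases hj' : j ∈ S'.carrier
    · by_cases h' : hn j ∈ T'.carrier
      · exact hxG _ (hn_mem_of_mem hj' h h')
      · rw [hx₀ _ h', hG.right _ h']
    · exact hxG _ (hT' j hj hj' h)
  have hvG {j : ℕ × ℤ} (hj : j ∈ S'.carrier) : v j = G (vn e) j := by
    rw [hv (hST' hj), hxG j hj, hxvn hj, hG.dv he (hST' hj) (Or.inr hj), add_sub_cancel_right,
      hc, smul_smul, hcc, one_smul]
  obtain ⟨H, hHe, hHv, hH⟩ : ∃ H : ℕ × ℤ → ℕ × ℤ → Tot X, (∀ j, H e j = x j) ∧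
      (∀ j, H (vn e) j = v j) ∧ ∀ i j, i ≠ e → i ≠ vn e → H i j = G i j :=
    ⟨fun i j => if i = e then x j else if i = vn e then v j else G i j, fun j => if_pos rfl,
      fun j => (if_neg hvne).trans (if_pos rfl), fun i j h h' => (if_neg h).trans (if_neg h')⟩
  have hHS {i : ℕ × ℤ} (hi : i ∈ S.carrier) (j : ℕ × ℤ) : H i j = G i j :=
    hH i j (fun h => heS (h ▸ hi)) (fun h => hveS (h ▸ hi))
  have hHT {i : ℕ × ℤ} (hi : i ∉ T.carrier) (j : ℕ × ℤ) : H i j = 0 :=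
    (hH i j (fun h => hi (h ▸ he)) (fun h => hi (h ▸ hve))).trans (hG.left hi j)
  have hHT' (i : ℕ × ℤ) {j : ℕ × ℤ} (hj : j ∉ T'.carrier) : H i j = 0 := by
    by_cases h : i = e
    · rw [h, hHe, hx₀ j hj]
    · by_cases h' : i = vn e
      · rw [h', hHv, hv₀ hj]
      · rw [hH i j h h', hG.right _ hj]
  have hDh {j : ℕ × ℤ} (hj : j ∈ T'.carrier) : Dh X (x j) = (if e.1 = 0 then 0 else G (hn e) j) +
      (sgn e : ℤ) • (if j.1 = 0 then 0 else x (hn j)) := by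
    rw [hhx j hj, pairingDh]
    congr 2
    split_ifs with h
    · rfl
    · rw [hxhn hj h]
  have hDh' {j : ℕ × ℤ} (hj : j ∈ T'.carrier) : Dh X (x (vn j)) =
      (if e.1 = 0 then 0 else G (hn e) (vn j)) +
      (sgn e : ℤ) • (if j.1 = 0 then 0 else x (vn (hn j))) := by
    by_cases h : vn j ∈ T'.carrier
    · exact hDh h
    · rw [hx₀ _ h, hx₀ _ (vn_hn_notMem_of_vn_notMem hj h), hG.right _ h, map_zero]
      simp
  have hDv' {j : ℕ × ℤ} (hj : j ∈ T'.carrier) (h : j.1 ≠ 0) : Dv X (x (hn j)) =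
      c • v (hn j) - (sgn e : ℤ) • (columnSign n' j : k) • x (vn (hn j)) := by
    by_cases h' : hn j ∈ T'.carrier
    · rw [hDv h', columnSign_hn hj h h', neg_smul, smul_neg, sub_eq_add_neg]
    · rw [hx₀ _ h', hx₀ _ (vn_hn_notMem_of_hn_notMem hj h h'), hv₀ h', map_zero]
      simp
  have hvv {j : ℕ × ℤ} (hj : j ∈ T'.carrier) :
      Dv X (v j) = -((sgn e : ℤ) • (columnSign n' j : k) • v (vn j)) := by
    have h₁ : Dv X (x (vn j)) = c • v (vn j) := by
      by_cases h : vn j ∈ T'.carrier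
      · rw [hDv h, hx₀ _ (vn_vn_notMem hj)]; simp
      · rw [hx₀ _ h, hv₀ h]; simp
    rw [hv hj, map_smul, map_sub, Dv_Dv, map_zsmul, map_smul, h₁, zero_sub, smul_neg,
      smul_comm c, smul_comm c, smul_smul c c, hcc, one_smul]
  have hvh {j : ℕ × ℤ} (hj : j ∈ T'.carrier) :
      Dh X (v j) = (if e.1 = 0 then 0 else G (vn (hn e)) j) -
        (sgn e : ℤ) • (if j.1 = 0 then 0 else v (hn j)) := by
    have h₁ : Dv X (if e.1 = 0 then 0 else G (hn e) j) = -(if e.1 = 0 then 0 else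
        c • G (vn (hn e)) j + (sgn e : ℤ) • (columnSign n' j : k) • G (hn e) (vn j)) := by
      split_ifs with h
      · simp
      · rw [hG.dv (hST (hn_e h)) hj (Or.inl (hn_e h)), columnSign_hn he h (hST (hn_e h)), hc,
          sgn_hn h, neg_smul, neg_smul, neg_add]
    have h₂ : Dv X (if j.1 = 0 then 0 else x (hn j)) = if j.1 = 0 then 0 else
        (c • v (hn j) - (sgn e : ℤ) • (columnSign n' j : k) • x (vn (hn j))) := by
      split_ifs with h
      · simp
      · exact hDv' hj h
    rw [hv hj, map_smul, map_sub, Dh_Dv, hDh hj, map_add, map_zsmul, h₁, h₂, map_zsmul, map_smul,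
      hDh' hj]
    -- What is left is a comparison of signs, settled by trying all values of the three signs
    -- together with the column 0 cases.
    obtain hs | hs := sgn_eq e <;> obtain rfl | rfl := hc' <;>
      obtain hj' | hj' := columnSign_eq (k := k) (n := n') j <;>
      rw [hs, hj'] <;> split_ifs <;> simp <;> abel
  refine ⟨H, ⟨fun i j => ?_, fun {i} hi j => hHT hi j, fun i j hj => hHT' i hj,
    fun {i j} hi hj _ => ?_, fun {i j} hi hj _ => ?_⟩, fun i j hD => ?_, fun i j => ?_⟩
  · by_cases h : i = e
    · rw [h, hHe]; exact hx j
    · by_cases h' : i = vn e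
      · rw [h', hHv]
        by_cases hj : j ∈ T'.carrier
        · rw [hv hj]
          refine Homog.smul (Homog.sub ?_ (Homog.zsmul (Homog.smul ?_ _) _)) _
          · rw [vn_add]; exact (hx j).Dv
          · rw [vn_add, ← add_vn]; exact hx (vn j)
        · rw [hv₀ hj]; exact homog_zero _
      · rw [hH i j h h']; exact hG.homog _ _
  · change _ = pairingDh H i j
    by_cases hiS : i ∈ S.carrier
    · rw [hHS hiS, hG.dh' hi hj (Or.inl hiS)]
      refine (pairingDh_congr (fun h => ?_) (fun h => hHS hiS _)).symm
      by_cases h' : hn i ∈ T.carrier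
      · exact hHS (hn_mem_of_mem hiS h h') _
      · rw [hHT h', hG.left h']
    · obtain rfl | rfl := hT i hi hiS
      · rw [hHe, hDh hj, pairingDh, hHe]
        congr 1
        split_ifs with h
        · rfl
        · rw [hHS (hn_e h)]
      · rw [hHv, hvh hj, pairingDh, hHv, sgn_vn, neg_smul, ← sub_eq_add_neg]
        congr 1
        split_ifs with h
        · rfl
        · have hne {l : ℕ × ℤ} (hl : l.1 = e.1) : hn (vn e) ≠ l := fun h' => by
            have := congrArg Prod.fst h'
            simp only at this
            omega
          exact (hH _ j (hne rfl) (hne rfl)).symm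
  · by_cases hiS : i ∈ S.carrier
    · rw [hHS hiS, hHS hiS, hG.dv hi hj (Or.inl hiS)]
      congr 2
      by_cases h' : vn i ∈ T.carrier
      · exact (hHS (vn_mem_of_mem hiS h') _).symm
      · rw [hHT h', hG.left h']
    · obtain rfl | rfl := hT i hi hiS
      · rw [hHe, hHe, hHv, hc, hDv hj]
      · rw [hHv, hHv, hvv hj, hHT (vn_vn_notMem he), smul_zero, zero_add, sgn_vn, neg_smul]
  · obtain hi | hj := hD
    · exact hHS hi j
    · by_cases h : i = e
      · rw [h, hHe, hxG j hj]
      · by_cases h' : i = vn e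
        · rw [h', hHv, hvG hj]
        · exact hH i j h h'
  · by_cases hi : i ∈ T.carrier
    · by_cases hiS : i ∈ S.carrier
      · rw [hHS hiS, hpG _ _ (Or.inl hiS)]
      · obtain rfl | rfl := hT i hi hiS
        · rw [hHe, hpx]
        · rw [hHv]
          by_cases hj : j ∈ T'.carrier
          · rw [hv hj, map_smul, map_sub, totMap_Dv, map_zsmul, map_smul, hpx, hpx,
              hK.dv he hj trivial, add_sub_cancel_right, hc, smul_smul, hcc, one_smul]
          · rw [hv₀ hj, hK.right _ hj, map_zero]
    · rw [hHT hi, hK.left hi, map_zero]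

open MonoidalCategory

/-- Lifting properties of pushout-products of inclusions of parts of discs follow from the
extension of pairings. -/
lemma hasLiftingProperty_pushoutProduct (hST : S.carrier ⊆ T.carrier)
    (hST' : S'.carrier ⊆ T'.carrier)
    (sq : (curriedTensor (Bicomplex k)).PushoutObjObj (incl k hST) (incl k hST'))
    (hp : ∀ (G : ℕ × ℤ → ℕ × ℤ → Tot X) (K : ℕ × ℤ → ℕ × ℤ → Tot Y),
      IsPairing T T' (Boundary S S') G → IsPairing T T' (fun _ _ => True) K →
      (∀ i j, Boundary S S' i j → totMap p (G i j) = K i j) →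
      ∃ H : ℕ × ℤ → ℕ × ℤ → Tot X, IsPairing T T' (fun _ _ => True) H ∧
        (∀ i j, Boundary S S' i j → H i j = G i j) ∧ ∀ i j, totMap p (H i j) = K i j) :
    HasLiftingProperty sq.ι p := by
  let inl : T.toBicomplex k ⊗ S'.toBicomplex k ⟶ sq.pt := sq.inl
  let inr : S.toBicomplex k ⊗ T'.toBicomplex k ⟶ sq.pt := sq.inr
  have hinl : inl ≫ sq.ι = T.toBicomplex k ◁ incl k hST' := sq.inl_ι
  have hinr : inr ≫ sq.ι = incl k hST ▷ T'.toBicomplex k := sq.inr_ι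
  have hw : incl k hST ▷ S'.toBicomplex k ≫ inl = S.toBicomplex k ◁ incl k hST' ≫ inr :=
    sq.isPushout.w
  -- The product cells of the two corners of the pushout glue to one family, since they agree on the
  -- product of `S` and `S'`. Allowing indices outside `T` or `T'`, where everything is zero, lets
  -- faces be rewritten uniformly.
  obtain ⟨g, hg₁, hg₂, hg₀⟩ : ∃ g : ℕ × ℤ → ℕ × ℤ → Tot sq.pt,
      (∀ i j, j ∈ S'.carrier ∨ j ∉ T'.carrier → g i j = totMap inl (tcell k T S' i j)) ∧
      (∀ i j, i ∈ S.carrier ∨ i ∉ T.carrier → g i j = totMap inr (tcell k S T' i j)) ∧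
      ∀ i j, Homog (i + j) (g i j) := by
    refine ⟨fun i j => if j ∈ S'.carrier then totMap inl (tcell k T S' i j) else
      totMap inr (tcell k S T' i j), fun i j h => ?_, fun i j h => ?_, fun i j => ?_⟩ <;> dsimp only
    · split_ifs with h'
      · rfl
      · rw [(isPairing_tcell T S').right i h',
          (isPairing_tcell S T').right i (h.resolve_left h'), map_zero, map_zero]
    · split_ifs with h'
      · obtain h | h := h
        · rw [← totMap_whiskerRight_tcell hST h, ← totMap_comp, hw, totMap_comp,
            totMap_whiskerLeft_tcell hST' _ h']
        · rw [(isPairing_tcell T S').left h,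
            (isPairing_tcell S T').left (fun h' => h (hST h')), map_zero, map_zero]
      · rfl
    · split_ifs
      · exact ((isPairing_tcell T S').homog i j).totMap inl
      · exact ((isPairing_tcell S T').homog i j).totMap inr
  have hclosed {j : ℕ × ℤ} (hj : j ∈ S'.carrier) (h : j.1 ≠ 0) :
      hn j ∈ S'.carrier ∨ hn j ∉ T'.carrier := by
    by_cases h' : hn j ∈ T'.carrier
    · exact Or.inl (hn_mem_of_mem hj h h')
    · exact Or.inr h'
  have hclosed_vn {j : ℕ × ℤ} (hj : j ∈ S'.carrier) : vn j ∈ S'.carrier ∨ vn j ∉ T'.carrier := by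
    by_cases h' : vn j ∈ T'.carrier
    · exact Or.inl (vn_mem_of_mem hj h')
    · exact Or.inr h'
  have hclosed' {i : ℕ × ℤ} (hi : i ∈ S.carrier) (h : i.1 ≠ 0) :
      hn i ∈ S.carrier ∨ hn i ∉ T.carrier := by
    by_cases h' : hn i ∈ T.carrier
    · exact Or.inl (hn_mem_of_mem hi h h')
    · exact Or.inr h'
  have hclosed_vn' {i : ℕ × ℤ} (hi : i ∈ S.carrier) : vn i ∈ S.carrier ∨ vn i ∉ T.carrier := by
    by_cases h' : vn i ∈ T.carrier
    · exact Or.inl (vn_mem_of_mem hi h')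
    · exact Or.inr h'
  have hgl := (isPairing_tcell (k := k) T S').map inl
  have hgr := (isPairing_tcell (k := k) S T').map inr
  have hg : IsPairing T T' (Boundary S S') g := by
    refine ⟨fun i j => ?_, fun {i} hi j => ?_, fun i j hj => ?_, fun {i j} hi hj hD => ?_,
      fun {i j} hi hj hD => ?_⟩
    · exact hg₀ i j
    · rw [hg₂ _ _ (Or.inr hi)]
      exact hgr.left (fun h => hi (hST h)) j
    · rw [hg₁ _ _ (Or.inr hj)]
      exact hgl.right i (fun h => hj (hST' h))
    · change _ = pairingDh g i j
      obtain h | h := hD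
      · rw [hg₂ _ _ (Or.inl h), hgr.dh' h hj trivial]
        exact (pairingDh_congr (fun h' => hg₂ _ _ (hclosed' h h'))
          (fun _ => hg₂ _ _ (Or.inl h))).symm
      · rw [hg₁ _ _ (Or.inl h), hgl.dh' hi h trivial]
        exact (pairingDh_congr (fun _ => hg₁ _ _ (Or.inl h))
          (fun h' => hg₁ _ _ (hclosed h h'))).symm
    · obtain h | h := hD
      · rw [hg₂ i j (Or.inl h), hgr.dv h hj trivial, hg₂ (vn i) j (hclosed_vn' h),
          hg₂ i (vn j) (Or.inl h)]
      · rw [hg₁ i j (Or.inl h), hgl.dv hi h trivial, hg₁ (vn i) j (Or.inl h),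
          hg₁ i (vn j) (hclosed_vn h)]
  have hgι {i j : ℕ × ℤ} (hD : Boundary S S' i j) : totMap sq.ι (g i j) = tcell k T T' i j := by
    obtain h | h := hD
    · rw [hg₂ _ _ (Or.inl h), ← totMap_comp, hinr, totMap_whiskerRight_tcell hST h]
    · rw [hg₁ _ _ (Or.inl h), ← totMap_comp, hinl, totMap_whiskerLeft_tcell hST' _ h]
  refine ⟨fun {top bot} w => ?_⟩
  obtain ⟨H, hH, hHG, hHK⟩ := hp _ _ (hg.map top) ((isPairing_tcell T T').map bot)
    (fun i j hD => by rw [← totMap_comp, w.w, totMap_comp, hgι hD])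
  obtain ⟨φ, hφ⟩ := exists_tensor_hom H hH
  refine ⟨⟨⟨φ, ?_, ?_⟩⟩⟩
  · refine sq.hom_ext ?_ ?_
    · change inl ≫ sq.ι ≫ φ = inl ≫ top
      refine tensor_hom_ext_tcell fun i _ j hj => ?_
      rw [← Category.assoc, hinl, totMap_comp, totMap_whiskerLeft_tcell hST' _ hj, hφ,
        hHG _ _ (Or.inr hj), hg₁ _ _ (Or.inl hj), totMap_comp]
    · change inr ≫ sq.ι ≫ φ = inr ≫ top
      refine tensor_hom_ext_tcell fun i hi j _ => ?_
      rw [← Category.assoc, hinr, totMap_comp, totMap_whiskerRight_tcell hST hi, hφ,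
        hHG _ _ (Or.inl hi), hg₂ _ _ (Or.inl hi), totMap_comp]
  · refine tensor_hom_ext_tcell fun i _ j _ => ?_
    rw [totMap_comp, hφ, hHK]

end DiscPart

end Bicomplex

end

/-! ### Pushout-products of cofibrations, the unit, and the monoidal model structure -/

noncomputable section

namespace Bicomplex

variable {k : Type u} [CommRing k]

namespace DiscPart

variable {n n' : ℕ} {q q' : ℤ}

/-- `T` is obtained from `S` by attaching a single corner, and the vertical differential of `T`
vanishes. -/
structure IsSphereAttachment (S T : DiscPart n q) : Prop where
  exists_eq : ∃ e ∈ T.carrier, e ∉ S.carrier ∧ ∀ i ∈ T.carrier, i ∉ S.carrier → i = e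
  hn_mem : ∀ i ∈ T.carrier, i ∉ S.carrier → i.1 ≠ 0 → hn i ∈ S.carrier
  vn_notMem : ∀ i ∈ T.carrier, vn i ∉ T.carrier

/-- `T` is obtained from `S` by attaching a corner and its vertical boundary. -/
structure IsDiscAttachment (S T : DiscPart n q) : Prop where
  exists_eq : ∃ e ∈ T.carrier, e ∉ S.carrier ∧ vn e ∈ T.carrier ∧ vn e ∉ S.carrier ∧
    ∀ i ∈ T.carrier, i ∉ S.carrier → i = e ∨ i = vn e
  hn_mem : ∀ i ∈ T.carrier, i ∉ S.carrier → i.1 ≠ 0 → hn i ∈ S.carrier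

lemma isSphereAttachment_sphere (q : ℤ) : IsSphereAttachment (zero 0 q) (sphere 0 q) where
  exists_eq := ⟨(0, q - 1), rfl, fun h => h, fun i hi _ => hi⟩
  hn_mem := by rintro _ rfl _ h; exact (h rfl).elim
  vn_notMem := by
    rintro _ rfl h
    have := congrArg Prod.snd (h : _ = _)
    simp at this

lemma isSphereAttachment_verticalBoundary (n : ℕ) (q : ℤ) :
    IsSphereAttachment (sphere n q) (verticalBoundary n q) where
  exists_eq := ⟨(n + 1, q - 1), Or.inl rfl, fun h => by simp [sphere] at h,
    fun i hi hi' => hi.resolve_right hi'⟩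
  hn_mem := by
    rintro _ (rfl | rfl) h _
    · rfl
    · exact (h rfl).elim
  vn_notMem := by
    rintro _ (rfl | rfl) h <;> simp [verticalBoundary, vn] at h

lemma isDiscAttachment_horizontalBoundary (q : ℤ) :
    IsDiscAttachment (zero 0 q) (horizontalBoundary 0 q) where
  exists_eq := ⟨(0, q), Or.inl rfl, fun h => h, Or.inr rfl, fun h => h, fun i hi _ => hi⟩
  hn_mem := by rintro _ (rfl | rfl) _ h <;> exact (h rfl).elim

lemma isDiscAttachment_disc (n : ℕ) (q : ℤ) :
    IsDiscAttachment (horizontalBoundary n q) (disc n q) where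
  exists_eq := by
    refine ⟨(n + 1, q), by simp [disc, corners], by simp [horizontalBoundary],
      by simp [disc, corners, vn], by simp [horizontalBoundary, vn], ?_⟩
    rintro ⟨r, s⟩ h h'
    simp only [disc, corners, horizontalBoundary, vn, Set.mem_ofPred_eq, Set.mem_insert_iff,
      Set.mem_singleton_iff, Prod.mk.injEq] at *
    omega
  hn_mem := by
    rintro ⟨r, s⟩ h h' _
    simp only [disc, corners, horizontalBoundary, hn, Set.mem_ofPred_eq, Set.mem_insert_iff,
      Set.mem_singleton_iff, Prod.mk.injEq] at *
    omega

end DiscPart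

open DiscPart

/-- The four families consist of only two kinds of attachment. Up to symmetry this leaves two cases
for a pushout-product of generators. -/
lemma ceGeneratingCofibrations_induction {P : ∀ ⦃A B : Bicomplex k⦄, (A ⟶ B) → Prop}
    (h : ∀ (n : ℕ) (q : ℤ) (S T : DiscPart n q) (hST : S.carrier ⊆ T.carrier),
      IsSphereAttachment S T ∨ IsDiscAttachment S T → P (incl k hST))
    {A B : Bicomplex k} {f : A ⟶ B} (hf : ceGeneratingCofibrations k f) : P f := by
  rcases hf with ((⟨⟨q⟩⟩ | ⟨⟨n, q⟩⟩) | ⟨⟨q⟩⟩) | ⟨⟨n, q⟩⟩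
  · exact h _ _ _ _ _ (Or.inl (isSphereAttachment_sphere q))
  · exact h _ _ _ _ _ (Or.inl (isSphereAttachment_verticalBoundary n q))
  · exact h _ _ _ _ _ (Or.inr (isDiscAttachment_horizontalBoundary q))
  · exact h _ _ _ _ _ (Or.inr (isDiscAttachment_disc n q))

section

variable {A B A' B' X Y : Bicomplex k} {f : A ⟶ B} {g : A' ⟶ B'} {p : X ⟶ Y}

/-- The braiding exchanges the two pushout-products of a pair of morphisms. -/
def flipTensorIso (sq : (curriedTensor (Bicomplex k)).PushoutObjObj f g) :
    Arrow.mk sq.ι ≅ Arrow.mk sq.flipTensor.ι :=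
  Arrow.isoMk (Iso.refl _) (β_ _ _)

/-- Vertical cycles need not be lifted, because the cell of the first factor comes with its vertical
boundary. Of the second factor only the property shared by both kinds of attachment is needed. -/
lemma hasLiftingProperty_of_isDiscAttachment {n n' : ℕ} {q q' : ℤ} {S T : DiscPart n q}
    {S' T' : DiscPart n' q'} {hST : S.carrier ⊆ T.carrier} {hST' : S'.carrier ⊆ T'.carrier}
    (h : IsDiscAttachment S T)
    (h' : ∀ i ∈ T'.carrier, i ∉ S'.carrier → i.1 ≠ 0 → hn i ∈ S'.carrier)
    (sq : (curriedTensor (Bicomplex k)).PushoutObjObj (incl k hST) (incl k hST'))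
    (hp : DLift p) : HasLiftingProperty sq.ι p := by
  obtain ⟨e, he, heS, hve, hveS, hT⟩ := h.exists_eq
  exact hasLiftingProperty_pushoutProduct hST hST' sq fun _ _ hG hK hpG =>
    exists_extension_of_dLift hp hST hST' he heS hve hveS hT (h.hn_mem e he heS) h' hG hK hpG

lemma hasLiftingProperty_of_isSphereAttachment {n n' : ℕ} {q q' : ℤ} {S T : DiscPart n q}
    {S' T' : DiscPart n' q'} {hST : S.carrier ⊆ T.carrier} {hST' : S'.carrier ⊆ T'.carrier}
    (h : IsSphereAttachment S T) (h' : IsSphereAttachment S' T')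
    (sq : (curriedTensor (Bicomplex k)).PushoutObjObj (incl k hST) (incl k hST'))
    (hp : SLift p) : HasLiftingProperty sq.ι p := by
  obtain ⟨e, he, heS, hT⟩ := h.exists_eq
  obtain ⟨e', he', heS', hT'⟩ := h'.exists_eq
  exact hasLiftingProperty_pushoutProduct hST hST' sq fun _ _ hG hK hpG =>
    exists_extension_of_sLift hp hST hST' he heS hT he' heS' hT' (h.hn_mem e he heS)
      (h'.hn_mem e' he' heS') h.vn_notMem h'.vn_notMem hG hK hpG

/-- Pushout-products of generating cofibrations are cofibrations. -/
lemma hasLiftingProperty_of_ceGeneratingCofibrations (hf : ceGeneratingCofibrations k f)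
    (hg : ceGeneratingCofibrations k g)
    (sq : (curriedTensor (Bicomplex k)).PushoutObjObj f g)
    (hp : (ceGeneratingCofibrations k).rlp p) : HasLiftingProperty sq.ι p := by
  obtain ⟨hD, hS⟩ := ceGeneratingCofibrations_rlp_iff.1 hp
  refine ceGeneratingCofibrations_induction (P := fun _ _ f =>
    ∀ sq : (curriedTensor (Bicomplex k)).PushoutObjObj f g, HasLiftingProperty sq.ι p)
    (fun n q S T hST h => ?_) hf sq
  refine ceGeneratingCofibrations_induction (P := fun _ _ g =>
    ∀ sq : (curriedTensor (Bicomplex k)).PushoutObjObj (incl k hST) g, HasLiftingProperty sq.ι p)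
    (fun n' q' S' T' hST' h' sq => ?_) hg
  obtain h | h := h
  · obtain h' | h' := h'
    · exact hasLiftingProperty_of_isSphereAttachment h h' sq hS
    -- The braiding moves the factor attached with its vertical boundary to the first variable.
    · rw [HasLiftingProperty.iff_of_arrow_iso_left (flipTensorIso sq)]
      exact hasLiftingProperty_of_isDiscAttachment h' h.hn_mem sq.flipTensor hD
  · exact hasLiftingProperty_of_isDiscAttachment h (h'.elim (·.hn_mem) (·.hn_mem)) sq hD

/-- Fixing `f` and `p`, the two-variable adjunction turns the lifting problem for the
pushout-product into one for `g` against a pullback-hom. It therefore suffices to have `g` in the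
generating set. -/
lemma hasLiftingProperty_of_ceCofibrations_right
    (hf : ∀ {A' B' : Bicomplex k} {g : A' ⟶ B'}, ceGeneratingCofibrations k g →
      ∀ sq : (curriedTensor (Bicomplex k)).PushoutObjObj f g, HasLiftingProperty sq.ι p)
    (hg : ceCofibrations k g) (sq : (curriedTensor (Bicomplex k)).PushoutObjObj f g) :
    HasLiftingProperty sq.ι p := by
  let sq' := Functor.PullbackObjObj.ofHasPullback MonoidalClosed.internalHom f p
  rw [MonoidalClosed.internalHomAdjunction₂.hasLiftingProperty_iff sq sq']
  refine hg _ fun _ _ g' hg' => ?_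
  rw [← MonoidalClosed.internalHomAdjunction₂.hasLiftingProperty_iff
    (Functor.PushoutObjObj.ofHasPushout (curriedTensor _) f g') sq']
  exact hf hg' _

/-- The pushout-product axiom for cofibrations. -/
lemma ceCofibrations_pushoutProduct (hf : ceCofibrations k f) (hg : ceCofibrations k g)
    (sq : (curriedTensor (Bicomplex k)).PushoutObjObj f g) : ceCofibrations k sq.ι := by
  intro X Y p hp
  refine hasLiftingProperty_of_ceCofibrations_right (fun hg' sq' => ?_) hg sq
  -- The second variable is now a generator; flipping allows the same reduction for the first.
  rw [HasLiftingProperty.iff_of_arrow_iso_left (flipTensorIso sq')]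
  refine hasLiftingProperty_of_ceCofibrations_right (fun hf' sq'' => ?_) hf sq'.flipTensor
  exact hasLiftingProperty_of_ceGeneratingCofibrations hg' hf' sq'' hp

end

lemma sphere_X_isZero {n : ℕ} {q : ℤ} {i : ℕ × ℤ} (hi : i ∉ (sphere n q).carrier) :
    IsZero (((sphere n q).toBicomplex k).X i) := by
  have : Subsingleton (cellModule k (sphere n q).carrier i) :=
    ⟨fun x y => Subtype.ext ((x.2 hi).trans (y.2 hi).symm)⟩
  exact @ModuleCat.isZero_of_subsingleton _ _
    (ModuleCat.of k (cellModule k (sphere n q).carrier i)) this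

variable (k) in
/-- The submodule `cellModule k S i` is the whole of `k` for `i ∈ S`. -/
def cellModuleEquiv {S : Set (ℕ × ℤ)} {i : ℕ × ℤ} (hi : i ∈ S) : cellModule k S i ≃ₗ[k] k :=
  LinearEquiv.ofTop _ (eq_top_iff.2 fun _ _ h => (h hi).elim)

open scoped Classical in
variable (k) in
/-- The sphere `S^{0, 0}` and the tensor unit are isomorphic in each bidegree. -/
def sphereUnitXIso (i : ℕ × ℤ) : ((sphere 0 1).toBicomplex k).X i ≅ (unit k).X i :=
  if hi : i = 0 then
    (cellModuleEquiv k (S := (sphere 0 1).carrier) (i := i) hi).toModuleIso ≪≫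
      (HomologicalComplex.singleObjXIsoOfEq hShape 0 (𝟙_ (ModuleCat.{u} k)) i hi).symm
  else (sphere_X_isZero (n := 0) (q := 1) hi).iso
    (HomologicalComplex.isZero_single_obj_X hShape 0 (𝟙_ (ModuleCat.{u} k)) i hi)

lemma sphere_unit_hom_eq_zero {i j : ℕ × ℤ} (h : i ≠ j)
    (f : ((sphere 0 1).toBicomplex k).X i ⟶ (unit k).X j) : f = 0 := by
  by_cases hi : i = 0
  · exact (HomologicalComplex.isZero_single_obj_X hShape 0 (𝟙_ (ModuleCat.{u} k)) j
      (fun hj => h (hi.trans hj.symm))).eq_of_tgt _ _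
  · exact (sphere_X_isZero (n := 0) (q := 1) hi).eq_of_src _ _

variable (k) in
/-- The sphere `S^{0, 0}` is the tensor unit. -/
def sphereUnitIso : (sphere 0 1).toBicomplex k ≅ unit k := by
  -- A differential changes the bidegree while both bicomplexes live in bidegree (0, 0) only, so
  -- both sides of every compatibility square vanish. The part `sphere 0 1` is used because `sphere
  -- n q` sits in bidegree `(n, q - 1)`.
  have h : ∀ i j : ℕ × ℤ, hShape.Rel i j ∨ vShape.Rel i j → i ≠ j := by
    rintro i _ h rfl
    simp only [hShape_rel, vShape_rel] at h
    omega
  have hh (i j : ℕ × ℤ) : (sphereUnitXIso k i).hom ≫ (unit k).dh i j =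
      ((sphere 0 1).toBicomplex k).dh i j ≫ (sphereUnitXIso k j).hom := by
    by_cases hr : hShape.Rel i j
    · rw [sphere_unit_hom_eq_zero (h i j (Or.inl hr)) (_ ≫ (unit k).dh i j),
        sphere_unit_hom_eq_zero (h i j (Or.inl hr)) (_ ≫ (sphereUnitXIso k j).hom)]
    · rw [Bicomplex.dh_shape _ _ _ hr, Bicomplex.dh_shape _ _ _ hr, comp_zero, zero_comp]
  have hv (i j : ℕ × ℤ) : (sphereUnitXIso k i).hom ≫ (unit k).dv i j =
      ((sphere 0 1).toBicomplex k).dv i j ≫ (sphereUnitXIso k j).hom := by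
    by_cases hr : vShape.Rel i j
    · rw [sphere_unit_hom_eq_zero (h i j (Or.inr hr)) (_ ≫ (unit k).dv i j),
        sphere_unit_hom_eq_zero (h i j (Or.inr hr)) (_ ≫ (sphereUnitXIso k j).hom)]
    · rw [Bicomplex.dv_shape _ _ _ hr, Bicomplex.dv_shape _ _ _ hr, comp_zero, zero_comp]
  exact
    { hom := { f := fun i => (sphereUnitXIso k i).hom, comm_h := hh, comm_v := hv }
      inv :=
        { f := fun i => (sphereUnitXIso k i).inv
          comm_h := fun i j => (Iso.inv_comp_eq _).2
            (((Iso.eq_comp_inv _).2 (hh i j).symm).trans (Category.assoc _ _ _))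
          comm_v := fun i j => (Iso.inv_comp_eq _).2
            (((Iso.eq_comp_inv _).2 (hv i j).symm).trans (Category.assoc _ _ _)) }
      hom_inv_id := Hom.ext (funext fun i => (sphereUnitXIso k i).hom_inv_id)
      inv_hom_id := Hom.ext (funext fun i => (sphereUnitXIso k i).inv_hom_id) }

section

attribute [local instance] ceModelCategory

variable {A B A' B' X Y : Bicomplex k} {f : A ⟶ B} {g : A' ⟶ B'}

lemma weakEquivalences_whiskerRight (hf : trivialCofibrations (Bicomplex k) f) (Z : Bicomplex k) :
    weakEquivalences (Bicomplex k) (f ▷ Z) :=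
  acyclicEmbeddings_le _ (isAcyclicEmbedding_whiskerRight_of_trivialCofibrations hf Z)

/-- The pushout-product axiom for a trivial cofibration in the first variable. -/
lemma trivialCofibrations_pushoutProduct (hf : trivialCofibrations (Bicomplex k) f)
    (hg : cofibrations (Bicomplex k) g)
    (sq : (curriedTensor (Bicomplex k)).PushoutObjObj f g) :
    trivialCofibrations (Bicomplex k) sq.ι := by
  refine ⟨ceCofibrations_pushoutProduct hf.1 hg sq, ?_⟩
  -- The map `sq.inr` is a cobase change of `f ▷ A'`, and followed by `sq.ι` it is `f ▷ B'`. Both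
  -- are acyclic embeddings, so two-out-of-three applies.
  have h₁ : weakEquivalences (Bicomplex k) sq.inr :=
    acyclicEmbeddings_le _ (MorphismProperty.of_isPushout (P := acyclicEmbeddings k)
      sq.isPushout.flip
      (isAcyclicEmbedding_whiskerRight_of_trivialCofibrations hf A'))
  have h₂ : weakEquivalences (Bicomplex k) (sq.inr ≫ sq.ι) := by
    rw [sq.inr_ι]
    exact weakEquivalences_whiskerRight hf B'
  exact MorphismProperty.of_precomp (weakEquivalences (Bicomplex k)) _ _ h₁ h₂

lemma isCofibrant_unit : IsCofibrant (𝟙_ (Bicomplex k)) := by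
  have hS : IsInitial ((zero 0 1).toBicomplex k) := (isZero_zero 0 1).isInitial
  let f : (zero 0 1).toBicomplex k ⟶ 𝟙_ (Bicomplex k) :=
    incl k (zero_subset (sphere 0 1)) ≫ (sphereUnitIso k).hom
  rw [isCofibrant_iff_of_isInitial f hS, cofibration_iff]
  exact (MorphismProperty.cancel_right_of_respectsIso (cofibrations (Bicomplex k)) _ _).2
    (MorphismProperty.le_llp_rlp _ _ (Or.inl (Or.inl (Or.inl ⟨1⟩))))

/-- Ken Brown's argument: `f` is a trivial cofibration followed by a retraction of another trivial
cofibration, and trivial cofibrations stay weak equivalences after tensoring with any `Z`. Since the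
unit is cofibrant, this yields the unit axiom. -/
lemma weakEquivalences_whiskerRight_of_isCofibrant [IsCofibrant A] [IsCofibrant B]
    (hf : weakEquivalences (Bicomplex k) f) (Z : Bicomplex k) :
    weakEquivalences (Bicomplex k) (f ▷ Z) := by
  obtain ⟨h⟩ : Nonempty (CofibrantBrownFactorization f) := inferInstance
  have : WeakEquivalence f := ⟨hf⟩
  have hi := weakEquivalences_whiskerRight (mem_trivialCofibrations h.i) Z
  have hs := weakEquivalences_whiskerRight (mem_trivialCofibrations h.s) Z
  have hp : weakEquivalences (Bicomplex k) (h.p ▷ Z) := by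
    refine MorphismProperty.of_precomp (weakEquivalences (Bicomplex k)) _ _ hs ?_
    rw [← comp_whiskerRight, h.s_p, id_whiskerRight]
    exact MorphismProperty.id_mem _ _
  rw [← h.fac, comp_whiskerRight]
  exact MorphismProperty.comp_mem _ _ _ hi hp

lemma weakEquivalences_whiskerLeft_iff (Z : Bicomplex k) :
    weakEquivalences (Bicomplex k) (Z ◁ f) ↔ weakEquivalences (Bicomplex k) (f ▷ Z) :=
  (weakEquivalences (Bicomplex k)).arrow_mk_iso_iff
    (Arrow.isoMk (β_ _ _) (β_ _ _) (BraidedCategory.braiding_naturality_right Z f).symm)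

lemma isMonoidalModelCategory_ce : IsMonoidalModelCategory (Bicomplex k) where
  closed := ⟨inferInstance⟩
  cofibrations_pushoutProduct _ _ hf hg sq := ceCofibrations_pushoutProduct hf hg sq
  trivialCofibrations_pushoutProduct_left _ _ hf hg sq :=
    trivialCofibrations_pushoutProduct hf hg sq
  trivialCofibrations_pushoutProduct_right _ _ hf hg sq :=
    ((trivialCofibrations (Bicomplex k)).arrow_mk_iso_iff (flipTensorIso sq)).2
      (trivialCofibrations_pushoutProduct hg hf sq.flipTensor)
  unit_left e he X _ := by
    have := isCofibrant_unit (k := k)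
    exact weakEquivalences_whiskerRight_of_isCofibrant he.2 X
  unit_right e he X _ := by
    have := isCofibrant_unit (k := k)
    exact (weakEquivalences_whiskerLeft_iff X).2
      (weakEquivalences_whiskerRight_of_isCofibrant he.2 X)

end

end Bicomplex

end

theorem mainTheorem5 (k : Type u) [CommRing k] :
    ∃ _ : ModelCategory (Bicomplex k),
      weakEquivalences (Bicomplex k) = Bicomplex.ceWeakEquivalences k ∧
      cofibrations (Bicomplex k) = Bicomplex.ceCofibrations k ∧
      fibrations (Bicomplex k) = Bicomplex.ceFibrations k ∧
      IsMonoidalModelCategory (Bicomplex k) ∧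
      IsCofibrant (𝟙_ (Bicomplex k)) ∧
      MonoidAxiom (Bicomplex k) := by

  exact ⟨Bicomplex.ceModelCategory k, rfl, rfl, rfl, Bicomplex.isMonoidalModelCategory_ce,
    Bicomplex.isCofibrant_unit, Bicomplex.monoidAxiom_ce⟩
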